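/- Let $n\ge 2$ and let $\mathbb{R}^n$ carry its standard inner product $(\cdot,\cdot)$ and standard basis $e_1,\dots,e_n$. Let $\Delta^+=\{e_i\pm e_j\mid 1\le i<j\le n\}\cup\{2e_i\mid 1\le i\le n\}$ be the positive roots of type $C_n$, $\Delta=\Delta^+\cup(-\Delta^+)$, and $\Pi=\{e_1-e_2,\dots,e_{n-1}-e_n,2e_n\}$ the simple roots. For $I\subseteq\Pi$ let $\Delta_I$ be the set of roots in the span of $I$, $\Delta_I^+=\Delta_I\cap\Delta^+$, $$C_I=\{\beta\in\Delta^+\setminus\Delta_I\mid \beta-\alpha\notin\Delta\ \text{ for all } \alpha\in\Delta_I^+\},$$ and, with $H_{\alpha,k}=\{v\in\mathbb{R}^n\mid (v,\alpha)=k\}$, let $\mathrm{Shi}(I)=\{H_{\alpha,0}\mid\alpha\in\Delta^+\}\cup\{H_{\alpha,1}\mid\alpha\in C_I\}$ be the $I$-deleted Shi arrangement. For a finite arrangement $\mathcal{A}$ of affine hyperplanes in $V=\mathbb{R}^n$, let $L(\mathcal{A})$ be the poset of non-empty intersections of members of $\mathcal{A}$ (including $V$ itself), ordered by reverse inclusion,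 with M\"obius function $\mu$, and let $\chi(\mathcal{A},t)=\sum_{x\in L(\mathcal{A})}\mu(V,x)\,t^{\dim x}$ be its characteristic polynomial; the exponents of $\mathcal{A}$ are the roots of $\chi(\mathcal{A},t)$, with multiplicity. The regions of $\mathcal{A}$ are the connected components of $V\setminus\bigcup_{H\in\mathcal{A}}H$. **Theorem.** Let $I\subseteq\Pi$ with $r=|I|$ and $1\le r\le n-1$. 1. Among the sets $I$ of cardinality $r$ with $2e_n\in I$, the polynomial $\chi(\mathrm{Shi}(I),t)$ does not depend on $I$. For such $I$ the multiset of exponents of $\mathrm{Shi}(I)$ is $$\{(2n-2r+1)^{n-r+1},\,2n-2r+3,\,2n-2r+5,\,\dots,\,2n-1\}$$ (the first number has multiplicity $n-r+1$; the other $r-1$ numbers have multiplicity one). The number of regions of $\mathrm{Shi}(I)$ is $(2n-2r+2)^{n-r}\,(2n)!!/(2n-2r)!!$, and the number of bounded regions is $(2n-2r)^{n-r}\,(2n-2)!!/(2n-2r-2)!!$. 2. Among the sets $I$ of cardinality $r$ with $2e_n\notin I$, the polynomial $\chi(\mathrm{Shi}(I),t)$ does not depend on $I$. For such $I$ the multiset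 of exponents of $\mathrm{Shi}(I)$ is $$\{(2n-2r)^{n-r},\,2n-2r+1,\,2n-2r+3,\,\dots,\,2n-1\}$$ (the first number has multiplicity $n-r$; the other $r$ numbers have multiplicity one). The number of regions of $\mathrm{Shi}(I)$ is $(2n-2r+1)^{n-r}\,(2n)!!/(2n-2r)!!$, and the number of bounded regions is $(2n-2r-1)^{n-r}\,(2n-2)!!/(2n-2r-2)!!$. -/

import Mathlib

open scoped Polynomial

namespace ShiDeletion

/-! Affine hyperplane arrangements in a real inner product space. -/

section Arrangement

variable {E : Type*} [NormedAddCommGroup E] [InnerProductSpace ℝ E]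

/-- The affine subspace `{v | (v, α) = k}`. -/
def hyperplane (α : E) (k : ℝ) : AffineSubspace ℝ E where
  carrier := {v | inner ℝ v α = k}
  smul_vsub_vadd_mem' := by
    intro c p₁ p₂ p₃ h₁ h₂ h₃
    simp only [Set.mem_ofPred_eq] at h₁ h₂ h₃ ⊢
    simp [inner_add_left, inner_sub_left, real_inner_smul_left, h₁, h₂, h₃]

open Classical in
/-- The elements of the intersection poset of the arrangement `A`: all non-empty intersections of
members of `A`.  The empty intersection is the whole space. -/
noncomputable def flats (A : Finset (AffineSubspace ℝ E)) : Finset (AffineSubspace ℝ E) :=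
  (A.powerset.image fun B => B.inf id).filter (· ≠ ⊥)

theorem top_mem_flats (A : Finset (AffineSubspace ℝ E)) : (⊤ : AffineSubspace ℝ E) ∈ flats A := by
  classical
  simp only [flats, Finset.mem_filter, Finset.mem_image, Finset.mem_powerset]
  exact ⟨⟨∅, by simp, by simp⟩, top_ne_bot⟩

/-- The intersection poset of `A`, ordered by reverse inclusion. -/
abbrev IntersectionPoset (A : Finset (AffineSubspace ℝ E)) : Type _ :=
  {x : AffineSubspace ℝ E // x ∈ flats A}ᵒᵈ

/-- The affine subspace underlying an element of the intersection poset. -/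
def IntersectionPoset.toSubspace {A : Finset (AffineSubspace ℝ E)} (x : IntersectionPoset A) :
    AffineSubspace ℝ E :=
  (OrderDual.ofDual x).1

/-- The whole space, as the least element of the intersection poset. -/
def IntersectionPoset.whole (A : Finset (AffineSubspace ℝ E)) : IntersectionPoset A :=
  OrderDual.toDual ⟨⊤, top_mem_flats A⟩

open Classical in
noncomputable instance (A : Finset (AffineSubspace ℝ E)) :
    LocallyFiniteOrder (IntersectionPoset A) :=
  Fintype.toLocallyFiniteOrder

open Classical in
/-- The characteristic polynomial `∑ x ∈ L(A), μ(V, x) t ^ dim x`. -/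
noncomputable def charPoly (A : Finset (AffineSubspace ℝ E)) : ℤ[X] :=
  ∑ x : IntersectionPoset A,
    Polynomial.C (IncidenceAlgebra.mu ℤ (IntersectionPoset.whole A) x) *
      Polynomial.X ^ Module.finrank ℝ x.toSubspace.direction

/-- The exponents of `A`: the multiset of (complex) roots of its characteristic polynomial. -/
noncomputable def exponents (A : Finset (AffineSubspace ℝ E)) : Multiset ℂ :=
  (charPoly A).aroots ℂ

/-- The complement of the union of the members of `A`. -/
def complement (A : Finset (AffineSubspace ℝ E)) : Set E :=
  {v | ∀ H ∈ A, v ∉ H}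

/-- The regions of `A`: the connected components of the complement. -/
def regions (A : Finset (AffineSubspace ℝ E)) : Set (Set E) :=
  {R | ∃ v ∈ complement A, R = connectedComponentIn (complement A) v}

/-- The bounded regions of `A`. -/
def boundedRegions (A : Finset (AffineSubspace ℝ E)) : Set (Set E) :=
  {R | R ∈ regions A ∧ Bornology.IsBounded R}

end Arrangement

/-! The root system of type `C_n` in `ℝⁿ` with its standard inner product. -/

/-- The standard basis vector `e_i` of `ℝⁿ`. -/
noncomputable def e {n : ℕ} (i : Fin n) : EuclideanSpace ℝ (Fin n) :=
  EuclideanSpace.single i 1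

open Classical in
/-- The positive roots: `e_i - e_j` and `e_i + e_j` for `i < j`, and `2 e_i`. -/
noncomputable def posRoots (n : ℕ) : Finset (EuclideanSpace ℝ (Fin n)) :=
  ((Finset.univ.filter fun p : Fin n × Fin n => p.1 < p.2).image fun p => e p.1 - e p.2) ∪
  ((Finset.univ.filter fun p : Fin n × Fin n => p.1 < p.2).image fun p => e p.1 + e p.2) ∪
  (Finset.univ.image fun i : Fin n => (2 : ℝ) • e i)

open Classical in
/-- All roots. -/
noncomputable def allRoots (n : ℕ) : Finset (EuclideanSpace ℝ (Fin n)) :=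
  posRoots n ∪ (posRoots n).image fun α => -α

open Classical in
/-- The simple roots: `e_i - e_{i+1}` for `i < n`, and `2 e_n` (indices in `Fin n` start at `0`). -/
noncomputable def simpleRoots (n : ℕ) : Finset (EuclideanSpace ℝ (Fin n)) :=
  ((Finset.univ.filter fun p : Fin n × Fin n => (p.1 : ℕ) + 1 = p.2).image
    fun p => e p.1 - e p.2) ∪
  ((Finset.univ.filter fun i : Fin n => (i : ℕ) + 1 = n).image fun i => (2 : ℝ) • e i)

/-- `Δ_I`, the roots in the span of `I`. -/
def subRoots {n : ℕ} (I : Finset (EuclideanSpace ℝ (Fin n))) :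
    Set (EuclideanSpace ℝ (Fin n)) :=
  {α | α ∈ allRoots n ∧ α ∈ Submodule.span ℝ (I : Set (EuclideanSpace ℝ (Fin n)))}

open Classical in
/-- `C_I`: the positive roots `β` outside `Δ_I` such that `β - α` is not a root for any positive
root `α` in `Δ_I`. -/
noncomputable def shiRoots {n : ℕ} (I : Finset (EuclideanSpace ℝ (Fin n))) :
    Finset (EuclideanSpace ℝ (Fin n)) :=
  (posRoots n).filter fun β =>
    β ∉ subRoots I ∧ ∀ α ∈ posRoots n, α ∈ subRoots I → β - α ∉ allRoots n

open Classical in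
/-- The `I`-deleted Shi arrangement `{H_{α,0} | α ∈ Δ⁺} ∪ {H_{α,1} | α ∈ C_I}`. -/
noncomputable def shi {n : ℕ} (I : Finset (EuclideanSpace ℝ (Fin n))) :
    Finset (AffineSubspace ℝ (EuclideanSpace ℝ (Fin n))) :=
  ((posRoots n).image fun α => hyperplane α 0) ∪ ((shiRoots I).image fun α => hyperplane α 1)

end ShiDeletion

/-! Let `M = omitted I` index the simple roots outside `I`, so `M` has `k = n - r` elements. By
`intVec_mem_shiRoots`, `C_I` consists of `e_m - e_l` (with `m ∈ M` and `l - 1` an element of `M`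
that is at least `m`), `e_m + e_m'` and `2e_m` (with `m, m' ∈ M`).

The characteristic polynomial comes from the finite field method (`exists_card_complement_eq_eval`):
its value at a large prime `p` is the number of points of `F_p^n` off all hyperplanes. Write `p = 2h
+ 1` and arrange the residues on a circle as `0, 1, …, h, -h, …, -1`. Avoiding the hyperplanes at
level 0 means that the letters `±1, …, ±n` occupy distinct nonzero places, symmetrically under
negation. Avoiding those at level 1 means that the place just before a letter `m ∈ M` holds neither
some `-m'` with `m' ∈ M` (`m' = m` included) nor a letter `l` as above.

These placements are counted by taking out the least `m ∈ M` together with `-m` and closing the gaps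
(`card_placements_erase`). Of the `2h - 1` remaining places, `m` may be put back after any except
those of `-m'` for the other `m' ∈ M` and those of the letters in `successors M`. This leaves `2h -
|M| - |successors M|` choices. While elements of `M` remain, a removal lowers `h`, `|M|` and
`|successors M|` by one each, so all `k` steps contribute the same factor: this is the repeated
exponent. The other `r` letters are unconstrained and contribute distinct factors
(`card_placements_of_empty`). The position of `2e_n` matters only through `ζ = |successors M| + 1 -
|M|`, which is 1 if `2e_n ∈ I` and 0 otherwise.

Regions and bounded regions are the values at `-1` and `1` up to sign (Zaslavsky), proved by
deletion and restriction for cells meeting an affine subspace (`cellCount_eq`,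
`boundedCellCount_eq`). -/

namespace ShiDeletion

/-! ### Whitney's expansion of the characteristic polynomial -/

section Whitney

variable {E : Type*} [NormedAddCommGroup E] [InnerProductSpace ℝ E] {ι : Type*}

open Classical in
/-- The monomial `t ^ dim X`, or `0` if `X` is empty. -/
noncomputable def dimMonomial (X : AffineSubspace ℝ E) : ℤ[X] :=
  if X = ⊥ then 0 else Polynomial.X ^ Module.finrank ℝ X.direction

/-- The Whitney sum of a family of affine subspaces, restricted to `X`. -/
noncomputable def whitneySum (H : ι → AffineSubspace ℝ E) (s : Finset ι) (X : AffineSubspace ℝ E) :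
    ℤ[X] :=
  ∑ B ∈ s.powerset, (-1) ^ B.card * dimMonomial (X ⊓ B.inf H)

@[simp]
theorem dimMonomial_bot : dimMonomial (⊥ : AffineSubspace ℝ E) = 0 := by
  simp [dimMonomial]

@[simp]
theorem whitneySum_bot (H : ι → AffineSubspace ℝ E) (s : Finset ι) : whitneySum H s ⊥ = 0 := by
  simp [whitneySum]

@[simp]
theorem whitneySum_empty (H : ι → AffineSubspace ℝ E) (X : AffineSubspace ℝ E) :
    whitneySum H ∅ X = dimMonomial X := by
  simp [whitneySum]

/-- Deletion and restriction: the subfamilies containing `h` are those of `s`, intersected inside `X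
⊓ H h`. Carrying `X` along makes the restricted arrangement an object of the same kind, with no
reindexing. -/
theorem whitneySum_insert [DecidableEq ι] (H : ι → AffineSubspace ℝ E) {s : Finset ι} {h : ι}
    (hs : h ∉ s) (X : AffineSubspace ℝ E) :
    whitneySum H (insert h s) X = whitneySum H s X - whitneySum H s (X ⊓ H h) := by
  unfold whitneySum
  rw [Finset.sum_powerset_insert hs, sub_eq_add_neg, ← Finset.sum_neg_distrib]
  congr 1
  refine Finset.sum_congr rfl fun B hB => ?_
  have hB' : h ∉ B := fun hh => hs (Finset.mem_powerset.1 hB hh)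
  rw [Finset.card_insert_of_notMem hB', Finset.inf_insert, inf_assoc]
  ring

open Classical in
theorem mem_flats_image (H : ι → AffineSubspace ℝ E)
    (s : Finset ι) (x : AffineSubspace ℝ E) :
    x ∈ flats (s.image H) ↔ x ≠ ⊥ ∧ ∃ B ⊆ s, B.inf H = x := by
  classical
  simp only [flats, Finset.mem_filter, Finset.mem_image, Finset.mem_powerset,
    Finset.subset_image_iff]
  constructor
  · rintro ⟨⟨_, ⟨B, hB, rfl⟩, rfl⟩, hx⟩
    refine ⟨hx, B, hB, ?_⟩
    rw [Finset.inf_image]; rfl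
  · rintro ⟨hx, B, hB, rfl⟩
    refine ⟨⟨B.image H, ⟨B, hB, rfl⟩, ?_⟩, hx⟩
    rw [Finset.inf_image]; rfl

-- The subfamilies in question are all subsets of `{i ∈ s | x ≤ H i}`, so the alternating sum
-- vanishes unless that set is empty. As `x` is itself an intersection of members, this happens only
-- for the whole space.
open Classical in
theorem sum_neg_one_pow_card_le (H : ι → AffineSubspace ℝ E)
    (s : Finset ι) (hH : ∀ i ∈ s, H i ≠ ⊤) (x : AffineSubspace ℝ E)
    (hx : x ∈ flats (s.image H)) :
    ∑ B ∈ s.powerset with x ≤ B.inf H, (-1 : ℤ) ^ B.card = if ⊤ = x then 1 else 0 := by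
  classical
  have h1 : {B ∈ s.powerset | x ≤ B.inf H} = (s.filter fun i => x ≤ H i).powerset := by
    ext B
    simp only [Finset.mem_filter, Finset.mem_powerset, Finset.le_inf_iff, Finset.subset_iff]
    exact ⟨fun h i hi => ⟨h.1 hi, h.2 i hi⟩, fun h => ⟨fun i hi => (h hi).1, fun i hi => (h hi).2⟩⟩
  rw [h1, Finset.sum_powerset_neg_one_pow_card]
  obtain ⟨-, B, hB, hBx⟩ := (mem_flats_image H s x).1 hx
  congr 1
  rw [eq_iff_iff, Finset.filter_eq_empty_iff]
  constructor
  · intro h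
    have : B = ∅ := by
      refine Finset.eq_empty_of_forall_notMem fun i hi => h (hB hi) ?_
      exact hBx ▸ Finset.inf_le hi
    simpa [this] using hBx
  · rintro rfl i hi
    exact fun h => hH i hi (top_le_iff.1 h)

-- Both sides satisfy the recursion that defines the Möbius function: summed over all flats
-- containing `x`, the fibres assemble into the sum of `sum_neg_one_pow_card_le`. Injectivity of `H`
-- is not needed, so several equations may describe one hyperplane.
open Classical in
theorem mu_eq_sum_neg_one_pow_card
    (H : ι → AffineSubspace ℝ E) (s : Finset ι) (hH : ∀ i ∈ s, H i ≠ ⊤)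
    (x : IntersectionPoset (s.image H)) :
    IncidenceAlgebra.mu ℤ (IntersectionPoset.whole (s.image H)) x =
      ∑ B ∈ s.powerset with B.inf H = x.toSubspace, (-1 : ℤ) ^ B.card := by
  classical
  have hwf : WellFounded (fun a b : IntersectionPoset (s.image H) => a < b) := wellFounded_lt
  induction x using hwf.induction with
  | _ x ih =>
  have hle : ∀ y, IntersectionPoset.whole (s.image H) ≤ y := fun y =>
    (le_top : y.toSubspace ≤ ⊤)
  have hxle : IntersectionPoset.whole (s.image H) ≤ x := hle x
  have e1 := IncidenceAlgebra.sum_Icc_mu_right (𝕜 := ℤ) (IntersectionPoset.whole (s.image H)) x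
  have e2 := sum_neg_one_pow_card_le H s hH x.toSubspace x.ofDual.2
  have e3 : ∑ y ∈ Finset.Icc (IntersectionPoset.whole (s.image H)) x,
      (∑ B ∈ s.powerset with B.inf H = y.toSubspace, (-1 : ℤ) ^ B.card) =
      ∑ B ∈ s.powerset with x.toSubspace ≤ B.inf H, (-1 : ℤ) ^ B.card := by
    rw [← Finset.sum_fiberwise_of_maps_to (s := {B ∈ s.powerset | x.toSubspace ≤ B.inf H})
      (t := (Finset.Icc (IntersectionPoset.whole (s.image H)) x).image
        IntersectionPoset.toSubspace) (g := fun B => B.inf H)]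
    · rw [Finset.sum_image]
      · refine Finset.sum_congr rfl fun y hy => Finset.sum_congr ?_ fun _ _ => rfl
        ext B
        have hyx : x.toSubspace ≤ y.toSubspace := (Finset.mem_Icc.1 hy).2
        simp only [Finset.mem_filter]
        constructor
        · rintro ⟨h1, h2⟩; exact ⟨⟨h1, h2 ▸ hyx⟩, h2⟩
        · rintro ⟨⟨h1, -⟩, h2⟩; exact ⟨h1, h2⟩
      · intro y _ z _ h
        exact OrderDual.ofDual.injective (Subtype.ext h)
    · intro B hB
      simp only [Finset.mem_filter, Finset.mem_powerset] at hB
      have hx0 := ((mem_flats_image H s _).1 x.ofDual.2).1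
      have hmem : B.inf H ∈ flats (s.image H) := by
        refine (mem_flats_image H s _).2 ⟨?_, B, hB.1, rfl⟩
        intro h
        exact hx0 (le_bot_iff.1 (h ▸ hB.2))
      refine Finset.mem_image.2 ⟨OrderDual.toDual ⟨_, hmem⟩, ?_, rfl⟩
      exact Finset.mem_Icc.2 ⟨hle _, hB.2⟩
  have e4 : (if IntersectionPoset.whole (s.image H) = x then (1 : ℤ) else 0) =
      if ⊤ = x.toSubspace then 1 else 0 := by
    congr 1
    rw [eq_iff_iff]
    constructor
    · rintro rfl; rfl
    · intro h
      exact OrderDual.ofDual.injective (Subtype.ext h)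
  rw [e4, ← e2, ← e3, ← Finset.Ico_insert_right hxle, Finset.sum_insert (by simp),
    Finset.sum_insert (by simp)] at e1
  have e5 := Finset.sum_congr (rfl : Finset.Ico (IntersectionPoset.whole (s.image H)) x = _)
    fun y hy => ih y (Finset.mem_Ico.1 hy).2
  linarith

open Classical in
/-- Whitney's theorem: the characteristic polynomial as a sum over subfamilies. -/
theorem charPoly_image_eq_whitneySum
    (H : ι → AffineSubspace ℝ E) (s : Finset ι) (hH : ∀ i ∈ s, H i ≠ ⊤) :
    charPoly (s.image H) = whitneySum H s ⊤ := by
  classical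
  have h0 : whitneySum H s ⊤ = ∑ B ∈ s.powerset with B.inf H ≠ ⊥,
      (-1 : ℤ[X]) ^ B.card * dimMonomial (B.inf H) := by
    rw [whitneySum, Finset.sum_filter]
    refine Finset.sum_congr rfl fun B _ => ?_
    split_ifs with h
    · simp
    · rw [not_not] at h; simp [h]
  rw [h0, charPoly, ← Finset.sum_fiberwise_of_maps_to (s := {B ∈ s.powerset | B.inf H ≠ ⊥})
    (t := Finset.univ.image (IntersectionPoset.toSubspace (A := s.image H)))
    (g := fun B => B.inf H), Finset.sum_image]
  · refine Finset.sum_congr rfl fun x _ => ?_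
    have hx0 : x.toSubspace ≠ ⊥ := ((mem_flats_image H s _).1 x.ofDual.2).1
    rw [mu_eq_sum_neg_one_pow_card H s hH x, map_sum, Finset.sum_mul]
    refine Finset.sum_congr ?_ fun B hB => ?_
    · ext B
      simp only [Finset.mem_filter]
      constructor
      · rintro ⟨h1, h2⟩; exact ⟨⟨h1, h2 ▸ hx0⟩, h2⟩
      · rintro ⟨⟨h1, -⟩, h2⟩; exact ⟨h1, h2⟩
    · rw [(Finset.mem_filter.1 hB).2, dimMonomial, if_neg hx0]
      simp
  · intro y _ z _ h
    exact OrderDual.ofDual.injective (Subtype.ext h)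
  · intro B hB
    simp only [Finset.mem_filter, Finset.mem_powerset] at hB
    exact Finset.mem_image.2 ⟨OrderDual.toDual ⟨_, (mem_flats_image H s _).2
      ⟨hB.2, B, hB.1, rfl⟩⟩, Finset.mem_univ _, rfl⟩

end Whitney

/-! ### Cells, recession cones and cutting by a hyperplane -/

section Zaslavsky

variable {E : Type*} [NormedAddCommGroup E] [InnerProductSpace ℝ E] {ι : Type*}

theorem mem_hyperplane {α : E} {k : ℝ} {v : E} : v ∈ hyperplane α k ↔ inner ℝ v α = k := Iff.rfl

/-- The set of points lying above the hyperplanes indexed by `P` and below the other ones. -/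
def cell (α : ι → E) (k : ι → ℝ) (s P : Finset ι) : Set E :=
  {v | ∀ i ∈ s, (i ∈ P → k i < inner ℝ v (α i)) ∧ (i ∉ P → inner ℝ v (α i) < k i)}

/-- The recession cone of the closure of a non-empty cell. -/
def recessionCone (α : ι → E) (s P : Finset ι) : Set E :=
  {v | ∀ i ∈ s, (i ∈ P → 0 ≤ inner ℝ v (α i)) ∧ (i ∉ P → inner ℝ v (α i) ≤ 0)}

/-- The directions parallel to all hyperplanes of a family. -/
def lineality (α : ι → E) (s : Finset ι) : Submodule ℝ E where
  carrier := {v | ∀ i ∈ s, inner ℝ v (α i) = 0}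
  add_mem' := by
    intro a b ha hb i hi
    rw [inner_add_left, ha i hi, hb i hi, add_zero]
  zero_mem' := by
    intro i _
    exact inner_zero_left _
  smul_mem' := by
    intro c a ha i hi
    rw [real_inner_smul_left, ha i hi, mul_zero]

theorem mem_lineality {α : ι → E} {s : Finset ι} {v : E} :
    v ∈ lineality α s ↔ ∀ i ∈ s, inner ℝ v (α i) = 0 := Iff.rfl

/-- The cell of `P` meets `X` in a set which is bounded modulo the lineality space. -/
def RelBounded (α : ι → E) (k : ι → ℝ) (s P : Finset ι) (X : AffineSubspace ℝ E) : Prop :=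
  ((X : Set E) ∩ cell α k s P).Nonempty ∧
    ∀ v ∈ X.direction, v ∈ recessionCone α s P → v ∈ lineality α s

theorem isOpen_cell (α : ι → E) (k : ι → ℝ) (s P : Finset ι) : IsOpen (cell α k s P) := by
  have : cell α k s P = ⋂ i ∈ s,
      {v : E | (i ∈ P → k i < inner ℝ v (α i)) ∧ (i ∉ P → inner ℝ v (α i) < k i)} := by
    ext v; simp [cell]
  rw [this]
  refine isOpen_biInter_finset fun i _ => ?_
  by_cases hi : i ∈ P
  · simpa [hi] using isOpen_lt continuous_const (continuous_id.inner continuous_const)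
  · simpa [hi] using isOpen_lt (continuous_id.inner continuous_const) continuous_const

theorem isLinearMap_inner_left (a : E) : IsLinearMap ℝ fun v : E => (inner ℝ v a : ℝ) :=
  ⟨fun _ _ => inner_add_left _ _ _, fun _ _ => real_inner_smul_left _ _ _⟩

theorem convex_cell (α : ι → E) (k : ι → ℝ) (s P : Finset ι) : Convex ℝ (cell α k s P) := by
  have : cell α k s P = ⋂ i ∈ s,
      {v : E | (i ∈ P → k i < inner ℝ v (α i)) ∧ (i ∉ P → inner ℝ v (α i) < k i)} := by
    ext v; simp [cell]
  rw [this]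
  refine convex_iInter₂ fun i _ => ?_
  by_cases hi : i ∈ P
  · simpa [hi] using convex_halfSpace_gt (isLinearMap_inner_left (α i)) (k i)
  · simpa [hi] using convex_halfSpace_lt (isLinearMap_inner_left (α i)) (k i)

theorem add_smul_mem_cell {α : ι → E} {k : ι → ℝ} {s P : Finset ι} {p v : E}
    (hp : p ∈ cell α k s P) (hv : v ∈ recessionCone α s P) {t : ℝ} (ht : 0 ≤ t) :
    p + t • v ∈ cell α k s P := by
  intro i hi
  rw [inner_add_left, real_inner_smul_left]
  refine ⟨fun h => ?_, fun h => ?_⟩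
  · have := mul_nonneg ht ((hv i hi).1 h)
    have := (hp i hi).1 h
    linarith
  · have := mul_nonneg ht (neg_nonneg.2 ((hv i hi).2 h))
    have := (hp i hi).2 h
    linarith

section Insert

variable [DecidableEq ι] {α : ι → E} {k : ι → ℝ} {s P : Finset ι} {h : ι}

theorem mem_cell_insert (hP : h ∉ P) {v : E} :
    v ∈ cell α k (insert h s) P ↔ v ∈ cell α k s P ∧ inner ℝ v (α h) < k h := by
  simp only [cell, Set.mem_ofPred_eq, Finset.forall_mem_insert, hP]
  tauto

theorem mem_cell_insert_insert (hs : h ∉ s) {v : E} :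
    v ∈ cell α k (insert h s) (insert h P) ↔ v ∈ cell α k s P ∧ k h < inner ℝ v (α h) := by
  simp only [cell, Set.mem_ofPred_eq, Finset.forall_mem_insert, Finset.mem_insert_self, not_true,
    false_imp_iff, true_imp_iff, and_true]
  rw [and_comm]
  refine and_congr_left fun _ => forall₂_congr fun i hi => ?_
  have : i ≠ h := fun e => hs (e ▸ hi)
  simp [this]

theorem mem_recessionCone_insert (hP : h ∉ P) {v : E} :
    v ∈ recessionCone α (insert h s) P ↔ v ∈ recessionCone α s P ∧ inner ℝ v (α h) ≤ 0 := by
  simp only [recessionCone, Set.mem_ofPred_eq, Finset.forall_mem_insert, hP]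
  tauto

theorem mem_recessionCone_insert_insert (hs : h ∉ s) {v : E} :
    v ∈ recessionCone α (insert h s) (insert h P) ↔
      v ∈ recessionCone α s P ∧ 0 ≤ inner ℝ v (α h) := by
  simp only [recessionCone, Set.mem_ofPred_eq, Finset.forall_mem_insert, Finset.mem_insert_self,
    not_true, false_imp_iff, true_imp_iff, and_true]
  rw [and_comm]
  refine and_congr_left fun _ => forall₂_congr fun i hi => ?_
  have : i ≠ h := fun e => hs (e ▸ hi)
  simp [this]

theorem mem_lineality_insert {v : E} :
    v ∈ lineality α (insert h s) ↔ inner ℝ v (α h) = 0 ∧ v ∈ lineality α s := by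
  simp only [mem_lineality, Finset.forall_mem_insert]

end Insert

section Cut

variable {α : ι → E} {k : ι → ℝ} {s P : Finset ι} {X : AffineSubspace ℝ E} {a : E} {c : ℝ}

theorem exists_small_shift {p v : E} (hp : p ∈ (X : Set E) ∩ cell α k s P)
    (hv : v ∈ X.direction) : ∃ t : ℝ, 0 < t ∧ p + t • v ∈ (X : Set E) ∩ cell α k s P := by
  have hc : Continuous fun t : ℝ => p + t • v := by fun_prop
  have h0 : (fun t : ℝ => p + t • v) ⁻¹' cell α k s P ∈ nhds (0 : ℝ) :=
    hc.continuousAt.preimage_mem_nhds ((isOpen_cell α k s P).mem_nhds (by simpa using hp.2))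
  have h1 : ∀ᶠ t in nhdsWithin (0 : ℝ) (Set.Ioi 0), p + t • v ∈ cell α k s P :=
    Filter.Eventually.filter_mono nhdsWithin_le_nhds h0
  obtain ⟨t, ht, ht'⟩ := (h1.and self_mem_nhdsWithin).exists
  refine ⟨t, ht', ?_, ht⟩
  have := AffineSubspace.vadd_mem_of_mem_direction (X.direction.smul_mem t hv) hp.1
  rwa [vadd_eq_add, add_comm] at this

theorem exists_direction_pos (ha : ∃ v ∈ X.direction, inner ℝ v a ≠ (0 : ℝ)) :
    ∃ v ∈ X.direction, (0 : ℝ) < inner ℝ v a := by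
  obtain ⟨v, hv, h⟩ := ha
  rcases lt_or_gt_of_ne h with h | h
  · exact ⟨-v, X.direction.neg_mem hv, by rw [inner_neg_left]; linarith⟩
  · exact ⟨v, hv, h⟩

theorem above_of_meets (ha : ∃ v ∈ X.direction, inner ℝ v a ≠ (0 : ℝ)) {p : E}
    (hp : p ∈ (X : Set E) ∩ cell α k s P) (hpc : inner ℝ p a = c) :
    ∃ q ∈ (X : Set E) ∩ cell α k s P, c < inner ℝ q a := by
  obtain ⟨v, hv, h⟩ := exists_direction_pos ha
  obtain ⟨t, ht, hq⟩ := exists_small_shift hp hv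
  refine ⟨_, hq, ?_⟩
  rw [inner_add_left, real_inner_smul_left]
  have := mul_pos ht h
  linarith

theorem below_of_meets (ha : ∃ v ∈ X.direction, inner ℝ v a ≠ (0 : ℝ)) {p : E}
    (hp : p ∈ (X : Set E) ∩ cell α k s P) (hpc : inner ℝ p a = c) :
    ∃ q ∈ (X : Set E) ∩ cell α k s P, inner ℝ q a < c := by
  obtain ⟨v, hv, h⟩ := exists_direction_pos ha
  obtain ⟨t, ht, hq⟩ := exists_small_shift hp (X.direction.neg_mem hv)
  refine ⟨_, hq, ?_⟩
  rw [inner_add_left, real_inner_smul_left, inner_neg_left]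
  have := mul_pos ht h
  linarith

theorem meets_of_above_of_below {p q : E} (hp : p ∈ (X : Set E) ∩ cell α k s P)
    (hpc : c < inner ℝ p a) (hq : q ∈ (X : Set E) ∩ cell α k s P) (hqc : inner ℝ q a < c) :
    ∃ z ∈ (X : Set E) ∩ cell α k s P, inner ℝ z a = c := by
  have hconv : Convex ℝ ((X : Set E) ∩ cell α k s P) := X.convex.inter (convex_cell α k s P)
  have hd : (0 : ℝ) < inner ℝ p a - inner ℝ q a := by linarith
  refine ⟨((c - inner ℝ q a) / (inner ℝ p a - inner ℝ q a)) • p +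
    ((inner ℝ p a - c) / (inner ℝ p a - inner ℝ q a)) • q, hconv hp hq ?_ ?_ ?_, ?_⟩
  · exact div_nonneg (by linarith) hd.le
  · exact div_nonneg (by linarith) hd.le
  · field_simp; ring
  · rw [inner_add_left, real_inner_smul_left, real_inner_smul_left]
    field_simp; ring

theorem add_smul_mem_inter {p v : E} (hp : p ∈ (X : Set E) ∩ cell α k s P)
    (hv : v ∈ X.direction) (hv' : v ∈ recessionCone α s P) {t : ℝ} (ht : 0 ≤ t) :
    p + t • v ∈ (X : Set E) ∩ cell α k s P := by
  refine ⟨?_, add_smul_mem_cell hp.2 hv' ht⟩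
  have := AffineSubspace.vadd_mem_of_mem_direction (X.direction.smul_mem t hv) hp.1
  rwa [vadd_eq_add, add_comm] at this

theorem meets_of_recession_neg {p v : E} (hp : p ∈ (X : Set E) ∩ cell α k s P)
    (hpc : c < inner ℝ p a) (hv : v ∈ X.direction) (hv' : v ∈ recessionCone α s P)
    (hva : inner ℝ v a < (0 : ℝ)) : ∃ z ∈ (X : Set E) ∩ cell α k s P, inner ℝ z a = c := by
  refine ⟨p + ((inner ℝ p a - c) / (-inner ℝ v a)) • v, add_smul_mem_inter hp hv hv'
    (div_nonneg (by linarith) (by linarith)), ?_⟩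
  rw [inner_add_left, real_inner_smul_left]
  have h0 : inner ℝ v a ≠ (0 : ℝ) := hva.ne
  field_simp
  ring

theorem meets_of_recession_pos {p v : E} (hp : p ∈ (X : Set E) ∩ cell α k s P)
    (hpc : inner ℝ p a < c) (hv : v ∈ X.direction) (hv' : v ∈ recessionCone α s P)
    (hva : (0 : ℝ) < inner ℝ v a) : ∃ z ∈ (X : Set E) ∩ cell α k s P, inner ℝ z a = c := by
  refine ⟨p + ((c - inner ℝ p a) / inner ℝ v a) • v, add_smul_mem_inter hp hv hv'
    (div_nonneg (by linarith) (by linarith)), ?_⟩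
  rw [inner_add_left, real_inner_smul_left]
  field_simp
  ring

/-- Two opposite recession directions which are not lineality directions combine to one which is
parallel to `a`. -/
theorem exists_recession_orthogonal {v w : E} (hv : v ∈ X.direction)
    (hv' : v ∈ recessionCone α s P) (hvl : v ∉ lineality α s) (hva : (0 : ℝ) ≤ inner ℝ v a)
    (hw : w ∈ X.direction) (hw' : w ∈ recessionCone α s P) (hwl : w ∉ lineality α s)
    (hwa : inner ℝ w a ≤ (0 : ℝ)) :
    ∃ u ∈ X.direction, u ∈ recessionCone α s P ∧ u ∉ lineality α s ∧ inner ℝ u a = (0 : ℝ) := by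
  rcases hva.eq_or_lt with h0 | hva
  · exact ⟨v, hv, hv', hvl, h0.symm⟩
  rcases hwa.eq_or_lt with h0 | hwa
  · exact ⟨w, hw, hw', hwl, h0⟩
  have hin : ∀ i, inner ℝ ((-inner ℝ w a) • v + (inner ℝ v a) • w) (α i) =
      (-inner ℝ w a) * inner ℝ v (α i) + inner ℝ v a * (inner ℝ w (α i) : ℝ) := fun i => by
    rw [inner_add_left, real_inner_smul_left, real_inner_smul_left]
  have hw0 : (0 : ℝ) < -inner ℝ w a := by linarith
  refine ⟨(-inner ℝ w a) • v + (inner ℝ v a) • w,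
    X.direction.add_mem (X.direction.smul_mem _ hv) (X.direction.smul_mem _ hw), ?_, ?_, ?_⟩
  · intro i hi
    rw [hin]
    refine ⟨fun h => ?_, fun h => ?_⟩
    · exact add_nonneg (mul_nonneg hw0.le ((hv' i hi).1 h)) (mul_nonneg hva.le ((hw' i hi).1 h))
    · exact add_nonpos (mul_nonpos_of_nonneg_of_nonpos hw0.le ((hv' i hi).2 h))
        (mul_nonpos_of_nonneg_of_nonpos hva.le ((hw' i hi).2 h))
  -- The two summands have the same sign and add up to zero, so each vanishes, which would put `v`
  -- in the lineality space.
  · intro hl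
    refine hvl fun i hi => ?_
    have e := hl i hi
    rw [hin] at e
    by_cases h : i ∈ P
    · have h1 := mul_nonneg hw0.le ((hv' i hi).1 h)
      have h2 := mul_nonneg hva.le ((hw' i hi).1 h)
      exact (mul_eq_zero.1 (by linarith : (-inner ℝ w a) * (inner ℝ v (α i) : ℝ) = 0)).resolve_left
        hw0.ne'
    · have h1 := mul_nonpos_of_nonneg_of_nonpos hw0.le ((hv' i hi).2 h)
      have h2 := mul_nonpos_of_nonneg_of_nonpos hva.le ((hw' i hi).2 h)
      exact (mul_eq_zero.1 (by linarith : (-inner ℝ w a) * (inner ℝ v (α i) : ℝ) = 0)).resolve_left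
        hw0.ne'
  · rw [inner_add_left, real_inner_smul_left, real_inner_smul_left]
    ring

end Cut

end Zaslavsky

/-! ### Deletion and restriction for single cells -/

section ZaslavskyCount

variable {E : Type*} [NormedAddCommGroup E] [InnerProductSpace ℝ E] {ι : Type*}

open Classical in
/-- The number of cells of a family meeting `X`. -/
noncomputable def cellCount (α : ι → E) (k : ι → ℝ) (s : Finset ι) (X : AffineSubspace ℝ E) : ℤ :=
  ∑ P ∈ s.powerset, if ((X : Set E) ∩ cell α k s P).Nonempty then 1 else 0

open Classical in
/-- The number of relatively bounded cells of a family meeting `X`. -/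
noncomputable def boundedCellCount (α : ι → E) (k : ι → ℝ) (s : Finset ι)
    (X : AffineSubspace ℝ E) : ℤ :=
  ∑ P ∈ s.powerset, if RelBounded α k s P X then 1 else 0

section Hyperplane

variable {α : ι → E} {k : ι → ℝ} {s P : Finset ι} {h : ι} {X : AffineSubspace ℝ E}

theorem nonempty_inf_hyperplane :
    (((X ⊓ hyperplane (α h) (k h) : AffineSubspace ℝ E) : Set E) ∩ cell α k s P).Nonempty ↔
      ∃ p ∈ (X : Set E) ∩ cell α k s P, inner ℝ p (α h) = k h := by
  constructor
  · rintro ⟨p, ⟨hp1, hp2⟩, hp3⟩; exact ⟨p, ⟨hp1, hp3⟩, hp2⟩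
  · rintro ⟨p, ⟨hp1, hp2⟩, hp3⟩; exact ⟨p, ⟨hp1, hp3⟩, hp2⟩

theorem exists_mem_inf_hyperplane (ha : ∃ v ∈ X.direction, inner ℝ v (α h) ≠ (0 : ℝ))
    (hX : X ≠ ⊥) : ∃ p, p ∈ X ⊓ hyperplane (α h) (k h) := by
  obtain ⟨q, hq⟩ := (AffineSubspace.nonempty_iff_ne_bot X).2 hX
  obtain ⟨v, hv, hva⟩ := ha
  refine ⟨q + ((k h - inner ℝ q (α h)) / inner ℝ v (α h)) • v, ?_, ?_⟩
  · have := AffineSubspace.vadd_mem_of_mem_direction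
      (X.direction.smul_mem ((k h - inner ℝ q (α h)) / inner ℝ v (α h)) hv) hq
    rwa [vadd_eq_add, add_comm] at this
  · change inner ℝ (q + _) (α h) = k h
    rw [inner_add_left, real_inner_smul_left]
    field_simp
    ring

theorem mem_direction_inf_hyperplane (hne : ∃ p, p ∈ X ⊓ hyperplane (α h) (k h)) {v : E} :
    v ∈ (X ⊓ hyperplane (α h) (k h)).direction ↔ v ∈ X.direction ∧ inner ℝ v (α h) = (0 : ℝ) := by
  obtain ⟨p, hp⟩ := hne
  rw [AffineSubspace.direction_inf_of_mem hp.1 hp.2, Submodule.mem_inf]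
  refine and_congr_right fun _ => ?_
  rw [AffineSubspace.mem_direction_iff_eq_vsub_right hp.2]
  have hp2 : inner ℝ p (α h) = k h := hp.2
  constructor
  · rintro ⟨q, hq, rfl⟩
    have hq : inner ℝ q (α h) = k h := hq
    rw [vsub_eq_sub, inner_sub_left, hq, hp2, sub_self]
  · intro hv
    refine ⟨v + p, ?_, by simp⟩
    change inner ℝ (v + p) (α h) = k h
    rw [inner_add_left, hv, hp2, zero_add]

theorem finrank_direction_inf_hyperplane [FiniteDimensional ℝ E]
    (ha : ∃ v ∈ X.direction, inner ℝ v (α h) ≠ (0 : ℝ)) (hX : X ≠ ⊥) :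
    Module.finrank ℝ (X ⊓ hyperplane (α h) (k h)).direction + 1 =
      Module.finrank ℝ X.direction := by
  have hdir := fun v => mem_direction_inf_hyperplane (exists_mem_inf_hyperplane (k := k) ha hX)
    (v := v)
  let f : Module.Dual ℝ X.direction := ((innerₗ E) (α h)).comp X.direction.subtype
  have hf : f ≠ 0 := by
    obtain ⟨v, hv, hva⟩ := ha
    intro h0
    apply hva
    have := LinearMap.congr_fun h0 ⟨v, hv⟩
    rw [real_inner_comm]
    exact this
  rw [← Module.Dual.finrank_ker_add_one_of_ne_zero hf]
  congr 1
  rw [← Submodule.finrank_map_subtype_eq]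
  suffices e : (X ⊓ hyperplane (α h) (k h)).direction =
      Submodule.map X.direction.subtype (LinearMap.ker f) by rw [e]
  ext v
  rw [hdir, Submodule.mem_map]
  constructor
  · rintro ⟨h1, h2⟩
    refine ⟨⟨v, h1⟩, ?_, rfl⟩
    rw [LinearMap.mem_ker]
    change inner ℝ (α h) v = (0 : ℝ)
    rw [real_inner_comm]; exact h2
  · rintro ⟨w, hw, rfl⟩
    refine ⟨w.2, ?_⟩
    rw [LinearMap.mem_ker] at hw
    rw [real_inner_comm]; exact hw

end Hyperplane

section Step

variable [DecidableEq ι] {α : ι → E} {k : ι → ℝ} {s P : Finset ι} {h : ι} {X : AffineSubspace ℝ E}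

theorem nonempty_cell_insert (hP : h ∉ P) :
    ((X : Set E) ∩ cell α k (insert h s) P).Nonempty ↔
      ∃ p ∈ (X : Set E) ∩ cell α k s P, inner ℝ p (α h) < k h := by
  simp only [Set.Nonempty, Set.mem_inter_iff, mem_cell_insert hP, and_assoc]

theorem nonempty_cell_insert_insert (hs : h ∉ s) :
    ((X : Set E) ∩ cell α k (insert h s) (insert h P)).Nonempty ↔
      ∃ p ∈ (X : Set E) ∩ cell α k s P, k h < inner ℝ p (α h) := by
  simp only [Set.Nonempty, Set.mem_inter_iff, mem_cell_insert_insert hs, and_assoc]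

-- If the hyperplane meets the cell inside `X`, small shifts along a transverse direction reach both
-- sides, and the identity reads `1 + 1 = 1 + 1`. Otherwise convexity keeps the cell on one side.
open Classical in
theorem cell_indicator_insert (hs : h ∉ s) (hP : P ⊆ s)
    (ha : ∃ v ∈ X.direction, inner ℝ v (α h) ≠ (0 : ℝ)) :
    ((if ((X : Set E) ∩ cell α k (insert h s) P).Nonempty then 1 else 0) +
      (if ((X : Set E) ∩ cell α k (insert h s) (insert h P)).Nonempty then 1 else 0) : ℤ) =
    (if ((X : Set E) ∩ cell α k s P).Nonempty then 1 else 0) +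
      (if (((X ⊓ hyperplane (α h) (k h) : AffineSubspace ℝ E) : Set E) ∩
        cell α k s P).Nonempty then 1 else 0) := by
  rw [nonempty_cell_insert (fun hh => hs (hP hh)), nonempty_cell_insert_insert hs,
    nonempty_inf_hyperplane]
  by_cases hZ : ∃ p ∈ (X : Set E) ∩ cell α k s P, inner ℝ p (α h) = k h
  · obtain ⟨p, hp, hpc⟩ := hZ
    rw [if_pos (below_of_meets ha hp hpc), if_pos (above_of_meets ha hp hpc),
      if_pos ⟨p, hp⟩, if_pos ⟨p, hp, hpc⟩]
  · rw [if_neg hZ]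
    by_cases hN : ∃ p ∈ (X : Set E) ∩ cell α k s P, inner ℝ p (α h) < k h
    · by_cases hQ : ∃ p ∈ (X : Set E) ∩ cell α k s P, k h < inner ℝ p (α h)
      · obtain ⟨p, hp, hpc⟩ := hN
        obtain ⟨q, hq, hqc⟩ := hQ
        exact absurd (meets_of_above_of_below hq hqc hp hpc) hZ
      · obtain ⟨p, hp, -⟩ := id hN
        rw [if_pos hN, if_neg hQ, if_pos ⟨p, hp⟩]
    · by_cases hQ : ∃ p ∈ (X : Set E) ∩ cell α k s P, k h < inner ℝ p (α h)
      · obtain ⟨p, hp, -⟩ := id hQ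
        rw [if_pos hQ, if_neg hN, if_pos ⟨p, hp⟩]; rfl
      · rw [if_neg hQ, if_neg hN, if_neg]
        rintro ⟨p, hp⟩
        rcases lt_trichotomy (inner ℝ p (α h)) (k h) with h1 | h1 | h1
        · exact hN ⟨p, hp, h1⟩
        · exact hZ ⟨p, hp, h1⟩
        · exact hQ ⟨p, hp, h1⟩

-- Call a recession direction bad if it is not in the lineality space. With no bad direction this is
-- `cell_indicator_insert`. If bad directions point to one side only, the half cell on the other
-- side is relatively bounded once nonempty, and it is nonempty exactly when the section is, because
-- a bad direction leads from it across the hyperplane. If they point to both sides,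
-- `exists_recession_orthogonal` makes one that is parallel to the hyperplane, and nothing is
-- counted. The hypothesis `hl` keeps the lineality space within `X.direction` unchanged.
open Classical in
theorem relBounded_indicator_insert (hs : h ∉ s) (hP : P ⊆ s) (hX : X ≠ ⊥)
    (ha : ∃ v ∈ X.direction, inner ℝ v (α h) ≠ (0 : ℝ))
    (hl : ∀ v ∈ X.direction, v ∈ lineality α s → inner ℝ v (α h) = (0 : ℝ)) :
    ((if RelBounded α k (insert h s) P X then 1 else 0) +
      (if RelBounded α k (insert h s) (insert h P) X then 1 else 0) : ℤ) =
    (if RelBounded α k s P X then 1 else 0) +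
      (if RelBounded α k s P (X ⊓ hyperplane (α h) (k h)) then 1 else 0) := by
  have hhP : h ∉ P := fun hh => hs (hP hh)
  have hdir := fun v => mem_direction_inf_hyperplane (exists_mem_inf_hyperplane (k := k) ha hX)
    (v := v)
  have key := cell_indicator_insert (k := k) hs hP ha
  have eN : RelBounded α k (insert h s) P X ↔
      ((X : Set E) ∩ cell α k (insert h s) P).Nonempty ∧ ∀ v ∈ X.direction,
        v ∈ recessionCone α s P → inner ℝ v (α h) ≤ (0 : ℝ) → v ∈ lineality α s := by
    refine and_congr_right fun _ => forall₂_congr fun v hv => ?_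
    rw [mem_recessionCone_insert hhP, mem_lineality_insert, and_imp]
    exact ⟨fun H h1 h2 => (H h1 h2).2, fun H h1 h2 => ⟨hl v hv (H h1 h2), H h1 h2⟩⟩
  have eQ : RelBounded α k (insert h s) (insert h P) X ↔
      ((X : Set E) ∩ cell α k (insert h s) (insert h P)).Nonempty ∧ ∀ v ∈ X.direction,
        v ∈ recessionCone α s P → (0 : ℝ) ≤ inner ℝ v (α h) → v ∈ lineality α s := by
    refine and_congr_right fun _ => forall₂_congr fun v hv => ?_
    rw [mem_recessionCone_insert_insert hs, mem_lineality_insert, and_imp]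
    exact ⟨fun H h1 h2 => (H h1 h2).2, fun H h1 h2 => ⟨hl v hv (H h1 h2), H h1 h2⟩⟩
  have eZ : RelBounded α k s P (X ⊓ hyperplane (α h) (k h)) ↔
      (((X ⊓ hyperplane (α h) (k h) : AffineSubspace ℝ E) : Set E) ∩
        cell α k s P).Nonempty ∧ ∀ v ∈ X.direction,
        v ∈ recessionCone α s P → inner ℝ v (α h) = (0 : ℝ) → v ∈ lineality α s := by
    refine and_congr_right fun _ => forall_congr' fun v => ?_
    rw [hdir, and_imp]
    exact forall_congr' fun _ => ⟨fun H h1 h2 => H h2 h1, fun H h1 h2 => H h2 h1⟩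
  have eX : RelBounded α k s P X ↔ ((X : Set E) ∩ cell α k s P).Nonempty ∧
      ∀ v ∈ X.direction, v ∈ recessionCone α s P → v ∈ lineality α s := Iff.rfl
  rw [nonempty_cell_insert hhP] at eN key
  rw [nonempty_cell_insert_insert hs] at eQ key
  rw [nonempty_inf_hyperplane] at eZ key
  by_cases hC : ∀ v ∈ X.direction, v ∈ recessionCone α s P → v ∈ lineality α s
  · rw [and_iff_left fun v hv hv' _ => hC v hv hv'] at eN eQ eZ
    rw [and_iff_left hC] at eX
    rw [if_congr eN rfl rfl, if_congr eQ rfl rfl, if_congr eX rfl rfl, if_congr eZ rfl rfl]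
    exact key
  rw [if_neg (fun hh => hC (eX.1 hh).2), zero_add]
  by_cases hCN : ∀ v ∈ X.direction, v ∈ recessionCone α s P → inner ℝ v (α h) ≤ (0 : ℝ) →
      v ∈ lineality α s
  · have hCQ : ¬ ∀ v ∈ X.direction, v ∈ recessionCone α s P → (0 : ℝ) ≤ inner ℝ v (α h) →
        v ∈ lineality α s := fun hCQ => hC fun v hv hv' =>
      (le_total (inner ℝ v (α h)) 0).elim (hCN v hv hv') (hCQ v hv hv')
    rw [if_neg (fun hh => hCQ (eQ.1 hh).2), add_zero]
    refine if_congr ?_ rfl rfl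
    rw [eN, eZ, and_iff_left hCN, and_iff_left fun v hv hv' h0 => hCN v hv hv' h0.le]
    constructor
    · rintro ⟨p, hp, hpc⟩
      push Not at hCQ
      obtain ⟨v, hv, hv', hva, hvl⟩ := hCQ
      refine meets_of_recession_pos hp hpc hv hv' (lt_of_le_of_ne hva fun h0 => hvl ?_)
      exact hCN v hv hv' h0.symm.le
    · rintro ⟨p, hp, hpc⟩
      exact below_of_meets ha hp hpc
  rw [if_neg (fun hh => hCN (eN.1 hh).2), zero_add]
  by_cases hCQ : ∀ v ∈ X.direction, v ∈ recessionCone α s P → (0 : ℝ) ≤ inner ℝ v (α h) →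
        v ∈ lineality α s
  · refine if_congr ?_ rfl rfl
    rw [eQ, eZ, and_iff_left hCQ, and_iff_left fun v hv hv' h0 => hCQ v hv hv' h0.ge]
    constructor
    · rintro ⟨p, hp, hpc⟩
      push Not at hCN
      obtain ⟨v, hv, hv', hva, hvl⟩ := hCN
      refine meets_of_recession_neg hp hpc hv hv' (lt_of_le_of_ne hva fun h0 => hvl ?_)
      exact hCQ v hv hv' h0.ge
    · rintro ⟨p, hp, hpc⟩
      exact above_of_meets ha hp hpc
  rw [if_neg (fun hh => hCQ (eQ.1 hh).2), if_neg]
  intro hZ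
  push Not at hCN hCQ
  obtain ⟨v, hv, hv', hva, hvl⟩ := hCQ
  obtain ⟨w, hw, hw', hwa, hwl⟩ := hCN
  obtain ⟨u, hu, hu', hul, hua⟩ := exists_recession_orthogonal hv hv' hvl hva hw hw' hwl hwa
  exact hul ((eZ.1 hZ).2 u hu hu' hua)

end Step

end ZaslavskyCount

/-! ### Zaslavsky's formulas by induction on the family -/

section ZaslavskyFormula

variable {E : Type*} [NormedAddCommGroup E] [InnerProductSpace ℝ E] {ι : Type*}
  {α : ι → E} {k : ι → ℝ} {s P : Finset ι} {h : ι} {X : AffineSubspace ℝ E}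

@[simp]
theorem cellCount_bot : cellCount α k s ⊥ = 0 := by
  simp [cellCount]

@[simp]
theorem boundedCellCount_bot : boundedCellCount α k s ⊥ = 0 := by
  simp [boundedCellCount, RelBounded]

theorem cellCount_empty (hX : X ≠ ⊥) : cellCount α k ∅ X = 1 := by
  have : (X : Set E).Nonempty := (AffineSubspace.nonempty_iff_ne_bot X).2 hX
  simp [cellCount, cell, this]

theorem boundedCellCount_empty (hX : X ≠ ⊥) : boundedCellCount α k ∅ X = 1 := by
  have : (X : Set E).Nonempty := (AffineSubspace.nonempty_iff_ne_bot X).2 hX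
  simp [boundedCellCount, RelBounded, cell, this, mem_lineality]

theorem inner_eq_of_direction (ha : ∀ v ∈ X.direction, inner ℝ v (α h) = (0 : ℝ)) {p q : E}
    (hp : p ∈ X) (hq : q ∈ X) : (inner ℝ p (α h) : ℝ) = inner ℝ q (α h) := by
  have := ha _ (AffineSubspace.vsub_mem_direction hp hq)
  rw [vsub_eq_sub, inner_sub_left] at this
  linarith

section Recursion

variable [DecidableEq ι]

theorem cellCount_insert (hs : h ∉ s) (ha : ∃ v ∈ X.direction, inner ℝ v (α h) ≠ (0 : ℝ)) :
    cellCount α k (insert h s) X =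
      cellCount α k s X + cellCount α k s (X ⊓ hyperplane (α h) (k h)) := by
  unfold cellCount
  rw [Finset.sum_powerset_insert hs, ← Finset.sum_add_distrib, ← Finset.sum_add_distrib]
  exact Finset.sum_congr rfl fun P hP => cell_indicator_insert hs (Finset.mem_powerset.1 hP) ha

theorem boundedCellCount_insert (hs : h ∉ s) (hX : X ≠ ⊥)
    (ha : ∃ v ∈ X.direction, inner ℝ v (α h) ≠ (0 : ℝ))
    (hl : ∀ v ∈ X.direction, v ∈ lineality α s → inner ℝ v (α h) = (0 : ℝ)) :
    boundedCellCount α k (insert h s) X =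
      boundedCellCount α k s X + boundedCellCount α k s (X ⊓ hyperplane (α h) (k h)) := by
  unfold boundedCellCount
  rw [Finset.sum_powerset_insert hs, ← Finset.sum_add_distrib, ← Finset.sum_add_distrib]
  exact Finset.sum_congr rfl fun P hP =>
    relBounded_indicator_insert hs (Finset.mem_powerset.1 hP) hX ha hl

theorem cell_insert_eq_empty_of_le (hs : h ∉ s) (hP : P ⊆ s)
    (hX : X ≤ hyperplane (α h) (k h)) :
    ¬ ((X : Set E) ∩ cell α k (insert h s) P).Nonempty ∧
      ¬ ((X : Set E) ∩ cell α k (insert h s) (insert h P)).Nonempty := by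
  rw [nonempty_cell_insert (fun hh => hs (hP hh)), nonempty_cell_insert_insert hs]
  constructor
  · rintro ⟨p, hp, hpc⟩; exact hpc.ne (hX hp.1)
  · rintro ⟨p, hp, hpc⟩; exact hpc.ne' (hX hp.1)

theorem cellCount_insert_of_le (hs : h ∉ s) (hX : X ≤ hyperplane (α h) (k h)) :
    cellCount α k (insert h s) X = 0 := by
  unfold cellCount
  rw [Finset.sum_powerset_insert hs, ← Finset.sum_add_distrib]
  refine Finset.sum_eq_zero fun P hP => ?_
  have := cell_insert_eq_empty_of_le hs (Finset.mem_powerset.1 hP) hX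
  rw [if_neg this.1, if_neg this.2, add_zero]

theorem boundedCellCount_insert_of_le (hs : h ∉ s) (hX : X ≤ hyperplane (α h) (k h)) :
    boundedCellCount α k (insert h s) X = 0 := by
  unfold boundedCellCount
  rw [Finset.sum_powerset_insert hs, ← Finset.sum_add_distrib]
  refine Finset.sum_eq_zero fun P hP => ?_
  have := cell_insert_eq_empty_of_le hs (Finset.mem_powerset.1 hP) hX
  rw [if_neg (fun hh => this.1 hh.1), if_neg (fun hh => this.2 hh.1), add_zero]

theorem relBounded_parallel (hs : h ∉ s) (hP : P ⊆ s)
    (ha : ∀ v ∈ X.direction, inner ℝ v (α h) = (0 : ℝ)) {p : E} (hp : p ∈ X) :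
    (inner ℝ p (α h) < k h →
      ((((X : Set E) ∩ cell α k (insert h s) P).Nonempty ↔
          ((X : Set E) ∩ cell α k s P).Nonempty) ∧
        (RelBounded α k (insert h s) P X ↔ RelBounded α k s P X) ∧
        ¬ ((X : Set E) ∩ cell α k (insert h s) (insert h P)).Nonempty)) ∧
    (k h < inner ℝ p (α h) →
      ((((X : Set E) ∩ cell α k (insert h s) (insert h P)).Nonempty ↔
          ((X : Set E) ∩ cell α k s P).Nonempty) ∧
        (RelBounded α k (insert h s) (insert h P) X ↔ RelBounded α k s P X) ∧
        ¬ ((X : Set E) ∩ cell α k (insert h s) P).Nonempty)) := by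
  have hhP : h ∉ P := fun hh => hs (hP hh)
  have hl : ∀ v ∈ X.direction, v ∈ lineality α (insert h s) ↔ v ∈ lineality α s := fun v hv => by
    rw [mem_lineality_insert, ha v hv]; simp
  have hr : ∀ v ∈ X.direction, v ∈ recessionCone α (insert h s) P ↔ v ∈ recessionCone α s P :=
    fun v hv => by rw [mem_recessionCone_insert hhP, ha v hv]; simp
  have hr' : ∀ v ∈ X.direction,
      v ∈ recessionCone α (insert h s) (insert h P) ↔ v ∈ recessionCone α s P :=
    fun v hv => by rw [mem_recessionCone_insert_insert hs, ha v hv]; simp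
  constructor
  · intro hk
    have h1 : ((X : Set E) ∩ cell α k (insert h s) P).Nonempty ↔
        ((X : Set E) ∩ cell α k s P).Nonempty := by
      rw [nonempty_cell_insert hhP]
      exact ⟨fun ⟨q, hq, _⟩ => ⟨q, hq⟩,
        fun ⟨q, hq⟩ => ⟨q, hq, (inner_eq_of_direction ha hq.1 hp).trans_lt hk⟩⟩
    refine ⟨h1, and_congr h1 (forall₂_congr fun v hv => ?_), ?_⟩
    · rw [hl v hv, hr v hv]
    · rw [nonempty_cell_insert_insert hs]
      rintro ⟨q, hq, hqc⟩
      exact (hqc.trans_eq (inner_eq_of_direction ha hq.1 hp)).not_gt hk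
  · intro hk
    have h1 : ((X : Set E) ∩ cell α k (insert h s) (insert h P)).Nonempty ↔
        ((X : Set E) ∩ cell α k s P).Nonempty := by
      rw [nonempty_cell_insert_insert hs]
      exact ⟨fun ⟨q, hq, _⟩ => ⟨q, hq⟩,
        fun ⟨q, hq⟩ => ⟨q, hq, hk.trans_eq (inner_eq_of_direction ha hp hq.1)⟩⟩
    refine ⟨h1, and_congr h1 (forall₂_congr fun v hv => ?_), ?_⟩
    · rw [hl v hv, hr' v hv]
    · rw [nonempty_cell_insert hhP]
      rintro ⟨q, hq, hqc⟩
      exact ((inner_eq_of_direction ha hp hq.1).trans_lt hqc).not_gt hk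

theorem cellCount_insert_of_parallel (hs : h ∉ s)
    (ha : ∀ v ∈ X.direction, inner ℝ v (α h) = (0 : ℝ)) {p : E} (hp : p ∈ X)
    (hpk : inner ℝ p (α h) ≠ k h) :
    cellCount α k (insert h s) X = cellCount α k s X := by
  classical
  unfold cellCount
  rw [Finset.sum_powerset_insert hs, ← Finset.sum_add_distrib]
  refine Finset.sum_congr rfl fun P hP => ?_
  have key := relBounded_parallel (k := k) hs (Finset.mem_powerset.1 hP) ha hp
  rcases lt_or_gt_of_ne hpk with h1 | h1
  · rw [if_congr (key.1 h1).1 rfl rfl, if_neg (key.1 h1).2.2, add_zero]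
  · rw [if_congr (key.2 h1).1 rfl rfl, if_neg (key.2 h1).2.2, zero_add]

theorem boundedCellCount_insert_of_parallel (hs : h ∉ s)
    (ha : ∀ v ∈ X.direction, inner ℝ v (α h) = (0 : ℝ)) {p : E} (hp : p ∈ X)
    (hpk : inner ℝ p (α h) ≠ k h) :
    boundedCellCount α k (insert h s) X = boundedCellCount α k s X := by
  classical
  unfold boundedCellCount
  rw [Finset.sum_powerset_insert hs, ← Finset.sum_add_distrib]
  refine Finset.sum_congr rfl fun P hP => ?_
  have key := relBounded_parallel (k := k) hs (Finset.mem_powerset.1 hP) ha hp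
  rcases lt_or_gt_of_ne hpk with h1 | h1
  · have h2 : ¬ RelBounded α k (insert h s) (insert h P) X := fun hh => (key.1 h1).2.2 hh.1
    rw [if_congr (key.1 h1).2.1 rfl rfl, if_neg h2, add_zero]
  · have h2 : ¬ RelBounded α k (insert h s) P X := fun hh => (key.2 h1).2.2 hh.1
    rw [if_congr (key.2 h1).2.1 rfl rfl, if_neg h2, zero_add]

/-- The direction `v` is parallel to every hyperplane of `s` but crosses the new one, so `v` or `-v`
is a recession direction of any cell and is not a lineality direction. -/
theorem boundedCellCount_insert_of_coloop (hs : h ∉ s)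
    (hl : ∃ v ∈ X.direction, v ∈ lineality α s ∧ inner ℝ v (α h) ≠ (0 : ℝ)) :
    boundedCellCount α k (insert h s) X = 0 := by
  obtain ⟨v, hv, hvl, hva⟩ := hl
  have hmem : ∀ Q : Finset ι, ∃ w ∈ X.direction,
      w ∈ recessionCone α (insert h s) Q ∧ w ∉ lineality α (insert h s) := by
    intro Q
    have hneg : ∀ i ∈ s, inner ℝ (-v) (α i) = (0 : ℝ) := fun i hi => by
      rw [inner_neg_left, hvl i hi, neg_zero]
    have hmain : ∀ w ∈ X.direction, (∀ i ∈ s, inner ℝ w (α i) = (0 : ℝ)) →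
        inner ℝ w (α h) ≠ (0 : ℝ) → ((h ∈ Q → (0 : ℝ) ≤ inner ℝ w (α h)) ∧
          (h ∉ Q → inner ℝ w (α h) ≤ (0 : ℝ))) → ∃ w ∈ X.direction,
      w ∈ recessionCone α (insert h s) Q ∧ w ∉ lineality α (insert h s) := by
      intro w hw hw0 hwa hQ
      refine ⟨w, hw, ?_, fun hh => hwa (mem_lineality_insert.1 hh).1⟩
      intro i hi
      rcases Finset.mem_insert.1 hi with rfl | hi
      · exact hQ
      · rw [hw0 i hi]; simp
    have hva' : inner ℝ (-v) (α h) ≠ (0 : ℝ) := by rw [inner_neg_left]; exact neg_ne_zero.2 hva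
    by_cases hQ : h ∈ Q <;> rcases lt_or_gt_of_ne hva with h1 | h1
    · exact hmain _ (X.direction.neg_mem hv) hneg hva' (by simp [hQ, h1.le])
    · exact hmain _ hv hvl hva (by simp [hQ, h1.le])
    · exact hmain _ hv hvl hva (by simp [hQ, h1.le])
    · exact hmain _ (X.direction.neg_mem hv) hneg hva' (by simp [hQ, h1.le])
  refine Finset.sum_eq_zero fun Q _ => if_neg fun hQ => ?_
  obtain ⟨w, hw, hw1, hw2⟩ := hmem Q
  exact hw2 (hQ.2 w hw hw1)

end Recursion

theorem inf_hyperplane_eq_bot_of_parallel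
    (ha : ∀ v ∈ X.direction, inner ℝ v (α h) = (0 : ℝ)) {p : E} (hp : p ∈ X)
    (hpk : inner ℝ p (α h) ≠ k h) : X ⊓ hyperplane (α h) (k h) = ⊥ := by
  by_contra hne
  obtain ⟨q, hq⟩ := (AffineSubspace.nonempty_iff_ne_bot _).2 hne
  exact hpk ((inner_eq_of_direction ha hp hq.1).trans hq.2)

theorem le_hyperplane_of_parallel
    (ha : ∀ v ∈ X.direction, inner ℝ v (α h) = (0 : ℝ)) {p : E} (hp : p ∈ X)
    (hpk : inner ℝ p (α h) = k h) : X ≤ hyperplane (α h) (k h) :=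
  fun _ hq => (inner_eq_of_direction ha hq hp).trans hpk

/-- Zaslavsky's formula for the number of cells. -/
theorem cellCount_eq [FiniteDimensional ℝ E] (α : ι → E) (k : ι → ℝ) (s : Finset ι)
    (X : AffineSubspace ℝ E) :
    cellCount α k s X = (-1) ^ Module.finrank ℝ X.direction *
      (whitneySum (fun i => hyperplane (α i) (k i)) s X).eval (-1) := by
  classical
  induction s using Finset.induction_on generalizing X with
  | empty =>
    by_cases hX : X = ⊥
    · simp [hX]
    · rw [cellCount_empty hX, whitneySum_empty, dimMonomial, if_neg hX, Polynomial.eval_pow,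
        Polynomial.eval_X, ← mul_pow]
      norm_num
  | insert h s hs ih =>
    by_cases hX : X = ⊥
    · simp [hX]
    rw [whitneySum_insert _ hs]
    by_cases ha : ∃ v ∈ X.direction, inner ℝ v (α h) ≠ (0 : ℝ)
    · rw [cellCount_insert hs ha, ih, ih, ← finrank_direction_inf_hyperplane (k := k) ha hX,
        Polynomial.eval_sub]
      ring
    · push Not at ha
      obtain ⟨p, hp⟩ := (AffineSubspace.nonempty_iff_ne_bot X).2 hX
      by_cases hpk : inner ℝ p (α h) = k h
      · have hle := le_hyperplane_of_parallel ha hp hpk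
        rw [cellCount_insert_of_le hs hle, inf_eq_left.2 hle]
        simp
      · rw [cellCount_insert_of_parallel hs ha hp hpk, ih,
          inf_hyperplane_eq_bot_of_parallel ha hp hpk]
        simp

/-- Each nonempty intersection contains the direction `v`, hence loses exactly one dimension when
cut by a hyperplane transverse to `v`. -/
theorem whitneySum_eq_X_mul [FiniteDimensional ℝ E] {a : E} {c : ℝ} (s : Finset ι)
    {v : E} (hv : v ∈ X.direction) (hvl : v ∈ lineality α s) (hva : inner ℝ v a ≠ (0 : ℝ)) :
    whitneySum (fun i => hyperplane (α i) (k i)) s X =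
      Polynomial.X * whitneySum (fun i => hyperplane (α i) (k i)) s (X ⊓ hyperplane a c) := by
  classical
  induction s using Finset.induction_on generalizing X with
  | empty =>
    by_cases hX : X = ⊥
    · simp [hX]
    have e := finrank_direction_inf_hyperplane (α := fun _ : Unit => a) (k := fun _ => c)
      (h := ()) ⟨v, hv, hva⟩ hX
    obtain ⟨p, hp⟩ := exists_mem_inf_hyperplane (α := fun _ : Unit => a) (k := fun _ => c)
      (h := ()) ⟨v, hv, hva⟩ hX
    have hX' : X ⊓ hyperplane a c ≠ ⊥ := (AffineSubspace.nonempty_iff_ne_bot _).1 ⟨p, hp⟩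
    rw [whitneySum_empty, whitneySum_empty, dimMonomial, dimMonomial, if_neg hX, if_neg hX', ← e]
    ring
  | insert h s hs ih =>
    rw [mem_lineality_insert] at hvl
    rw [whitneySum_insert _ hs, whitneySum_insert _ hs, ih hv hvl.2, inf_right_comm]
    by_cases hY : X ⊓ hyperplane (α h) (k h) = ⊥
    · rw [hY]; simp
    · rw [ih (X := X ⊓ hyperplane (α h) (k h)) _ hvl.2, mul_sub]
      exact (mem_direction_inf_hyperplane ((AffineSubspace.nonempty_iff_ne_bot _).2 hY)).2
        ⟨hv, hvl.1⟩

/-- Zaslavsky's formula for the number of relatively bounded cells. -/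
theorem boundedCellCount_eq [FiniteDimensional ℝ E] (α : ι → E) (k : ι → ℝ) (s : Finset ι)
    (X : AffineSubspace ℝ E) :
    boundedCellCount α k s X =
      (-1) ^ (Module.finrank ℝ X.direction +
        Module.finrank ℝ (X.direction ⊓ lineality α s : Submodule ℝ E)) *
      (whitneySum (fun i => hyperplane (α i) (k i)) s X).eval 1 := by
  classical
  induction s using Finset.induction_on generalizing X with
  | empty =>
    by_cases hX : X = ⊥
    · simp [hX]
    · have : lineality α ∅ = ⊤ := by
        ext v; simp [mem_lineality]
      rw [boundedCellCount_empty hX, whitneySum_empty, dimMonomial, if_neg hX, this, inf_top_eq,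
        Polynomial.eval_pow, Polynomial.eval_X, one_pow, mul_one, Even.neg_one_pow ⟨_, rfl⟩]
  | insert h s hs ih =>
    by_cases hX : X = ⊥
    · simp [hX]
    rw [whitneySum_insert _ hs]
    by_cases ha : ∃ v ∈ X.direction, inner ℝ v (α h) ≠ (0 : ℝ)
    · by_cases hl : ∃ v ∈ X.direction, v ∈ lineality α s ∧ inner ℝ v (α h) ≠ (0 : ℝ)
      · rw [boundedCellCount_insert_of_coloop hs hl]
        obtain ⟨v, hv, hvl, hva⟩ := hl
        -- Deletion minus restriction is now `X - 1` times the restriction, which vanishes at `1`.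
        rw [whitneySum_eq_X_mul (c := k h) s hv hvl hva]
        simp
      · push Not at hl
        have e1 : X.direction ⊓ lineality α (insert h s) = X.direction ⊓ lineality α s := by
          ext v
          simp only [Submodule.mem_inf, mem_lineality_insert]
          exact and_congr_right fun hv => ⟨fun hh => hh.2, fun hh => ⟨hl v hv hh, hh⟩⟩
        have e2 : (X ⊓ hyperplane (α h) (k h)).direction ⊓ lineality α s =
            X.direction ⊓ lineality α s := by
          ext v
          simp only [Submodule.mem_inf,
            mem_direction_inf_hyperplane (exists_mem_inf_hyperplane (k := k) ha hX)]
          exact ⟨fun hh => ⟨hh.1.1, hh.2⟩, fun hh => ⟨⟨hh.1, hl v hh.1 hh.2⟩, hh.2⟩⟩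
        rw [boundedCellCount_insert hs hX ha hl, ih, ih, e1, e2,
          ← finrank_direction_inf_hyperplane (k := k) ha hX, Polynomial.eval_sub]
        ring
    · push Not at ha
      obtain ⟨p, hp⟩ := (AffineSubspace.nonempty_iff_ne_bot X).2 hX
      have e1 : X.direction ⊓ lineality α (insert h s) = X.direction ⊓ lineality α s := by
        ext v
        simp only [Submodule.mem_inf, mem_lineality_insert]
        exact and_congr_right fun hv => ⟨fun hh => hh.2, fun hh => ⟨ha v hv, hh⟩⟩
      by_cases hpk : inner ℝ p (α h) = k h
      · have hle := le_hyperplane_of_parallel ha hp hpk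
        rw [boundedCellCount_insert_of_le hs hle, inf_eq_left.2 hle]
        simp
      · rw [boundedCellCount_insert_of_parallel hs ha hp hpk, ih, e1,
          inf_hyperplane_eq_bot_of_parallel ha hp hpk]
        simp

end ZaslavskyFormula

/-! ### Regions as cells, bounded regions as relatively bounded cells -/

section Regions

variable {E : Type*} [NormedAddCommGroup E] [InnerProductSpace ℝ E] {ι : Type*}
  {α : ι → E} {k : ι → ℝ} {s P Q : Finset ι}

open Classical in
theorem mem_complement_image {v : E} :
    v ∈ complement (s.image fun i => hyperplane (α i) (k i)) ↔
      ∀ i ∈ s, inner ℝ v (α i) ≠ k i := by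
  simp only [complement, Set.mem_ofPred_eq, Finset.forall_mem_image, mem_hyperplane, ne_eq]

open Classical in
theorem cell_subset_complement :
    cell α k s P ⊆ complement (s.image fun i => hyperplane (α i) (k i)) := by
  intro v hv
  refine mem_complement_image.2 fun i hi => ?_
  by_cases h : i ∈ P
  · exact ((hv i hi).1 h).ne'
  · exact ((hv i hi).2 h).ne

theorem eq_of_mem_cell (hP : P ⊆ s) (hQ : Q ⊆ s) {v : E} (h1 : v ∈ cell α k s P)
    (h2 : v ∈ cell α k s Q) : P = Q := by
  ext i
  constructor
  · intro hi
    by_contra hi'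
    exact lt_asymm ((h1 i (hP hi)).1 hi) ((h2 i (hP hi)).2 hi')
  · intro hi
    by_contra hi'
    exact lt_asymm ((h1 i (hQ hi)).2 hi') ((h2 i (hQ hi)).1 hi)

-- A cell is convex, hence connected. Conversely each linear form maps the component onto an
-- interval that omits `k i`, so no sign can change.
open Classical in
theorem connectedComponentIn_eq_cell {v : E} (hv : v ∈ cell α k s P) :
    connectedComponentIn (complement (s.image fun i => hyperplane (α i) (k i))) v =
      cell α k s P := by
  have hvc := cell_subset_complement hv
  refine Set.Subset.antisymm ?_
    ((convex_cell α k s P).isPreconnected.subset_connectedComponentIn hv cell_subset_complement)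
  intro w hw i hi
  have hpre := (isPreconnected_connectedComponentIn
    (F := complement (s.image fun i => hyperplane (α i) (k i))) (x := v)).image
    (fun u => (inner ℝ u (α i) : ℝ)) (by fun_prop)
  have hno : k i ∉ (fun u => (inner ℝ u (α i) : ℝ)) ''
      connectedComponentIn (complement (s.image fun i => hyperplane (α i) (k i))) v := by
    rintro ⟨u, hu, hui⟩
    exact mem_complement_image.1 (connectedComponentIn_subset _ _ hu) i hi hui
  have hv' := Set.mem_image_of_mem (fun u => (inner ℝ u (α i) : ℝ))
    (mem_connectedComponentIn hvc)
  have hw' := Set.mem_image_of_mem (fun u => (inner ℝ u (α i) : ℝ)) hw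
  refine ⟨fun h => ?_, fun h => ?_⟩
  · by_contra hlt
    exact hno (hpre.ordConnected.out hw' hv' ⟨not_lt.1 hlt, ((hv i hi).1 h).le⟩)
  · by_contra hlt
    exact hno (hpre.ordConnected.out hv' hw' ⟨((hv i hi).2 h).le, not_lt.1 hlt⟩)

open Classical in
theorem regions_image_eq :
    regions (s.image fun i => hyperplane (α i) (k i)) =
      (fun P => cell α k s P) '' {P | P ∈ s.powerset ∧ (cell α k s P).Nonempty} := by
  ext R
  constructor
  · rintro ⟨v, hv, rfl⟩
    have hv' : v ∈ cell α k s (s.filter fun i => k i < inner ℝ v (α i)) := by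
      intro i hi
      simp only [Finset.mem_filter, hi, true_and]
      refine ⟨id, fun h => lt_of_le_of_ne (not_lt.1 h) (mem_complement_image.1 hv i hi)⟩
    exact ⟨_, ⟨Finset.mem_powerset.2 (Finset.filter_subset _ _), v, hv'⟩,
      (connectedComponentIn_eq_cell hv').symm⟩
  · rintro ⟨P, ⟨-, v, hv⟩, rfl⟩
    exact ⟨v, cell_subset_complement hv, (connectedComponentIn_eq_cell hv).symm⟩

theorem injOn_cell :
    Set.InjOn (fun P => cell α k s P) {P | P ∈ s.powerset ∧ (cell α k s P).Nonempty} := by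
  rintro P ⟨hP, v, hv⟩ Q ⟨hQ, -⟩ h
  have h : cell α k s P = cell α k s Q := h
  exact eq_of_mem_cell (Finset.mem_powerset.1 hP) (Finset.mem_powerset.1 hQ) hv (h ▸ hv)

open Classical in
theorem finite_regions_image : (regions (s.image fun i => hyperplane (α i) (k i))).Finite := by
  rw [regions_image_eq]
  exact (s.powerset.finite_toSet.subset fun P hP => hP.1).image _

open Classical in
theorem ncard_regions_image :
    ((regions (s.image fun i => hyperplane (α i) (k i))).ncard : ℤ) = cellCount α k s ⊤ := by
  rw [regions_image_eq, injOn_cell.ncard_image, cellCount, ← Finset.sum_filter, Finset.sum_const,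
    nsmul_one, ← Set.ncard_coe_finset]
  congr 2
  ext P
  simp

theorem isBounded_cell_iff [FiniteDimensional ℝ E] (hne : (cell α k s P).Nonempty) :
    Bornology.IsBounded (cell α k s P) ↔ ∀ v ∈ recessionCone α s P, v = 0 := by
  constructor
  · intro hb v hv
    obtain ⟨p, hp⟩ := hne
    by_contra hv0
    obtain ⟨C, hC⟩ := hb.exists_norm_le
    have hvn : 0 < ‖v‖ := norm_pos_iff.2 hv0
    have hC0 : 0 ≤ C := (norm_nonneg p).trans (hC p hp)
    -- Moving by a vector of norm `2 * C + 1` cannot stay within a ball of radius `C`.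
    have ht : 0 ≤ (2 * C + 1) / ‖v‖ := by positivity
    have h1 := hC _ (add_smul_mem_cell hp hv ht)
    have h2 : ‖((2 * C + 1) / ‖v‖) • v‖ = 2 * C + 1 := by
      rw [norm_smul, Real.norm_of_nonneg ht]
      field_simp
    have h3 : ‖((2 * C + 1) / ‖v‖) • v‖ ≤ ‖p + ((2 * C + 1) / ‖v‖) • v‖ + ‖p‖ := by
      have := norm_sub_le (p + ((2 * C + 1) / ‖v‖) • v) p
      rwa [add_sub_cancel_left] at this
    have h4 := hC p hp
    linarith
  · intro hcone
    classical
    -- `g` is the total violation of the cone inequalities. It is positively homogeneous, positive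
    -- off the origin since the cone is trivial, and bounded on the cell by the sum of the `|k i|`.
    -- Its minimum on the unit sphere therefore bounds the norm.
    let g : E → ℝ := fun v => ∑ i ∈ s, max 0 (if i ∈ P then -inner ℝ v (α i) else inner ℝ v (α i))
    have hterm : ∀ (v : E) (i : ι),
        (0 : ℝ) ≤ max 0 (if i ∈ P then -inner ℝ v (α i) else inner ℝ v (α i)) :=
      fun v i => le_max_left _ _
    have hg : Continuous g := by
      refine continuous_finsetSum _ fun i _ => continuous_const.max ?_
      by_cases h : i ∈ P
      · simp only [if_pos h]
        exact (continuous_id.inner continuous_const).neg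
      · simp only [if_neg h]
        exact continuous_id.inner continuous_const
    have hpos : ∀ v, v ≠ 0 → 0 < g v := by
      intro v hv
      refine lt_of_le_of_ne (Finset.sum_nonneg fun i _ => hterm v i) fun h0 => hv (hcone v ?_)
      intro i hi
      have := (Finset.sum_eq_zero_iff_of_nonneg fun i _ => hterm v i).1 h0.symm i hi
      rw [max_eq_left_iff] at this
      refine ⟨fun h => ?_, fun h => ?_⟩
      · rw [if_pos h] at this; linarith
      · rwa [if_neg h] at this
    have hhom : ∀ (t : ℝ) (v : E), 0 ≤ t → g (t • v) = t * g v := by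
      intro t v ht
      simp only [g]
      rw [Finset.mul_sum]
      refine Finset.sum_congr rfl fun i _ => ?_
      rw [mul_max_of_nonneg _ _ ht, mul_zero, real_inner_smul_left]
      split_ifs <;> ring_nf
    have hcell : ∀ v ∈ cell α k s P, g v ≤ ∑ i ∈ s, |k i| := by
      intro v hv
      refine Finset.sum_le_sum fun i hi => max_le (abs_nonneg _) ?_
      split_ifs with h
      · have := (hv i hi).1 h
        have := neg_abs_le (k i)
        linarith
      · exact ((hv i hi).2 h).le.trans (le_abs_self _)
    rcases (Metric.sphere (0 : E) 1).eq_empty_or_nonempty with hsph | hsph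
    · have : Subsingleton E := by
        refine subsingleton_of_forall_eq 0 fun v => ?_
        by_contra hv
        have : ‖v‖⁻¹ • v ∈ Metric.sphere (0 : E) 1 := by
          simp [norm_smul, norm_ne_zero_iff.2 hv]
        rw [hsph] at this
        exact this
      exact (Set.toFinite _).isBounded
    · obtain ⟨u, hu, hmin⟩ := (isCompact_sphere (0 : E) 1).exists_isMinOn hsph hg.continuousOn
      have hu0 : u ≠ 0 := by
        rintro rfl
        simp at hu
      have hδ := hpos u hu0
      refine isBounded_iff_forall_norm_le.2 ⟨(∑ i ∈ s, |k i|) / g u, fun v hv => ?_⟩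
      rw [le_div_iff₀ hδ]
      refine le_trans ?_ (hcell v hv)
      by_cases hv0 : v = 0
      · rw [hv0, norm_zero, zero_mul]
        exact Finset.sum_nonneg fun i _ => hterm 0 i
      have hvn : ‖v‖ ≠ 0 := norm_ne_zero_iff.2 hv0
      have hmem : ‖v‖⁻¹ • v ∈ Metric.sphere (0 : E) 1 := by
        simp [norm_smul, hvn]
      calc ‖v‖ * g u ≤ ‖v‖ * g (‖v‖⁻¹ • v) :=
            mul_le_mul_of_nonneg_left (hmin hmem) (norm_nonneg v)
        _ = g v := by rw [← hhom _ _ (norm_nonneg v), smul_inv_smul₀ hvn]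

open Classical in
theorem ncard_boundedRegions_image [FiniteDimensional ℝ E] (hs : lineality α s = ⊥) :
    ((boundedRegions (s.image fun i => hyperplane (α i) (k i))).ncard : ℤ) =
      boundedCellCount α k s ⊤ := by
  have h1 : boundedRegions (s.image fun i => hyperplane (α i) (k i)) =
      (fun P => cell α k s P) '' {P | P ∈ s.powerset ∧ RelBounded α k s P ⊤} := by
    ext R
    rw [boundedRegions, regions_image_eq]
    have key : ∀ P, RelBounded α k s P ⊤ ↔
        (cell α k s P).Nonempty ∧ ∀ v ∈ recessionCone α s P, v = 0 := by
      intro P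
      simp [RelBounded, hs]
    constructor
    · rintro ⟨⟨P, ⟨hP, hne⟩, rfl⟩, hb⟩
      exact ⟨P, ⟨hP, (key P).2 ⟨hne, (isBounded_cell_iff hne).1 hb⟩⟩, rfl⟩
    · rintro ⟨P, ⟨hP, hr⟩, rfl⟩
      have := (key P).1 hr
      exact ⟨⟨P, ⟨hP, this.1⟩, rfl⟩, (isBounded_cell_iff this.1).2 this.2⟩
  have h2 : Set.InjOn (fun P => cell α k s P) {P | P ∈ s.powerset ∧ RelBounded α k s P ⊤} :=
    Set.InjOn.mono (s₂ := {P | P ∈ s.powerset ∧ (cell α k s P).Nonempty})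
      (fun P hP => ⟨hP.1, by simpa using hP.2.1⟩) injOn_cell
  rw [h1, h2.ncard_image, boundedCellCount, ← Finset.sum_filter, Finset.sum_const,
    nsmul_one, ← Set.ncard_coe_finset]
  congr 2
  ext P
  simp

open Classical in
/-- Zaslavsky's theorem for regions. -/
theorem ncard_regions_eq_eval_charPoly [FiniteDimensional ℝ E]
    (hα : ∀ i ∈ s, hyperplane (α i) (k i) ≠ ⊤) :
    ((regions (s.image fun i => hyperplane (α i) (k i))).ncard : ℤ) =
      (-1) ^ Module.finrank ℝ E *
        (charPoly (s.image fun i => hyperplane (α i) (k i))).eval (-1) := by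
  rw [ncard_regions_image, cellCount_eq, charPoly_image_eq_whitneySum _ _ hα,
    AffineSubspace.direction_top, finrank_top]

open Classical in
/-- Zaslavsky's theorem for bounded regions of an essential arrangement. -/
theorem ncard_boundedRegions_eq_eval_charPoly [FiniteDimensional ℝ E]
    (hα : ∀ i ∈ s, hyperplane (α i) (k i) ≠ ⊤) (hs : lineality α s = ⊥) :
    ((boundedRegions (s.image fun i => hyperplane (α i) (k i))).ncard : ℤ) =
      (-1) ^ Module.finrank ℝ E *
        (charPoly (s.image fun i => hyperplane (α i) (k i))).eval 1 := by
  rw [ncard_boundedRegions_image hs, boundedCellCount_eq, charPoly_image_eq_whitneySum _ _ hα, hs,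
    AffineSubspace.direction_top, finrank_top, inf_bot_eq, finrank_bot, add_zero]

end Regions

/-! ### The finite field method -/

section FiniteField

/-- The solution set over `K` of a linear system with integer coefficients. -/
def solutionSet {ι : Type*} {n : ℕ} (K : Type*) [Field K] (B : Finset ι) (a : ι → Fin n → ℤ)
    (b : ι → ℤ) : Set (Fin n → K) :=
  {x | ∀ i ∈ B, ∑ j, (a i j : K) * x j = b i}

/-- The affine parametrization of the solutions of `∑ j, a j * x j = b` by the coordinates other
than `j₀`. -/
noncomputable def solveFor {m : ℕ} (K : Type*) [Field K] (j₀ : Fin (m + 1)) (a : Fin (m + 1) → ℤ)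
    (b : ℤ) : (Fin m → K) →ᵃ[K] (Fin (m + 1) → K) :=
  AffineMap.pi (Fin.insertNth (α := fun _ => (Fin m → K) →ᵃ[K] K) j₀
    ((a j₀ : K)⁻¹ • (AffineMap.const K (Fin m → K) (b : K) -
      ∑ l, (a (j₀.succAbove l) : K) • (LinearMap.proj l : (Fin m → K) →ₗ[K] K).toAffineMap))
    (fun l => (LinearMap.proj l : (Fin m → K) →ₗ[K] K).toAffineMap))

variable {m : ℕ} {K : Type*} [Field K] (j₀ : Fin (m + 1)) (a : Fin (m + 1) → ℤ) (b : ℤ)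

theorem solveFor_same (y : Fin m → K) :
    solveFor K j₀ a b y j₀ = (a j₀ : K)⁻¹ * (b - ∑ l, (a (j₀.succAbove l) : K) * y l) := by
  have hsum : ∀ s : Finset (Fin m), (∑ l ∈ s, (a (j₀.succAbove l) : K) •
      (LinearMap.proj l : (Fin m → K) →ₗ[K] K).toAffineMap) y =
      ∑ l ∈ s, (a (j₀.succAbove l) : K) * y l := by
    intro s
    classical
    induction s using Finset.induction_on with
    | empty => simp
    | insert l s hl ih => rw [Finset.sum_insert hl, Finset.sum_insert hl, ← ih]; simp
  simp [solveFor, AffineMap.pi_apply, hsum]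

theorem solveFor_succAbove (y : Fin m → K) (l : Fin m) :
    solveFor K j₀ a b y (j₀.succAbove l) = y l := by
  simp [solveFor, AffineMap.pi_apply]

theorem solveFor_injective : Function.Injective (solveFor K j₀ a b) := by
  intro y z h
  ext l
  rw [← solveFor_succAbove j₀ a b y l, h, solveFor_succAbove]

/-- Over all fields of large characteristic, the solution set of a linear system with integer
coefficients is either always empty or always an affine space of the same dimension. -/
theorem exists_uniform_parametrization {ι : Type*} (B : Finset ι) :
    ∀ (n : ℕ) (a : ι → Fin n → ℤ) (b : ι → ℤ), ∃ D : ℤ, D ≠ 0 ∧ ∃ o : Option ℕ,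
      ∀ (K : Type) [Field K], (D : K) ≠ 0 →
        (o = none → solutionSet K B a b = ∅) ∧
        ∀ d, o = some d → ∃ φ : (Fin d → K) →ᵃ[K] (Fin n → K),
          Function.Injective φ ∧ Set.range φ = solutionSet K B a b := by
  -- All coefficients are zero: the system is void or contains a contradiction `0 = b i`. In the
  -- latter case `D = b i` rules out the characteristics in which the contradiction disappears.
  have htriv : ∀ (n : ℕ) (a : ι → Fin n → ℤ) (b : ι → ℤ), (∀ i ∈ B, ∀ j, a i j = 0) →
      ∃ D : ℤ, D ≠ 0 ∧ ∃ o : Option ℕ, ∀ (K : Type) [Field K], (D : K) ≠ 0 →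
        (o = none → solutionSet K B a b = ∅) ∧
        ∀ d, o = some d → ∃ φ : (Fin d → K) →ᵃ[K] (Fin n → K),
          Function.Injective φ ∧ Set.range φ = solutionSet K B a b := by
    intro n a b h0
    by_cases hb : ∀ i ∈ B, b i = 0
    · refine ⟨1, one_ne_zero, some n, fun K _ _ => ⟨by simp, ?_⟩⟩
      rintro d ⟨⟩
      refine ⟨AffineMap.id K _, fun _ _ h => h, ?_⟩
      ext x
      simp only [AffineMap.coe_id, Set.range_id, Set.mem_univ, true_iff]
      intro i hi
      simp [h0 i hi, hb i hi]
    · push Not at hb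
      obtain ⟨i, hi, hbi⟩ := hb
      refine ⟨b i, hbi, none, fun K _ hK => ⟨fun _ => ?_, by simp⟩⟩
      refine Set.eq_empty_of_forall_notMem fun x hx => hK ?_
      rw [← hx i hi]
      simp [h0 i hi]
  intro n
  induction n with
  | zero => exact fun a b => htriv 0 a b fun i _ j => j.elim0
  | succ m ih =>
    intro a b
    by_cases h0 : ∀ i ∈ B, ∀ j, a i j = 0
    · exact htriv _ a b h0
    push Not at h0
    obtain ⟨i₀, hi₀, j₀, hc⟩ := h0
    -- Elimination without division keeps the coefficients integral. Equation `i₀` turns into `0 =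
    -- 0`, so the index set `B` need not change, and the pivot is put into `D` to stay invertible in
    -- `K`.
    obtain ⟨D, hD, o, ho⟩ := ih
      (fun i l => a i₀ j₀ * a i (j₀.succAbove l) - a i j₀ * a i₀ (j₀.succAbove l))
      (fun i => a i₀ j₀ * b i - a i j₀ * b i₀)
    refine ⟨a i₀ j₀ * D, mul_ne_zero hc hD, o, fun K _ hK => ?_⟩
    rw [Int.cast_mul, mul_ne_zero_iff] at hK
    obtain ⟨hcK, hDK⟩ := hK
    have hsub : ∀ (y : Fin m → K) (i : ι), (a i₀ j₀ : K) *
        (∑ j, (a i j : K) * solveFor K j₀ (a i₀) (b i₀) y j - b i) =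
        ∑ l, ((a i₀ j₀ * a i (j₀.succAbove l) - a i j₀ * a i₀ (j₀.succAbove l) : ℤ) : K) * y l -
          ((a i₀ j₀ * b i - a i j₀ * b i₀ : ℤ) : K) := by
      intro y i
      rw [Fin.sum_univ_succAbove _ j₀, solveFor_same]
      simp only [solveFor_succAbove]
      push_cast
      simp only [sub_mul, Finset.sum_sub_distrib, mul_assoc, ← Finset.mul_sum]
      field_simp
      ring
    have hmem : ∀ y : Fin m → K, solveFor K j₀ (a i₀) (b i₀) y ∈ solutionSet K B a b ↔
        y ∈ solutionSet K B
          (fun i l => a i₀ j₀ * a i (j₀.succAbove l) - a i j₀ * a i₀ (j₀.succAbove l))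
          (fun i => a i₀ j₀ * b i - a i j₀ * b i₀) := by
      intro y
      refine forall₂_congr fun i _ => ?_
      rw [← sub_eq_zero, ← mul_eq_zero_iff_left hcK, hsub, sub_eq_zero]
    have hall : ∀ x ∈ solutionSet K B a b,
        x = solveFor K j₀ (a i₀) (b i₀) (fun l => x (j₀.succAbove l)) := by
      intro x hx
      ext j
      refine Fin.succAboveCases (α := fun j => x j =
        solveFor K j₀ (a i₀) (b i₀) (fun l => x (j₀.succAbove l)) j) j₀ ?_ (fun l => ?_) j
      · rw [solveFor_same, ← hx i₀ hi₀, Fin.sum_univ_succAbove _ j₀]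
        field_simp
        ring
      · rw [solveFor_succAbove]
    refine ⟨fun h => ?_, fun d hd => ?_⟩
    · refine Set.eq_empty_of_forall_notMem fun x hx => ?_
      have h1 := hall x hx
      rw [h1, hmem, (ho K hDK).1 h] at hx
      exact hx
    · obtain ⟨φ, hφ, hr⟩ := (ho K hDK).2 d hd
      refine ⟨(solveFor K j₀ (a i₀) (b i₀)).comp φ,
        (solveFor_injective j₀ (a i₀) (b i₀)).comp hφ, ?_⟩
      ext x
      constructor
      · rintro ⟨z, rfl⟩
        rw [AffineMap.comp_apply, hmem, ← hr]
        exact ⟨z, rfl⟩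
      · intro hx
        have h1 := hall x hx
        have h2 := hx
        rw [h1, hmem, ← hr] at h2
        obtain ⟨z, hz⟩ := h2
        exact ⟨z, by rw [AffineMap.comp_apply, hz, ← h1]⟩

/-- The vector of `ℝⁿ` with the given integer coordinates. -/
noncomputable def intVec {n : ℕ} (a : Fin n → ℤ) : EuclideanSpace ℝ (Fin n) :=
  WithLp.toLp 2 fun i => (a i : ℝ)

theorem inner_intVec {n : ℕ} (v : EuclideanSpace ℝ (Fin n)) (a : Fin n → ℤ) :
    inner ℝ v (intVec a) = ∑ j, (a j : ℝ) * v j := by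
  simp [intVec, PiLp.inner_apply]

/-- The hyperplane with the given integer coefficients. -/
noncomputable def intHyperplane {n : ℕ} (t : (Fin n → ℤ) × ℤ) :
    AffineSubspace ℝ (EuclideanSpace ℝ (Fin n)) :=
  hyperplane (intVec t.1) t.2

theorem mem_inf_intHyperplane {n : ℕ} (B : Finset ((Fin n → ℤ) × ℤ))
    (v : EuclideanSpace ℝ (Fin n)) :
    v ∈ B.inf intHyperplane ↔ WithLp.ofLp v ∈ solutionSet ℝ B Prod.fst Prod.snd := by
  classical
  induction B using Finset.induction_on with
  | empty => simp [solutionSet]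
  | insert t B ht ih =>
    rw [Finset.inf_insert, AffineSubspace.mem_inf_iff, ih, intHyperplane, mem_hyperplane,
      inner_intVec]
    simp [solutionSet]

theorem exists_card_solutionSet_eq_eval {n : ℕ} (B : Finset ((Fin n → ℤ) × ℤ)) :
    ∃ D : ℤ, D ≠ 0 ∧ ∀ (p : ℕ) [Fact p.Prime], (D : ZMod p) ≠ 0 →
      ((solutionSet (ZMod p) B Prod.fst Prod.snd).ncard : ℤ) =
        (dimMonomial (B.inf intHyperplane)).eval (p : ℤ) := by
  obtain ⟨D, hD, o, ho⟩ := exists_uniform_parametrization B n Prod.fst Prod.snd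
  refine ⟨D, hD, fun p _ hp => ?_⟩
  -- The outcome `o` does not depend on the field, so the real flat and its reduction modulo `p` are
  -- both empty or have the same dimension.
  have hR := ho ℝ (Int.cast_ne_zero.2 hD)
  have hP := ho (ZMod p) hp
  cases o with
  | none =>
    have : B.inf intHyperplane = ⊥ := by
      by_contra hne
      obtain ⟨v, hv⟩ := (AffineSubspace.nonempty_iff_ne_bot _).2 hne
      have := (mem_inf_intHyperplane B v).1 hv
      rw [hR.1 rfl] at this
      exact this
    rw [hP.1 rfl, this]
    simp
  | some d =>
    obtain ⟨φ, hφ, hr⟩ := hR.2 d rfl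
    obtain ⟨ψ, hψ, hs⟩ := hP.2 d rfl
    let χ : (Fin d → ℝ) →ᵃ[ℝ] EuclideanSpace ℝ (Fin n) :=
      ((WithLp.linearEquiv 2 ℝ (Fin n → ℝ)).symm.toLinearMap.toAffineMap).comp φ
    have hχ : Function.Injective χ :=
      (WithLp.linearEquiv 2 ℝ (Fin n → ℝ)).symm.injective.comp hφ
    have e : B.inf intHyperplane = (⊤ : AffineSubspace ℝ (Fin d → ℝ)).map χ := by
      ext v
      rw [mem_inf_intHyperplane, ← hr, AffineSubspace.mem_map]
      constructor
      · rintro ⟨z, hz⟩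
        refine ⟨z, AffineSubspace.mem_top _ _ _, ?_⟩
        change WithLp.toLp 2 (φ z) = v
        rw [hz]
      · rintro ⟨z, -, rfl⟩
        exact ⟨z, rfl⟩
    have hne : B.inf intHyperplane ≠ ⊥ := by
      rw [e, ne_eq, AffineSubspace.map_eq_bot_iff]
      exact top_ne_bot
    rw [dimMonomial, if_neg hne, e, AffineSubspace.map_direction, AffineSubspace.direction_top,
      Submodule.map_top, LinearMap.finrank_range_of_inj (χ.linear_injective_iff.2 hχ),
      Module.finrank_fin_fun, ← hs, ← Set.image_univ, Set.ncard_image_of_injective _ hψ,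
      Set.ncard_univ]
    simp

/-- The finite field method. -/
theorem exists_card_complement_eq_eval {n : ℕ} (T : Finset ((Fin n → ℤ) × ℤ)) :
    ∃ D : ℤ, D ≠ 0 ∧ ∀ (p : ℕ) [Fact p.Prime], (D : ZMod p) ≠ 0 →
      (({x | ∀ t ∈ T, ∑ j, (t.1 j : ZMod p) * x j ≠ t.2} : Set (Fin n → ZMod p)).ncard : ℤ) =
        (whitneySum intHyperplane T ⊤).eval (p : ℤ) := by
  classical
  choose D hD hcard using exists_card_solutionSet_eq_eval (n := n)
  -- The product excludes the bad characteristics of all subfamilies at once; inclusion-exclusion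
  -- then matches the Whitney sum term by term.
  refine ⟨∏ B ∈ T.powerset, D B, Finset.prod_ne_zero_iff.2 fun B _ => hD B, fun p _ hp => ?_⟩
  rw [Int.cast_prod, Finset.prod_ne_zero_iff] at hp
  rw [whitneySum, Polynomial.eval_finsetSum]
  have h1 := Finset.inclusion_exclusion_card_inf_compl T
    (fun t : (Fin n → ℤ) × ℤ => ({x | ∑ j, (t.1 j : ZMod p) * x j = t.2} :
      Finset (Fin n → ZMod p)))
  have hmem : ∀ (B : Finset ((Fin n → ℤ) × ℤ)) (x : Fin n → ZMod p),
      x ∈ B.inf (fun t : (Fin n → ℤ) × ℤ => ({x | ∑ j, (t.1 j : ZMod p) * x j = t.2} :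
      Finset (Fin n → ZMod p))) ↔ ∀ t ∈ B, ∑ j, (t.1 j : ZMod p) * x j = t.2 := by
    intro B x
    simp [Finset.mem_inf]
  have hmem' : ∀ x : Fin n → ZMod p,
      x ∈ T.inf (fun t : (Fin n → ℤ) × ℤ => ({x | ∑ j, (t.1 j : ZMod p) * x j = t.2} :
      Finset (Fin n → ZMod p))ᶜ) ↔ ∀ t ∈ T, ∑ j, (t.1 j : ZMod p) * x j ≠ t.2 := by
    intro x
    simp [Finset.mem_inf]
  have h2 : ({x | ∀ t ∈ T, ∑ j, (t.1 j : ZMod p) * x j ≠ t.2} : Set (Fin n → ZMod p)) =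
      (T.inf (fun t : (Fin n → ℤ) × ℤ => ({x | ∑ j, (t.1 j : ZMod p) * x j = t.2} :
      Finset (Fin n → ZMod p))ᶜ) : Finset (Fin n → ZMod p)) := by
    ext x
    rw [Finset.mem_coe, hmem']
    rfl
  rw [h2, Set.ncard_coe_finset, h1]
  refine Finset.sum_congr rfl fun B hB => ?_
  rw [top_inf_eq, Polynomial.eval_mul, ← hcard B p (hp B hB)]
  refine congrArg₂ (· * ·) (by simp) (congrArg _ ?_)
  rw [← Set.ncard_coe_finset]
  congr 1
  ext x
  rw [Finset.mem_coe, hmem]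
  rfl

end FiniteField

/-! ### Signed placements, and closing or opening a pair of places -/

section Placement

/-- Closing up the two positions `c` and `-c`. -/
def squeeze (c y : ℤ) : ℤ := if c < y then y - 1 else if y < -c then y + 1 else y

/-- Making room for the two positions `c` and `-c`. -/
def stretch (c y : ℤ) : ℤ := if c ≤ y then y + 1 else if y ≤ -c then y - 1 else y

/-- The position, after removal of `a` and `-a`, of the predecessor of `a`. -/
def predPos (a : ℤ) : ℤ := if 0 < a then a - 1 else a

/-- The position inserted directly after `u`. -/
def succPos (u : ℤ) : ℤ := if 0 ≤ u then u + 1 else u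

variable {n : ℕ}

/-- The indices which directly follow an element of `M` that is at least `m`. -/
def follows (M : Finset (Fin n)) (m l : Fin n) : Prop := ∃ m' ∈ M, m ≤ m' ∧ (m' : ℕ) + 1 = l

/-- Signed placements of the letters of `S` at positions in `[-h, h]`, subject to the adjacency
constraints given by `M`. -/
structure IsPlacement (S M : Finset (Fin n)) (h : ℤ) (x : Fin n → ℤ) : Prop where
  -- A normalisation: letters outside `S` are absent. Keeping `Fin n` as index type while `S`
  -- shrinks preserves the original adjacency of indices.
  zero : ∀ i ∉ S, x i = 0
  ne_zero : ∀ i ∈ S, x i ≠ 0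
  mem : ∀ i ∈ S, -h ≤ x i ∧ x i ≤ h
  distinct : ∀ i ∈ S, ∀ j ∈ S, i ≠ j → x i ≠ x j ∧ x i ≠ -x j
  -- Modulo `2h + 1` this says `2 * x m ≠ 1`: the letter `m` does not directly follow `-m`. It also
  -- rules out wrapping around in the next two conditions, which can thus be stated over the
  -- integers.
  ne_neg : ∀ m ∈ M, x m ≠ -h
  add_ne : ∀ m ∈ M, ∀ m' ∈ M, m ≠ m' → x m + x m' ≠ 1
  ne_succ : ∀ m ∈ M, ∀ l, follows M m l → x m ≠ x l + 1

open Classical in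
/-- The finset of all placements. -/
noncomputable def placements (S M : Finset (Fin n)) (h : ℤ) : Finset (Fin n → ℤ) :=
  (Fintype.piFinset fun _ => insert 0 (Finset.Icc (-h) h)).filter (IsPlacement S M h)

theorem mem_placements {S M : Finset (Fin n)} {h : ℤ} {x : Fin n → ℤ} :
    x ∈ placements S M h ↔ IsPlacement S M h x := by
  classical
  simp only [placements, Finset.mem_filter, and_iff_right_iff_imp, Fintype.mem_piFinset]
  intro hx i
  by_cases hi : i ∈ S
  · exact Finset.mem_insert_of_mem (Finset.mem_Icc.2 (hx.mem i hi))
  · rw [hx.zero i hi]; exact Finset.mem_insert_self _ _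

/-- Remove the letter `m`, closing up its two positions. -/
def removeLetter (m : Fin n) (x : Fin n → ℤ) : Fin n → ℤ :=
  fun i => if i = m then 0 else squeeze |x m| (x i)

/-- Insert the letter `m` at position `a`. -/
def insertLetter (m : Fin n) (a : ℤ) (x : Fin n → ℤ) : Fin n → ℤ :=
  fun i => if i = m then a else stretch |a| (x i)

theorem removeLetter_of_ne {m i : Fin n} (h : i ≠ m) (x : Fin n → ℤ) :
    removeLetter m x i = squeeze |x m| (x i) := if_neg h

theorem insertLetter_of_ne {m i : Fin n} (h : i ≠ m) (a : ℤ) (x : Fin n → ℤ) :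
    insertLetter m a x i = stretch |a| (x i) := if_neg h

theorem insertLetter_same (m : Fin n) (a : ℤ) (x : Fin n → ℤ) : insertLetter m a x m = a :=
  if_pos rfl

theorem stretch_squeeze {a y : ℤ} (ha : a ≠ 0) (h1 : y ≠ a) (h2 : y ≠ -a) :
    stretch |a| (squeeze |a| y) = y := by
  rcases abs_cases a with ⟨h, _⟩ | ⟨h, _⟩ <;> rw [h] <;> unfold stretch squeeze <;>
    split_ifs <;> omega

theorem squeeze_stretch {a y : ℤ} : squeeze |a| (stretch |a| y) = y := by
  rcases abs_cases a with ⟨h, _⟩ | ⟨h, _⟩ <;> rw [h] <;> unfold stretch squeeze <;>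
    split_ifs <;> omega

theorem insertLetter_removeLetter {S M : Finset (Fin n)} {h : ℤ} {m : Fin n} (hm : m ∈ S)
    {x : Fin n → ℤ} (hx : IsPlacement S M h x) :
    insertLetter m (x m) (removeLetter m x) = x := by
  funext i
  by_cases hi : i = m
  · rw [hi, insertLetter_same]
  · rw [insertLetter_of_ne hi, removeLetter_of_ne hi]
    have hm0 := hx.ne_zero m hm
    by_cases hiS : i ∈ S
    · have := hx.distinct i hiS m hm hi
      exact stretch_squeeze hm0 this.1 this.2
    · have h0 := hx.zero i hiS
      exact stretch_squeeze hm0 (by omega) (by omega)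

theorem removeLetter_insertLetter {S M : Finset (Fin n)} {h : ℤ} {m : Fin n} (hm : m ∉ S)
    {x : Fin n → ℤ} (hx : IsPlacement S M h x) (a : ℤ) :
    removeLetter m (insertLetter m a x) = x := by
  funext i
  by_cases hi : i = m
  · rw [hi, hx.zero m hm]; simp [removeLetter]
  · rw [removeLetter_of_ne hi, insertLetter_same, insertLetter_of_ne hi, squeeze_stretch]

section Integers

variable {a y z h u : ℤ}

theorem squeeze_ne_zero (ha : a ≠ 0) (hy : y ≠ 0) :
    squeeze |a| y ≠ 0 := by
  rcases abs_cases a with ⟨h, _⟩ | ⟨h, _⟩ <;> rw [h] <;> unfold squeeze <;> split_ifs <;> omega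

theorem squeeze_mem (ha : -h ≤ a ∧ a ≤ h) (hy : -h ≤ y ∧ y ≤ h) (h1 : y ≠ a) (h2 : y ≠ -a) :
    -(h - 1) ≤ squeeze |a| y ∧ squeeze |a| y ≤ h - 1 := by
  rcases abs_cases a with ⟨h, _⟩ | ⟨h, _⟩ <;> rw [h] <;> unfold squeeze <;> split_ifs <;> omega

theorem squeeze_distinct (hy1 : y ≠ a) (hy2 : y ≠ -a) (hz1 : z ≠ a) (hz2 : z ≠ -a)
    (h1 : y ≠ z) (h2 : y ≠ -z) :
    squeeze |a| y ≠ squeeze |a| z ∧ squeeze |a| y ≠ -squeeze |a| z := by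
  rcases abs_cases a with ⟨h, _⟩ | ⟨h, _⟩ <;> rw [h] <;> unfold squeeze <;> split_ifs <;> omega

theorem squeeze_ne_neg (ha : -h ≤ a ∧ a ≤ h) (ha' : a ≠ -h) (hy : y ≠ -h)
    (hy1 : y ≠ a) (hy2 : y ≠ -a) (h1 : y + a ≠ 1) : squeeze |a| y ≠ -(h - 1) := by
  rcases abs_cases a with ⟨h, _⟩ | ⟨h, _⟩ <;> rw [h] <;> unfold squeeze <;> split_ifs <;> omega

theorem squeeze_add_ne (hy1 : y ≠ a) (hy2 : y ≠ -a)
    (hz1 : z ≠ a) (hz2 : z ≠ -a) (h1 : y + a ≠ 1) (h2 : z + a ≠ 1) (h3 : y + z ≠ 1) :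
    squeeze |a| y + squeeze |a| z ≠ 1 := by
  rcases abs_cases a with ⟨h, _⟩ | ⟨h, _⟩ <;> rw [h] <;> unfold squeeze <;> split_ifs <;> omega

/-- If `y` comes to follow `z` only after the removal, the place between them was `a` or `-a`. The
hypotheses exclude `a` directly after `z` and `y` directly after `-a`. -/
theorem squeeze_ne_succ (hy1 : y ≠ a) (hy2 : y ≠ -a)
    (hz1 : z ≠ a) (hz2 : z ≠ -a) (h1 : y + a ≠ 1) (h2 : a ≠ z + 1) (h3 : y ≠ z + 1) :
    squeeze |a| y ≠ squeeze |a| z + 1 := by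
  rcases abs_cases a with ⟨h, _⟩ | ⟨h, _⟩ <;> rw [h] <;> unfold squeeze <;> split_ifs <;> omega

theorem predPos_mem (ha : -h ≤ a ∧ a ≤ h) (ha' : a ≠ -h) :
    -(h - 1) ≤ predPos a ∧ predPos a ≤ h - 1 := by
  unfold predPos; split_ifs <;> omega

theorem predPos_ne_neg_squeeze (ha : a ≠ 0) (hy : y ≠ 0) (hy1 : y ≠ a) (hy2 : y ≠ -a)
    (h1 : y + a ≠ 1) : predPos a ≠ -squeeze |a| y := by
  rcases abs_cases a with ⟨h, _⟩ | ⟨h, _⟩ <;> rw [h] <;> unfold squeeze predPos <;>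
    split_ifs <;> omega

theorem predPos_ne_squeeze (ha : a ≠ 0) (hy : y ≠ 0) (hy1 : y ≠ a) (hy2 : y ≠ -a)
    (h1 : a ≠ y + 1) : predPos a ≠ squeeze |a| y := by
  rcases abs_cases a with ⟨h, _⟩ | ⟨h, _⟩ <;> rw [h] <;> unfold squeeze predPos <;>
    split_ifs <;> omega

theorem succPos_predPos (ha : a ≠ 0) : succPos (predPos a) = a := by
  unfold succPos predPos; split_ifs <;> omega

theorem predPos_succPos : predPos (succPos u) = u := by
  unfold succPos predPos; split_ifs <;> omega

theorem succPos_ne_zero : succPos u ≠ 0 := by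
  unfold succPos; split_ifs <;> omega

theorem succPos_mem (hu : -(h - 1) ≤ u ∧ u ≤ h - 1) : -h ≤ succPos u ∧ succPos u ≤ h := by
  unfold succPos; split_ifs <;> omega

theorem succPos_ne_neg (hu : -(h - 1) ≤ u ∧ u ≤ h - 1) : succPos u ≠ -h := by
  unfold succPos; split_ifs <;> omega

theorem stretch_zero (ha : a ≠ 0) : stretch |a| 0 = 0 := by
  rcases abs_cases a with ⟨h, _⟩ | ⟨h, _⟩ <;> rw [h] <;> unfold stretch <;> split_ifs <;> omega

theorem stretch_ne (hy : y ≠ 0) :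
    stretch |a| y ≠ 0 ∧ stretch |a| y ≠ a ∧ stretch |a| y ≠ -a := by
  rcases abs_cases a with ⟨h, _⟩ | ⟨h, _⟩ <;> rw [h] <;> unfold stretch <;> split_ifs <;> omega

theorem stretch_mem (hy : -(h - 1) ≤ y ∧ y ≤ h - 1) :
    -h ≤ stretch |a| y ∧ stretch |a| y ≤ h := by
  unfold stretch; split_ifs <;> omega

theorem stretch_distinct (h1 : y ≠ z) (h2 : y ≠ -z) :
    stretch |a| y ≠ stretch |a| z ∧ stretch |a| y ≠ -stretch |a| z := by
  rcases abs_cases a with ⟨h, _⟩ | ⟨h, _⟩ <;> rw [h] <;> unfold stretch <;> split_ifs <;> omega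

theorem stretch_ne_neg (hy : -(h - 1) ≤ y ∧ y ≤ h - 1)
    (h1 : y ≠ -(h - 1)) : stretch |succPos u| y ≠ -h := by
  rcases abs_cases (succPos u) with ⟨h, _⟩ | ⟨h, _⟩ <;> rw [h] <;> unfold stretch <;>
    split_ifs <;> omega

theorem stretch_add_ne (h1 : y + z ≠ 1) :
    stretch |a| y + stretch |a| z ≠ 1 := by
  rcases abs_cases a with ⟨h, _⟩ | ⟨h, _⟩ <;> rw [h] <;> unfold stretch <;> split_ifs <;> omega

theorem stretch_ne_succ (h1 : y ≠ z + 1) :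
    stretch |a| y ≠ stretch |a| z + 1 := by
  rcases abs_cases a with ⟨h, _⟩ | ⟨h, _⟩ <;> rw [h] <;> unfold stretch <;> split_ifs <;> omega

theorem succPos_add_stretch_ne (h1 : u ≠ -y) :
    stretch |succPos u| y + succPos u ≠ 1 := by
  rcases abs_cases (succPos u) with ⟨h, _⟩ | ⟨h, _⟩ <;> rw [h] <;> unfold succPos at * <;>
    unfold stretch <;> split_ifs at * <;> omega

theorem succPos_ne_stretch_succ (h1 : u ≠ y) :
    succPos u ≠ stretch |succPos u| y + 1 := by
  rcases abs_cases (succPos u) with ⟨h, _⟩ | ⟨h, _⟩ <;> rw [h] <;> unfold succPos at * <;>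
    unfold stretch <;> split_ifs at * <;> omega

end Integers

end Placement

/-! ### Counting placements by removing one letter at a time -/

section PlacementCount

variable {n : ℕ} {S M : Finset (Fin n)} {h : ℤ} {m : Fin n} {x : Fin n → ℤ}

theorem IsPlacement.remove_base (hm : m ∈ S) (hx : IsPlacement S M h x) {N : Finset (Fin n)}
    (h1 : ∀ i ∈ N, removeLetter m x i ≠ -(h - 1))
    (h2 : ∀ i ∈ N, ∀ j ∈ N, i ≠ j → removeLetter m x i + removeLetter m x j ≠ 1)
    (h3 : ∀ i ∈ N, ∀ l, follows N i l → removeLetter m x i ≠ removeLetter m x l + 1) :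
    IsPlacement (S.erase m) N (h - 1) (removeLetter m x) where
  zero i hi := by
    by_cases him : i = m
    · simp [removeLetter, him]
    · have h0 : x i = 0 := hx.zero i fun hiS => hi (Finset.mem_erase.2 ⟨him, hiS⟩)
      rw [removeLetter_of_ne him, h0]
      unfold squeeze
      have := abs_nonneg (x m)
      split_ifs <;> omega
  ne_zero i hi := by
    obtain ⟨him, hiS⟩ := Finset.mem_erase.1 hi
    rw [removeLetter_of_ne him]
    exact squeeze_ne_zero (hx.ne_zero m hm) (hx.ne_zero i hiS)
  mem i hi := by
    obtain ⟨him, hiS⟩ := Finset.mem_erase.1 hi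
    have hd := hx.distinct i hiS m hm him
    rw [removeLetter_of_ne him]
    exact squeeze_mem (hx.mem m hm) (hx.mem i hiS) hd.1 hd.2
  distinct i hi j hj hij := by
    obtain ⟨him, hiS⟩ := Finset.mem_erase.1 hi
    obtain ⟨hjm, hjS⟩ := Finset.mem_erase.1 hj
    have hd := hx.distinct i hiS m hm him
    have hd' := hx.distinct j hjS m hm hjm
    have hd'' := hx.distinct i hiS j hjS hij
    rw [removeLetter_of_ne him, removeLetter_of_ne hjm]
    exact squeeze_distinct hd.1 hd.2 hd'.1 hd'.2 hd''.1 hd''.2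
  ne_neg := h1
  add_ne := h2
  ne_succ := h3

theorem IsPlacement.insert_base (hm : m ∈ S) {N : Finset (Fin n)} (hx : IsPlacement (S.erase m) N
    (h - 1) x) {a : ℤ} (ha0 : a ≠ 0) (ha : -h ≤ a ∧ a ≤ h)
    (h1 : ∀ i ∈ M, insertLetter m a x i ≠ -h)
    (h2 : ∀ i ∈ M, ∀ j ∈ M, i ≠ j → insertLetter m a x i + insertLetter m a x j ≠ 1)
    (h3 : ∀ i ∈ M, ∀ l, follows M i l → insertLetter m a x i ≠ insertLetter m a x l + 1) :
    IsPlacement S M h (insertLetter m a x) where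
  zero i hi := by
    have him : i ≠ m := fun e => hi (e ▸ hm)
    rw [insertLetter_of_ne him, hx.zero i fun hh => hi (Finset.mem_of_mem_erase hh),
      stretch_zero ha0]
  ne_zero i hi := by
    by_cases him : i = m
    · rwa [him, insertLetter_same]
    · rw [insertLetter_of_ne him]
      exact (stretch_ne (hx.ne_zero i (Finset.mem_erase.2 ⟨him, hi⟩))).1
  mem i hi := by
    by_cases him : i = m
    · rwa [him, insertLetter_same]
    · rw [insertLetter_of_ne him]
      exact stretch_mem (hx.mem i (Finset.mem_erase.2 ⟨him, hi⟩))
  distinct i hi j hj hij := by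
    by_cases him : i = m
    · have hjm : j ≠ m := fun e => hij (him.trans e.symm)
      have := stretch_ne (a := a) (hx.ne_zero j (Finset.mem_erase.2 ⟨hjm, hj⟩))
      rw [him, insertLetter_same, insertLetter_of_ne hjm]
      omega
    · have := stretch_ne (a := a) (hx.ne_zero i (Finset.mem_erase.2 ⟨him, hi⟩))
      by_cases hjm : j = m
      · rw [hjm, insertLetter_same, insertLetter_of_ne him]
        omega
      · rw [insertLetter_of_ne him, insertLetter_of_ne hjm]
        have := hx.distinct i (Finset.mem_erase.2 ⟨him, hi⟩) j (Finset.mem_erase.2 ⟨hjm, hj⟩) hij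
        exact stretch_distinct this.1 this.2
  ne_neg := h1
  add_ne := h2
  ne_succ := h3

/-- The elements which directly follow an element of `M`. -/
def successors (M : Finset (Fin n)) : Finset (Fin n) :=
  Finset.univ.filter fun l => ∃ m ∈ M, (m : ℕ) + 1 = l

theorem mem_successors {l : Fin n} : l ∈ successors M ↔ ∃ m ∈ M, (m : ℕ) + 1 = l := by
  simp [successors]

/-- This is why the least letter is removed first: its set of forbidden predecessors among the
successors is all of `successors M`, and so contains that of every other letter. -/
theorem follows_of_mem_successors (hmin : ∀ i ∈ M, m ≤ i) {l : Fin n} :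
    follows M m l ↔ l ∈ successors M := by
  rw [mem_successors]
  exact ⟨fun ⟨i, hi, _, hl⟩ => ⟨i, hi, hl⟩, fun ⟨i, hi, hl⟩ => ⟨i, hi, hmin i hi, hl⟩⟩

/-- Without adjacency conditions `m` may occupy any of the `2h` nonzero places, and closing up its
pair of places is a bijection for each choice. -/
theorem card_placements_free (hm : m ∈ S) (hh : 0 ≤ h) :
    ((placements S ∅ h).card : ℤ) = 2 * h * (placements (S.erase m) ∅ (h - 1)).card := by
  have h1 : (placements S ∅ h).card =
      (((Finset.Icc (-h) h).erase 0) ×ˢ placements (S.erase m) ∅ (h - 1)).card := by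
    refine Finset.card_nbij' (fun x => (x m, removeLetter m x)) (fun p => insertLetter m p.1 p.2)
      ?_ ?_ ?_ ?_
    · intro x hx
      have hx := mem_placements.1 hx
      refine Finset.mem_coe.2 (Finset.mem_product.2 ⟨Finset.mem_erase.2 ⟨hx.ne_zero m hm,
        Finset.mem_Icc.2 (hx.mem m hm)⟩, mem_placements.2 ?_⟩)
      exact hx.remove_base hm (by simp) (by simp) (by simp)
    · rintro ⟨a, x⟩ hp
      obtain ⟨ha, hx⟩ := Finset.mem_product.1 (Finset.mem_coe.1 hp)
      obtain ⟨ha0, ha⟩ := Finset.mem_erase.1 ha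
      exact mem_placements.2 ((mem_placements.1 hx).insert_base hm ha0 (Finset.mem_Icc.1 ha)
        (by simp) (by simp) (by simp))
    · intro x hx
      exact insertLetter_removeLetter hm (mem_placements.1 hx)
    · rintro ⟨a, x⟩ hp
      obtain ⟨ha, hx⟩ := Finset.mem_product.1 (Finset.mem_coe.1 hp)
      exact Prod.ext (insertLetter_same m a x)
        (removeLetter_insertLetter (Finset.notMem_erase m S) (mem_placements.1 hx) a)
  rw [h1, Finset.card_product, Finset.card_erase_of_mem (Finset.mem_Icc.2 ⟨by omega, hh⟩),
    Int.card_Icc]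
  push_cast
  congr 1
  omega

theorem card_placements_empty (h : ℤ) : (placements (∅ : Finset (Fin n)) ∅ h).card = 1 := by
  rw [Finset.card_eq_one]
  refine ⟨0, Finset.eq_singleton_iff_unique_mem.2 ⟨mem_placements.2 ?_, fun x hx => ?_⟩⟩
  · constructor <;> simp
  · funext i
    exact (mem_placements.1 hx).zero i (by simp)

theorem card_placements_of_empty (S : Finset (Fin n)) :
    ∀ h : ℤ, (S.card : ℤ) ≤ h →
      ((placements S ∅ h).card : ℤ) = ∏ i ∈ Finset.range S.card, (2 * h - 2 * (i : ℤ)) := by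
  induction S using Finset.strongInduction with
  | _ S ih =>
    intro h hh
    rcases S.eq_empty_or_nonempty with rfl | ⟨m, hm⟩
    · simp [card_placements_empty]
    · have hc := Finset.card_erase_add_one hm
      rw [card_placements_free hm (by omega), ih _ (Finset.erase_ssubset hm) _ (by omega), ← hc,
        Finset.prod_range_succ']
      rw [mul_comm]
      congr 1
      · refine Finset.prod_congr rfl fun i _ => ?_
        push_cast; ring
      · simp

/-- The allowed insertion points for the least letter of `M`. -/
noncomputable def insertionPoints (M : Finset (Fin n)) (m : Fin n) (h : ℤ) (x : Fin n → ℤ) :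
    Finset ℤ :=
  Finset.Icc (-(h - 1)) (h - 1) \
    ((M.erase m).image (fun i => -x i) ∪ (successors M).image x)

/-- The excluded places are pairwise distinct because a placement has nonzero values that differ up
to sign. Hence the count is `(2h - 1) - (|M| - 1) - |successors M|`, whatever the placement `x` is.
Minimality of `m` ensures that `m` is not itself a successor. -/
theorem card_insertionPoints (hMS : M ⊆ S) (hsS : successors M ⊆ S) (hm : m ∈ M)
    (hmin : ∀ i ∈ M, m ≤ i) (hh : 1 ≤ h) {N : Finset (Fin n)}
    (hx : IsPlacement (S.erase m) N (h - 1) x) :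
    ((insertionPoints M m h x).card : ℤ) =
      2 * h - M.card - (successors M).card := by
  have hs : successors M ⊆ S.erase m := by
    intro l hl
    refine Finset.mem_erase.2 ⟨?_, hsS hl⟩
    rintro rfl
    obtain ⟨i, hi, hil⟩ := mem_successors.1 hl
    have := Fin.le_def.1 (hmin i hi)
    omega
  have hM : M.erase m ⊆ S.erase m := Finset.erase_subset_erase m hMS
  have hinj : Set.InjOn x (S.erase m : Finset (Fin n)) := by
    intro i hi j hj hij
    by_contra hne
    exact (hx.distinct i hi j hj hne).1 hij
  have hc1 : ((M.erase m).image (fun i => -x i)).card = (M.erase m).card :=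
    Finset.card_image_of_injOn fun i hi j hj hij => hinj (hM hi) (hM hj) (neg_injective hij)
  have hc2 : ((successors M).image x).card = (successors M).card :=
    Finset.card_image_of_injOn (hinj.mono hs)
  have hdisj : Disjoint ((M.erase m).image (fun i => -x i)) ((successors M).image x) := by
    rw [Finset.disjoint_left]
    intro y hy hy'
    obtain ⟨i, hi, rfl⟩ := Finset.mem_image.1 hy
    obtain ⟨l, hl, hli⟩ := Finset.mem_image.1 hy'
    by_cases hil : l = i
    · have := hx.ne_zero i (hM hi)
      rw [hil] at hli
      omega
    · exact (hx.distinct l (hs hl) i (hM hi) hil).2 hli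
  have hsub : (M.erase m).image (fun i => -x i) ∪ (successors M).image x ⊆
      Finset.Icc (-(h - 1)) (h - 1) := by
    refine Finset.union_subset (Finset.image_subset_iff.2 fun i hi => ?_)
      (Finset.image_subset_iff.2 fun i hi => Finset.mem_Icc.2 (hx.mem i (hs hi)))
    have := hx.mem i (hM hi)
    rw [Finset.mem_Icc]
    omega
  have hle := Finset.card_le_card hsub
  rw [insertionPoints, Finset.card_sdiff_of_subset hsub, Nat.cast_sub hle,
    Finset.card_union_of_disjoint hdisj, hc1, hc2, Int.card_Icc]
  have := Finset.card_erase_add_one hm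
  push_cast
  omega

theorem follows.of_erase {i l : Fin n} (hf : follows (M.erase m) i l) : follows M i l := by
  obtain ⟨j, hj, hij, hjl⟩ := hf
  exact ⟨j, Finset.mem_of_mem_erase hj, hij, hjl⟩

theorem follows.erase (hmin : ∀ i ∈ M, m ≤ i) {i l : Fin n} (hi : i ∈ M) (him : i ≠ m)
    (hf : follows M i l) : follows (M.erase m) i l := by
  obtain ⟨j, hj, hij, hjl⟩ := hf
  refine ⟨j, Finset.mem_erase.2 ⟨?_, hj⟩, hij, hjl⟩
  rintro rfl
  exact him (le_antisymm hij (hmin i hi))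

/-- A placement corresponds to its reduction together with the reduced place `u` of the predecessor
of `m`. Removal preserves the conditions: a letter of `M` that followed `m` inherits the predecessor
of `m`, which obeys the strictest restrictions, and no letter of `M` followed `-m`. For the
converse, excluding `u = -x i` prevents both that `m` follows `-i` and, by symmetry, that `i`
follows `-m`. A letter of `M` may well follow `m`, as `m` is not in `successors M`. -/
theorem card_placements_erase (hMS : M ⊆ S) (hsS : successors M ⊆ S) (hm : m ∈ M)
    (hmin : ∀ i ∈ M, m ≤ i) (hh : 1 ≤ h) :
    ((placements S M h).card : ℤ) =
      (2 * h - M.card - (successors M).card) *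
        (placements (S.erase m) (M.erase m) (h - 1)).card := by
  have hmS := hMS hm
  have hsne : ∀ l ∈ successors M, l ≠ m := by
    rintro l hl rfl
    obtain ⟨i, hi, hil⟩ := mem_successors.1 hl
    have := Fin.le_def.1 (hmin i hi)
    omega
  have hfs : ∀ {i l}, follows M i l → l ∈ successors M := fun ⟨j, hj, _, hjl⟩ =>
    mem_successors.2 ⟨j, hj, hjl⟩
  have h1 : (placements S M h).card =
      ((placements (S.erase m) (M.erase m) (h - 1)).sigma
        fun x => insertionPoints M m h x).card := by
    refine Finset.card_nbij' (fun x => ⟨removeLetter m x, predPos (x m)⟩)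
      (fun p => insertLetter m (succPos p.2) p.1) ?_ ?_ ?_ ?_
    · intro x hx
      have hx := mem_placements.1 hx
      have ha0 := hx.ne_zero m hmS
      have ha := hx.mem m hmS
      have ha' := hx.ne_neg m hm
      refine Finset.mem_coe.2 (Finset.mem_sigma.2 ⟨mem_placements.2 ?_, ?_⟩)
      · refine hx.remove_base hmS ?_ ?_ ?_
        · intro i hi
          obtain ⟨him, hi⟩ := Finset.mem_erase.1 hi
          have hd := hx.distinct i (hMS hi) m hmS him
          rw [removeLetter_of_ne him]
          exact squeeze_ne_neg ha ha' (hx.ne_neg i hi) hd.1 hd.2 (hx.add_ne i hi m hm him)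
        · intro i hi j hj hij
          obtain ⟨him, hi⟩ := Finset.mem_erase.1 hi
          obtain ⟨hjm, hj⟩ := Finset.mem_erase.1 hj
          have hd := hx.distinct i (hMS hi) m hmS him
          have hd' := hx.distinct j (hMS hj) m hmS hjm
          rw [removeLetter_of_ne him, removeLetter_of_ne hjm]
          exact squeeze_add_ne hd.1 hd.2 hd'.1 hd'.2 (hx.add_ne i hi m hm him)
            (hx.add_ne j hj m hm hjm) (hx.add_ne i hi j hj hij)
        · intro i hi l hl
          obtain ⟨him, hi⟩ := Finset.mem_erase.1 hi
          have hl := hl.of_erase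
          have hls := hfs hl
          have hlm := hsne l hls
          have hd := hx.distinct i (hMS hi) m hmS him
          have hd' := hx.distinct l (hsS hls) m hmS hlm
          rw [removeLetter_of_ne him, removeLetter_of_ne hlm]
          exact squeeze_ne_succ hd.1 hd.2 hd'.1 hd'.2 (hx.add_ne i hi m hm him)
            (hx.ne_succ m hm l ((follows_of_mem_successors hmin).2 hls)) (hx.ne_succ i hi l hl)
      · simp only [insertionPoints, Finset.mem_sdiff, Finset.mem_union, Finset.mem_image, not_or,
          not_exists, not_and, Finset.mem_Icc]
        refine ⟨predPos_mem ha ha', fun i hi => ?_, fun l hl => ?_⟩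
        · obtain ⟨him, hi⟩ := Finset.mem_erase.1 hi
          have hd := hx.distinct i (hMS hi) m hmS him
          rw [removeLetter_of_ne him]
          exact (predPos_ne_neg_squeeze ha0 (hx.ne_zero i (hMS hi)) hd.1 hd.2
            (hx.add_ne i hi m hm him)).symm
        · have hlm := hsne l hl
          have hd := hx.distinct l (hsS hl) m hmS hlm
          rw [removeLetter_of_ne hlm]
          exact (predPos_ne_squeeze ha0 (hx.ne_zero l (hsS hl)) hd.1 hd.2
            (hx.ne_succ m hm l ((follows_of_mem_successors hmin).2 hl))).symm
    · rintro ⟨x, u⟩ hp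
      obtain ⟨hx, hu⟩ := Finset.mem_sigma.1 (Finset.mem_coe.1 hp)
      have hx := mem_placements.1 hx
      simp only [insertionPoints, Finset.mem_sdiff, Finset.mem_union, Finset.mem_image, not_or,
          not_exists, not_and, Finset.mem_Icc] at hu
      obtain ⟨hu, hu1, hu2⟩ := hu
      have hS : ∀ {i}, i ∈ M → i ≠ m → i ∈ S.erase m := fun hi him =>
        Finset.mem_erase.2 ⟨him, hMS hi⟩
      have hM : ∀ {i}, i ∈ M → i ≠ m → i ∈ M.erase m := fun hi him =>
        Finset.mem_erase.2 ⟨him, hi⟩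
      refine mem_placements.2 (hx.insert_base hmS succPos_ne_zero (succPos_mem hu) ?_ ?_ ?_)
      · intro i hi
        by_cases him : i = m
        · rw [him, insertLetter_same]
          exact succPos_ne_neg hu
        · rw [insertLetter_of_ne him]
          exact stretch_ne_neg (hx.mem i (hS hi him)) (hx.ne_neg i (hM hi him))
      · have key : ∀ i ∈ M, i ≠ m →
            insertLetter m (succPos u) x i + insertLetter m (succPos u) x m ≠ 1 := by
          intro i hi him
          rw [insertLetter_same, insertLetter_of_ne him]
          exact succPos_add_stretch_ne fun e => hu1 i (hM hi him) e.symm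
        intro i hi j hj hij
        by_cases him : i = m
        · have hjm : j ≠ m := fun e => hij (him.trans e.symm)
          rw [him, add_comm]
          exact key j hj hjm
        · by_cases hjm : j = m
          · rw [hjm]; exact key i hi him
          · rw [insertLetter_of_ne him, insertLetter_of_ne hjm]
            exact stretch_add_ne (hx.add_ne i (hM hi him) j (hM hj hjm) hij)
      · intro i hi l hl
        have hls := hfs hl
        have hlm := hsne l hls
        rw [insertLetter_of_ne hlm]
        by_cases him : i = m
        · rw [him, insertLetter_same]
          exact succPos_ne_stretch_succ fun e => hu2 l hls e.symm
        · rw [insertLetter_of_ne him]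
          exact stretch_ne_succ (hx.ne_succ i (hM hi him) l (hl.erase hmin hi him))
    · intro x hx
      have hx := mem_placements.1 hx
      change insertLetter m (succPos (predPos (x m))) (removeLetter m x) = x
      rw [succPos_predPos (hx.ne_zero m hmS)]
      exact insertLetter_removeLetter hmS hx
    · rintro ⟨x, u⟩ hp
      obtain ⟨hx, hu⟩ := Finset.mem_sigma.1 (Finset.mem_coe.1 hp)
      have hx := mem_placements.1 hx
      change (⟨removeLetter m (insertLetter m (succPos u) x),
        predPos (insertLetter m (succPos u) x m)⟩ : (_ : Fin n → ℤ) × ℤ) = ⟨x, u⟩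
      rw [insertLetter_same, predPos_succPos,
        removeLetter_insertLetter (Finset.notMem_erase m S) hx]
  rw [h1, Finset.card_sigma]
  push_cast
  rw [Finset.sum_congr rfl fun x hx =>
    card_insertionPoints hMS hsS hm hmin hh (mem_placements.1 hx), Finset.sum_const, nsmul_eq_mul,
    mul_comm]

/-- A larger element of `M` guarantees that `m` is not the last index, so `m + 1` exists and is
lost. For `M` consisting of the last index alone nothing would be lost. -/
theorem successors_erase (hm : m ∈ M) (hmin : ∀ i ∈ M, m ≤ i) (hne : (M.erase m).Nonempty) :
    (successors (M.erase m)).card + 1 = (successors M).card := by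
  obtain ⟨j, hj⟩ := hne
  obtain ⟨hjm, hjM⟩ := Finset.mem_erase.1 hj
  have hlt : m < j := lt_of_le_of_ne (hmin j hjM) (Ne.symm hjm)
  have hmn : (m : ℕ) + 1 < n := by
    have := Fin.lt_def.1 hlt
    have := j.2
    omega
  have e : successors (M.erase m) = (successors M).erase ⟨m + 1, hmn⟩ := by
    ext l
    simp only [Finset.mem_erase, mem_successors, ne_eq, Fin.ext_iff]
    constructor
    · rintro ⟨i, ⟨him, hi⟩, hil⟩
      exact ⟨by omega, i, hi, hil⟩
    · rintro ⟨hl, i, hi, hil⟩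
      exact ⟨i, ⟨by omega, hi⟩, hil⟩
  rw [e, Finset.card_erase_add_one]
  exact mem_successors.2 ⟨m, hm, rfl⟩

/-- The factor from `card_placements_erase` equals `2h + 1 - 2|M| - ζ` and is invariant under
removal. The relation for `ζ` is required only for nonempty `M`: at the end of the recursion it
would force `ζ = 1`, while `ζ` then enters only through a zeroth power. -/
theorem card_placements_eq (ζ : ℤ) (S : Finset (Fin n)) : ∀ (M : Finset (Fin n)) (h : ℤ), M ⊆ S →
    successors M ⊆ S → (M.Nonempty → ((successors M).card : ℤ) + 1 = M.card + ζ) →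
    (S.card : ℤ) ≤ h →
    ((placements S M h).card : ℤ) = (2 * h + 1 - 2 * M.card - ζ) ^ M.card *
      ∏ i ∈ Finset.range (S.card - M.card), (2 * h - 2 * M.card - 2 * (i : ℤ)) := by
  induction S using Finset.strongInduction with
  | _ S ih =>
    intro M h hMS hsS hζ hh
    rcases M.eq_empty_or_nonempty with rfl | hM
    · simp [card_placements_of_empty S h hh]
    have hm := M.min'_mem hM
    have hmin : ∀ i ∈ M, M.min' hM ≤ i := fun i hi => M.min'_le i hi
    have hcM := Finset.card_erase_add_one hm
    have hcS := Finset.card_erase_add_one (hMS hm)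
    have h1 : successors (M.erase (M.min' hM)) ⊆ S.erase (M.min' hM) := by
      intro l hl
      obtain ⟨i, hi, hil⟩ := mem_successors.1 hl
      have hi := Finset.mem_of_mem_erase hi
      refine Finset.mem_erase.2 ⟨fun e => ?_, hsS (mem_successors.2 ⟨i, hi, hil⟩)⟩
      have := Fin.le_def.1 (hmin i hi)
      rw [← e] at this
      omega
    rw [card_placements_erase hMS hsS hm hmin (by omega), ih _ (Finset.erase_ssubset (hMS hm))
      (M.erase (M.min' hM)) (h - 1) (Finset.erase_subset_erase _ hMS) h1 ?_ (by omega)]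
    · have hζ' := hζ hM
      have e1 : (S.erase (M.min' hM)).card - (M.erase (M.min' hM)).card = S.card - M.card := by
        omega
      have e2 : 2 * h - (M.card : ℤ) - (successors M).card = 2 * h + 1 - 2 * M.card - ζ := by
        omega
      have e3 : ((M.erase (M.min' hM)).card : ℤ) = M.card - 1 := by omega
      rw [e1, e2, e3, ← hcM, pow_succ]
      push_cast
      rw [mul_comm ((_ : ℤ) ^ _) (2 * h + _ - _ - ζ), mul_assoc]
      congr 2
      · ring
      · refine Finset.prod_congr rfl fun i _ => ?_
        ring
    · intro hne
      have := successors_erase hm hmin hne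
      have := hζ hM
      omega

end PlacementCount

/-! ### Points modulo an odd number as placements -/

section IntegerModel

variable {n : ℕ}

/-- The standard basis vector with integer coordinates. -/
def intBasis (i : Fin n) : Fin n → ℤ := Pi.single i 1

/-- The positive roots of type `C_n` as integer vectors. -/
def IsIntPosRoot (a : Fin n → ℤ) : Prop :=
  (∃ i j, i < j ∧ a = intBasis i - intBasis j) ∨
    (∃ i j, i < j ∧ a = intBasis i + intBasis j) ∨ ∃ i, a = intBasis i + intBasis i

/-- The roots whose affine hyperplanes at level `1` belong to the deleted Shi arrangement. -/
def IsIntShiRoot (M : Finset (Fin n)) (a : Fin n → ℤ) : Prop :=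
  (∃ m ∈ M, ∃ l, follows M m l ∧ a = intBasis m - intBasis l) ∨
    (∃ m ∈ M, ∃ m' ∈ M, m < m' ∧ a = intBasis m + intBasis m') ∨
    ∃ m ∈ M, a = intBasis m + intBasis m

theorem IsIntShiRoot.isIntPosRoot {M : Finset (Fin n)} {a : Fin n → ℤ} (ha : IsIntShiRoot M a) :
    IsIntPosRoot a := by
  rcases ha with ⟨m, -, l, ⟨m', -, h1, h2⟩, rfl⟩ | ⟨m, -, m', -, h, rfl⟩ | ⟨m, -, rfl⟩
  · refine Or.inl ⟨m, l, ?_, rfl⟩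
    have := Fin.le_def.1 h1
    exact Fin.lt_def.2 (by omega)
  · exact Or.inr (Or.inl ⟨m, m', h, rfl⟩)
  · exact Or.inr (Or.inr ⟨m, rfl⟩)

theorem finite_isIntPosRoot : {a : Fin n → ℤ | IsIntPosRoot a}.Finite := by
  refine (((Set.finite_range fun p : Fin n × Fin n => intBasis p.1 - intBasis p.2).union
    (Set.finite_range fun p : Fin n × Fin n => intBasis p.1 + intBasis p.2))).subset ?_
  rintro a (⟨i, j, -, rfl⟩ | ⟨i, j, -, rfl⟩ | ⟨i, rfl⟩)
  · exact Or.inl ⟨(i, j), rfl⟩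
  · exact Or.inr ⟨(i, j), rfl⟩
  · exact Or.inr ⟨(i, i), rfl⟩

theorem finite_isIntShiRoot (M : Finset (Fin n)) : {a : Fin n → ℤ | IsIntShiRoot M a}.Finite :=
  finite_isIntPosRoot.subset fun _ ha => IsIntShiRoot.isIntPosRoot ha

/-- The equations of the members of the deleted Shi arrangement. -/
noncomputable def shiEquations (M : Finset (Fin n)) : Finset ((Fin n → ℤ) × ℤ) :=
  finite_isIntPosRoot.toFinset ×ˢ {0} ∪
    (finite_isIntShiRoot M).toFinset ×ˢ {1}

theorem mem_shiEquations {M : Finset (Fin n)} {t : (Fin n → ℤ) × ℤ} :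
    t ∈ shiEquations M ↔ (IsIntPosRoot t.1 ∧ t.2 = 0) ∨ (IsIntShiRoot M t.1 ∧ t.2 = 1) := by
  simp only [shiEquations, Finset.mem_union, Finset.mem_product, Set.Finite.mem_toFinset,
    Finset.mem_singleton]
  rfl

theorem sum_intBasis_mul (i : Fin n) (z : Fin n → ℤ) : ∑ j, intBasis i j * z j = z i := by
  simp [intBasis, Pi.single_apply]

theorem sum_add_mul (i j : Fin n) (z : Fin n → ℤ) :
    ∑ k, (intBasis i + intBasis j) k * z k = z i + z j := by
  simp only [Pi.add_apply, add_mul, Finset.sum_add_distrib, sum_intBasis_mul]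

theorem sum_sub_mul (i j : Fin n) (z : Fin n → ℤ) :
    ∑ k, (intBasis i - intBasis j) k * z k = z i - z j := by
  simp only [Pi.sub_apply, sub_mul, Finset.sum_sub_distrib, sum_intBasis_mul]

/-- The range is asymmetric because, with entries in `[-h, h]` and `q = 2h + 1`, an expression such
as `z i + z j - 1` can reach `-q` but not `q`. -/
theorem eq_of_dvd_of_abs_le {q w : ℤ} (hq : 0 < q) (hd : q ∣ w) (h1 : -q ≤ w) (h2 : w < q) :
    w = 0 ∨ w = -q := by
  obtain ⟨c, rfl⟩ := hd
  have h3 : c < 1 := by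
    by_contra h; push Not at h; nlinarith
  have h4 : -1 ≤ c := by
    by_contra h; push Not at h
    have : c + 2 ≤ 0 := by omega
    nlinarith
  have : c = 0 ∨ c = -1 := by omega
  rcases this with rfl | rfl
  · left; ring
  · right; ring

/-- By size, divisibility leaves only the values `0` and `-q`. At level 0 the value `-q` is out of
reach, and at level 1 it forces an entry `-h` at an index in `M`, which is the condition `ne_neg`.
-/
theorem isPlacement_iff_not_dvd (M : Finset (Fin n)) (h : ℕ) (z : Fin n → ℤ)
    (hz : ∀ i, -(h : ℤ) ≤ z i ∧ z i ≤ h) :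
    IsPlacement Finset.univ M h z ↔
      ∀ t ∈ shiEquations M, ¬ (2 * (h : ℤ) + 1) ∣ ∑ j, t.1 j * z j - t.2 := by
  have hq : (0 : ℤ) < 2 * h + 1 := by omega
  have hd : ∀ {w : ℤ}, (2 * (h : ℤ) + 1) ∣ w → -(2 * (h : ℤ) + 1) ≤ w → w < 2 * h + 1 →
      w = 0 ∨ w = -(2 * h + 1) := fun h1 h2 h3 => eq_of_dvd_of_abs_le hq h1 h2 h3
  constructor
  · rintro hx ⟨a, b⟩ ht hdvd
    rcases mem_shiEquations.1 ht with ⟨ha, hb⟩ | ⟨ha, hb⟩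
    · simp only at ha hb hdvd
      subst hb
      rcases ha with ⟨i, j, hij, rfl⟩ | ⟨i, j, hij, rfl⟩ | ⟨i, rfl⟩
      · rw [sum_sub_mul] at hdvd
        have hi := hz i
        have hj := hz j
        have := hx.distinct i (Finset.mem_univ i) j (Finset.mem_univ j) hij.ne
        have := hd hdvd (by omega) (by omega)
        omega
      · rw [sum_add_mul] at hdvd
        have hi := hz i
        have hj := hz j
        have := hx.distinct i (Finset.mem_univ i) j (Finset.mem_univ j) hij.ne
        have := hd hdvd (by omega) (by omega)
        omega
      · rw [sum_add_mul] at hdvd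
        have hi := hz i
        have := hx.ne_zero i (Finset.mem_univ i)
        have := hd hdvd (by omega) (by omega)
        omega
    · simp only at ha hb hdvd
      subst hb
      rcases ha with ⟨i, hi, l, hl, rfl⟩ | ⟨i, hi, j, hj, hij, rfl⟩ | ⟨i, hi, rfl⟩
      · rw [sum_sub_mul] at hdvd
        have h1 := hz i
        have h2 := hz l
        have h3 := hx.ne_neg i hi
        have h4 := hx.ne_succ i hi l hl
        have := hd hdvd (by omega) (by omega)
        omega
      · rw [sum_add_mul] at hdvd
        have h1 := hz i
        have h2 := hz j
        have h3 := hx.ne_neg i hi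
        have h4 := hx.add_ne i hi j hj hij.ne
        have := hd hdvd (by omega) (by omega)
        omega
      · rw [sum_add_mul] at hdvd
        have h1 := hz i
        have h3 := hx.ne_neg i hi
        have := hd hdvd (by omega) (by omega)
        omega
  · intro H
    have h0 : ∀ a, IsIntPosRoot a → ∑ j, a j * z j ≠ 0 := fun a ha h0 =>
      H (a, 0) (mem_shiEquations.2 (Or.inl ⟨ha, rfl⟩)) (by simp [h0])
    have h1 : ∀ a, IsIntShiRoot M a → ∑ j, a j * z j ≠ 1 := fun a ha h1 =>
      H (a, 1) (mem_shiEquations.2 (Or.inr ⟨ha, rfl⟩)) (by simp [h1])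
    have hlt : ∀ i j, i < j → z i ≠ z j ∧ z i ≠ -z j := by
      intro i j hij
      have e1 := h0 _ (Or.inl ⟨i, j, hij, rfl⟩)
      have e2 := h0 _ (Or.inr (Or.inl ⟨i, j, hij, rfl⟩))
      rw [sum_sub_mul] at e1
      rw [sum_add_mul] at e2
      omega
    refine ⟨by simp, fun i _ => ?_, fun i _ => hz i, fun i _ j _ hij => ?_, fun i hi => ?_,
      fun i hi j hj hij => ?_, fun i hi l hl => ?_⟩
    · have := h0 _ (Or.inr (Or.inr ⟨i, rfl⟩))
      rw [sum_add_mul] at this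
      omega
    · rcases lt_or_gt_of_ne hij with h2 | h2
      · exact hlt i j h2
      · have := hlt j i h2
        omega
    · have := H (_, 1) (mem_shiEquations.2 (Or.inr ⟨Or.inr (Or.inr ⟨i, hi, rfl⟩), rfl⟩))
      simp only [sum_add_mul] at this
      intro e
      exact this ⟨-1, by rw [e]; ring⟩
    · rcases lt_or_gt_of_ne hij with h2 | h2
      · have := h1 _ (Or.inr (Or.inl ⟨i, hi, j, hj, h2, rfl⟩))
        rwa [sum_add_mul] at this
      · have := h1 _ (Or.inr (Or.inl ⟨j, hj, i, hi, h2, rfl⟩))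
        rw [sum_add_mul] at this
        omega
    · have := h1 _ (Or.inl ⟨i, hi, l, hl, rfl⟩)
      rw [sum_sub_mul] at this
      omega

theorem ncard_complement_shiEquations (M : Finset (Fin n)) (h q : ℕ) (hq : q = 2 * h + 1) :
    ({x | ∀ t ∈ shiEquations M, ∑ j, (t.1 j : ZMod q) * x j ≠ t.2} :
      Set (Fin n → ZMod q)).ncard = (placements Finset.univ M (h : ℤ)).card := by
  have : NeZero q := ⟨by omega⟩
  have hcast : ∀ (z : Fin n → ℤ) (t : (Fin n → ℤ) × ℤ),
      ∑ j, (t.1 j : ZMod q) * (z j : ZMod q) ≠ t.2 ↔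
        ¬ (2 * (h : ℤ) + 1) ∣ ∑ j, t.1 j * z j - t.2 := by
    intro z t
    have e : (2 * (h : ℤ) + 1) = ((q : ℕ) : ℤ) := by rw [hq]; push_cast; ring
    rw [e, ← ZMod.intCast_zmod_eq_zero_iff_dvd, ne_eq, ← sub_eq_zero]
    push_cast
    rfl
  have hset : ({x | ∀ t ∈ shiEquations M, ∑ j, (t.1 j : ZMod q) * x j ≠ t.2} :
      Set (Fin n → ZMod q)) =
      (fun (z : Fin n → ℤ) j => (z j : ZMod q)) '' (placements Finset.univ M (h : ℤ)) := by
    ext x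
    constructor
    · intro hx
      -- As `q` is odd, the representatives of least absolute value are exactly the integers in
      -- `[-h, h]`.
      refine ⟨fun j => (x j).valMinAbs, ?_, ?_⟩
      · refine Finset.mem_coe.2 (mem_placements.2 ((isPlacement_iff_not_dvd M h _ ?_).2 ?_))
        · intro i
          have := (x i).valMinAbs_mem_Ioc
          rw [Set.mem_Ioc] at this
          omega
        · intro t ht
          rw [← hcast]
          simpa using hx t ht
      · funext j
        simp
    · rintro ⟨z, hz, rfl⟩ t ht
      have hz := mem_placements.1 (Finset.mem_coe.1 hz)
      exact (hcast z t).2 ((isPlacement_iff_not_dvd M h z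
        fun i => hz.mem i (Finset.mem_univ i)).1 hz t ht)
  rw [hset, Set.InjOn.ncard_image, Set.ncard_coe_finset]
  intro y hy z hz hyz
  have hy := mem_placements.1 (Finset.mem_coe.1 hy)
  have hz := mem_placements.1 (Finset.mem_coe.1 hz)
  funext i
  have h1 := (ZMod.intCast_eq_intCast_iff_dvd_sub _ _ _).1 (congrFun hyz i)
  have h2 := hy.mem i (Finset.mem_univ i)
  have h3 := hz.mem i (Finset.mem_univ i)
  have := eq_of_dvd_of_abs_le (by omega) h1 (by omega) (by omega)
  omega

/-- The characteristic polynomial of the deleted Shi arrangement with equations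
`shiEquations M`. -/
theorem whitneySum_shiEquations (M : Finset (Fin n)) (ζ : ℤ)
    (hζ : M.Nonempty → ((successors M).card : ℤ) + 1 = M.card + ζ) :
    whitneySum intHyperplane (shiEquations M) ⊤ =
      (Polynomial.X - Polynomial.C (2 * (M.card : ℤ) + ζ)) ^ M.card *
        ∏ i ∈ Finset.range (n - M.card),
          (Polynomial.X - Polynomial.C (2 * (M.card : ℤ) + 1 + 2 * (i : ℤ))) := by
  obtain ⟨D, hD, hcount⟩ := exists_card_complement_eq_eval (shiEquations M)
  -- Two polynomials agreeing at infinitely many primes are equal. The bound on `p` makes `D`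
  -- nonzero modulo `p`, makes `p` odd, and gives `n ≤ h`.
  refine Polynomial.eq_of_infinite_eval_eq _ _ (Set.Infinite.mono (s := (fun p : ℕ => (p : ℤ)) ''
    {p | p.Prime ∧ D.natAbs + 2 * n + 2 < p}) ?_ (Set.Infinite.image
      (fun a _ b _ hab => Nat.cast_injective hab) ?_))
  · rintro _ ⟨p, ⟨hp, hlt⟩, rfl⟩
    have : Fact p.Prime := ⟨hp⟩
    have hDp : (D : ZMod p) ≠ 0 := by
      rw [ne_eq, ZMod.intCast_zmod_eq_zero_iff_dvd]
      intro hdvd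
      have := Nat.le_of_dvd (Int.natAbs_pos.2 hD) (Int.natCast_dvd.1 hdvd)
      omega
    obtain ⟨h, hh⟩ := hp.odd_of_ne_two (by omega)
    change Polynomial.eval (p : ℤ) _ = Polynomial.eval (p : ℤ) _
    rw [← hcount p hDp, ncard_complement_shiEquations M h p hh,
      card_placements_eq ζ Finset.univ M h (Finset.subset_univ _) (Finset.subset_univ _) hζ
        (by rw [Finset.card_univ, Fintype.card_fin]; omega),
      Polynomial.eval_mul, Polynomial.eval_pow, Polynomial.eval_prod, Finset.card_univ,
      Fintype.card_fin, hh]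
    simp only [Polynomial.eval_sub, Polynomial.eval_X, Polynomial.eval_C]
    push_cast
    congr 1
    · congr 1
      ring
    · refine Finset.prod_congr rfl fun i _ => ?_
      ring
  · rw [Set.infinite_iff_exists_gt]
    intro N
    obtain ⟨p, hp1, hp2⟩ := Nat.exists_infinite_primes (N + (D.natAbs + 2 * n + 2) + 1)
    exact ⟨p, ⟨hp2, by omega⟩, by omega⟩

end IntegerModel

/-! ### Roots of type `C_n` in integer coordinates -/

section RootModel

variable {n : ℕ}

theorem intVec_injective : Function.Injective (intVec (n := n)) := by
  intro a b h
  funext i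
  have := congrArg (fun v : EuclideanSpace ℝ (Fin n) => v i) h
  simpa [intVec] using this

theorem intVec_add (a b : Fin n → ℤ) : intVec (a + b) = intVec a + intVec b := by
  ext i; simp [intVec]

theorem intVec_sub (a b : Fin n → ℤ) : intVec (a - b) = intVec a - intVec b := by
  ext i; simp [intVec]

theorem intVec_neg (a : Fin n → ℤ) : intVec (-a) = -intVec a := by
  ext i; simp [intVec]

theorem intVec_intBasis (i : Fin n) : intVec (intBasis i) = e i := by
  ext j
  simp [intVec, intBasis, e, Pi.single_apply]

theorem intVec_two (i : Fin n) : intVec (intBasis i + intBasis i) = (2 : ℝ) • e i := by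
  rw [intVec_add, intVec_intBasis, two_smul]

theorem mem_posRoots {β : EuclideanSpace ℝ (Fin n)} :
    β ∈ posRoots n ↔ ∃ a, IsIntPosRoot a ∧ intVec a = β := by
  simp only [posRoots, Finset.mem_union, Finset.mem_image, Finset.mem_filter, Finset.mem_univ,
    true_and, Prod.exists]
  constructor
  · rintro ((⟨i, j, h, rfl⟩ | ⟨i, j, h, rfl⟩) | ⟨i, rfl⟩)
    · exact ⟨_, Or.inl ⟨i, j, h, rfl⟩, by rw [intVec_sub, intVec_intBasis, intVec_intBasis]⟩
    · exact ⟨_, Or.inr (Or.inl ⟨i, j, h, rfl⟩), by rw [intVec_add, intVec_intBasis, intVec_intBasis]⟩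
    · exact ⟨_, Or.inr (Or.inr ⟨i, rfl⟩), intVec_two i⟩
  · rintro ⟨_, ⟨i, j, h, rfl⟩ | ⟨i, j, h, rfl⟩ | ⟨i, rfl⟩, rfl⟩
    · exact Or.inl (Or.inl ⟨i, j, h, by rw [intVec_sub, intVec_intBasis, intVec_intBasis]⟩)
    · exact Or.inl (Or.inr ⟨i, j, h, by rw [intVec_add, intVec_intBasis, intVec_intBasis]⟩)
    · exact Or.inr ⟨i, (intVec_two i).symm⟩

theorem intVec_mem_posRoots {a : Fin n → ℤ} : intVec a ∈ posRoots n ↔ IsIntPosRoot a := by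
  rw [mem_posRoots]
  exact ⟨fun ⟨b, hb, h⟩ => intVec_injective h ▸ hb, fun h => ⟨a, h, rfl⟩⟩

theorem intVec_mem_allRoots {a : Fin n → ℤ} :
    intVec a ∈ allRoots n ↔ IsIntPosRoot a ∨ IsIntPosRoot (-a) := by
  simp only [allRoots, Finset.mem_union, Finset.mem_image, intVec_mem_posRoots]
  refine or_congr_right ⟨?_, fun h => ⟨_, intVec_mem_posRoots.2 h, ?_⟩⟩
  · rintro ⟨β, hβ, h⟩
    rw [← intVec_mem_posRoots, intVec_neg, ← h, neg_neg]
    exact hβ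
  · rw [intVec_neg, neg_neg]

/-- The simple root with index `i`, as an integer vector. -/
def intSimple (i : Fin n) : Fin n → ℤ :=
  if h : (i : ℕ) + 1 < n then intBasis i - intBasis ⟨i + 1, h⟩ else intBasis i + intBasis i

theorem intBasis_apply (i j : Fin n) : intBasis i j = if (j : ℕ) = i then 1 else 0 := by
  simp [intBasis, Pi.single_apply, Fin.ext_iff]

theorem intSimple_of_succ {i j : Fin n} (h : (i : ℕ) + 1 = j) :
    intSimple i = intBasis i - intBasis j := by
  have hi : (i : ℕ) + 1 < n := by omega
  have hj : (⟨i + 1, hi⟩ : Fin n) = j := Fin.ext h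
  rw [intSimple, dif_pos hi, hj]

theorem intSimple_of_last {i : Fin n} (h : (i : ℕ) + 1 = n) :
    intSimple i = intBasis i + intBasis i := by
  rw [intSimple, dif_neg (by omega)]

theorem succ_or_last (i : Fin n) : (∃ j : Fin n, (i : ℕ) + 1 = j) ∨ (i : ℕ) + 1 = n := by
  by_cases h : (i : ℕ) + 1 < n
  · exact Or.inl ⟨⟨i + 1, h⟩, rfl⟩
  · right; omega

theorem isIntPosRoot_intSimple (i : Fin n) : IsIntPosRoot (intSimple i) := by
  rcases succ_or_last i with ⟨j, hj⟩ | hi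
  · rw [intSimple_of_succ hj]
    exact Or.inl ⟨i, j, Fin.lt_def.2 (by omega), rfl⟩
  · rw [intSimple_of_last hi]
    exact Or.inr (Or.inr ⟨i, rfl⟩)

theorem intSimple_injective : Function.Injective (intSimple (n := n)) := by
  have key : ∀ i j : Fin n, (i : ℕ) < j → intSimple i ≠ intSimple j := by
    intro i j hij h
    have h1 := congrFun h i
    rcases succ_or_last i with ⟨i', hi⟩ | hi
    · rw [intSimple_of_succ hi] at h1
      rcases succ_or_last j with ⟨j', hj⟩ | hj
      · rw [intSimple_of_succ hj] at h1
        simp only [Pi.sub_apply, intBasis_apply] at h1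
        split_ifs at h1 <;> omega
      · rw [intSimple_of_last hj] at h1
        simp only [Pi.sub_apply, Pi.add_apply, intBasis_apply] at h1
        split_ifs at h1 <;> omega
    · omega
  intro i j h
  rcases lt_trichotomy (i : ℕ) j with h1 | h1 | h1
  · exact absurd h (key i j h1)
  · exact Fin.ext h1
  · exact absurd h.symm (key j i h1)

theorem mem_simpleRoots {β : EuclideanSpace ℝ (Fin n)} :
    β ∈ simpleRoots n ↔ ∃ i, intVec (intSimple i) = β := by
  simp only [simpleRoots, Finset.mem_union, Finset.mem_image, Finset.mem_filter, Finset.mem_univ,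
    true_and, Prod.exists]
  constructor
  · rintro (⟨i, j, h, rfl⟩ | ⟨i, h, rfl⟩)
    · exact ⟨i, by rw [intSimple_of_succ h, intVec_sub, intVec_intBasis, intVec_intBasis]⟩
    · exact ⟨i, by rw [intSimple_of_last h, intVec_two]⟩
  · rintro ⟨i, rfl⟩
    rcases succ_or_last i with ⟨j, h⟩ | h
    · exact Or.inl ⟨i, j, h, by
        rw [intSimple_of_succ h, intVec_sub, intVec_intBasis, intVec_intBasis]⟩
    · exact Or.inr ⟨i, h, by rw [intSimple_of_last h, intVec_two]⟩

open Classical in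
/-- The indices of the simple roots outside `I`. -/
noncomputable def omitted (I : Finset (EuclideanSpace ℝ (Fin n))) : Finset (Fin n) :=
  Finset.univ.filter fun i => intVec (intSimple i) ∉ I

theorem mem_omitted {I : Finset (EuclideanSpace ℝ (Fin n))} {i : Fin n} :
    i ∈ omitted I ↔ intVec (intSimple i) ∉ I := by
  simp [omitted]

theorem card_omitted {I : Finset (EuclideanSpace ℝ (Fin n))} (hI : I ⊆ simpleRoots n) :
    (omitted I).card + I.card = n := by
  classical
  have h1 : I = (omitted I)ᶜ.image fun i => intVec (intSimple i) := by
    ext β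
    simp only [Finset.mem_image, Finset.mem_compl, mem_omitted, not_not]
    constructor
    · intro hβ
      obtain ⟨i, rfl⟩ := mem_simpleRoots.1 (hI hβ)
      exact ⟨i, hβ, rfl⟩
    · rintro ⟨i, hi, rfl⟩
      exact hi
  have h2 : I.card = (omitted I)ᶜ.card := by
    conv_lhs => rw [h1]
    exact Finset.card_image_of_injective _ (intVec_injective.comp intSimple_injective)
  rw [h2, Finset.card_add_card_compl, Fintype.card_fin]

/-- The sum of the coordinates with index at most `m`. -/
def prefixSum (m : Fin n) (a : Fin n → ℤ) : ℤ := ∑ i ∈ Finset.Iic m, a i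

theorem prefixSum_intBasis (m i : Fin n) :
    prefixSum m (intBasis i) = if (i : ℕ) ≤ m then 1 else 0 := by
  simp [prefixSum, intBasis, Pi.single_apply]

theorem prefixSum_add (m : Fin n) (a b : Fin n → ℤ) :
    prefixSum m (a + b) = prefixSum m a + prefixSum m b := by
  simp [prefixSum, Finset.sum_add_distrib]

theorem prefixSum_sub (m : Fin n) (a b : Fin n → ℤ) :
    prefixSum m (a - b) = prefixSum m a - prefixSum m b := by
  simp [prefixSum, Finset.sum_sub_distrib]

theorem prefixSum_intSimple_of_ne {m i : Fin n} (h : i ≠ m) : prefixSum m (intSimple i) = 0 := by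
  have h : (i : ℕ) ≠ m := fun e => h (Fin.ext e)
  rcases succ_or_last i with ⟨j, hj⟩ | hi
  · rw [intSimple_of_succ hj, prefixSum_sub, prefixSum_intBasis, prefixSum_intBasis]
    split_ifs <;> omega
  · rw [intSimple_of_last hi, prefixSum_add, prefixSum_intBasis]
    split_ifs <;> omega

/-- The form `prefixSum m` vanishes on every simple root except the one with index `m`, hence on the
span of `I` when that one is omitted. -/
theorem prefixSum_eq_zero_of_mem_span {I : Finset (EuclideanSpace ℝ (Fin n))}
    (hI : I ⊆ simpleRoots n) {a : Fin n → ℤ}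
    (ha : intVec a ∈ Submodule.span ℝ (I : Set (EuclideanSpace ℝ (Fin n)))) {m : Fin n}
    (hm : m ∈ omitted I) : prefixSum m a = 0 := by
  let f : EuclideanSpace ℝ (Fin n) →ₗ[ℝ] ℝ :=
    { toFun := fun v => ∑ i ∈ Finset.Iic m, v i
      map_add' := fun v w => by simp [Finset.sum_add_distrib]
      map_smul' := fun c v => by simp [Finset.mul_sum] }
  have hf : ∀ b : Fin n → ℤ, f (intVec b) = (prefixSum m b : ℝ) := by
    intro b
    change ∑ i ∈ Finset.Iic m, intVec b i = _
    simp [intVec, prefixSum]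
  have hle : Submodule.span ℝ (I : Set (EuclideanSpace ℝ (Fin n))) ≤ LinearMap.ker f := by
    rw [Submodule.span_le]
    intro β hβ
    obtain ⟨i, rfl⟩ := mem_simpleRoots.1 (hI hβ)
    have him : i ≠ m := by
      rintro rfl
      exact mem_omitted.1 hm hβ
    rw [SetLike.mem_coe, LinearMap.mem_ker, hf, prefixSum_intSimple_of_ne him, Int.cast_zero]
  have := LinearMap.mem_ker.1 (hle ha)
  rw [hf] at this
  exact_mod_cast this

/-- A positive entry at `m` would need a negative entry before it to cancel, but in a positive root
the negative entry comes second. -/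
theorem IsIntPosRoot.apply_nonpos {a : Fin n → ℤ} (ha : IsIntPosRoot a) {m : Fin n}
    (h : prefixSum m a = 0) : a m ≤ 0 := by
  rcases ha with ⟨i, j, hij, rfl⟩ | ⟨i, j, hij, rfl⟩ | ⟨i, rfl⟩
  · have hij := Fin.lt_def.1 hij
    rw [prefixSum_sub, prefixSum_intBasis, prefixSum_intBasis] at h
    rw [Pi.sub_apply, intBasis_apply, intBasis_apply]
    split_ifs at * <;> omega
  · have hij := Fin.lt_def.1 hij
    rw [prefixSum_add, prefixSum_intBasis, prefixSum_intBasis] at h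
    rw [Pi.add_apply, intBasis_apply, intBasis_apply]
    split_ifs at * <;> omega
  · rw [prefixSum_add, prefixSum_intBasis] at h
    rw [Pi.add_apply, intBasis_apply]
    split_ifs at * <;> omega

/-- A negative entry at `m + 1` would have its positive partner at an index at most `m`, giving
prefix sum 1. -/
theorem IsIntPosRoot.apply_nonneg {a : Fin n → ℤ} (ha : IsIntPosRoot a) {m l : Fin n}
    (hl : (m : ℕ) + 1 = l) (h : prefixSum m a = 0) : 0 ≤ a l := by
  rcases ha with ⟨i, j, hij, rfl⟩ | ⟨i, j, hij, rfl⟩ | ⟨i, rfl⟩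
  · have hij := Fin.lt_def.1 hij
    rw [prefixSum_sub, prefixSum_intBasis, prefixSum_intBasis] at h
    rw [Pi.sub_apply, intBasis_apply, intBasis_apply]
    split_ifs at * <;> omega
  · rw [Pi.add_apply, intBasis_apply, intBasis_apply]
    split_ifs <;> omega
  · rw [Pi.add_apply, intBasis_apply]
    split_ifs <;> omega

theorem IsIntPosRoot.ne_zero {a : Fin n → ℤ} (ha : IsIntPosRoot a) : a ≠ 0 := by
  rcases ha with ⟨i, j, hij, rfl⟩ | ⟨i, j, hij, rfl⟩ | ⟨i, rfl⟩ <;> intro h <;>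
    have h1 := congrFun h i
  · have hij := Fin.lt_def.1 hij
    rw [Pi.sub_apply, intBasis_apply, intBasis_apply, Pi.zero_apply] at h1
    split_ifs at * <;> omega
  · rw [Pi.add_apply, intBasis_apply, intBasis_apply, Pi.zero_apply] at h1
    split_ifs at * <;> omega
  · rw [Pi.add_apply, intBasis_apply, Pi.zero_apply] at h1
    split_ifs at * <;> omega

/-- A coarse normal form `±e_p ± e_q`, with `p = q` allowed. It also admits the zero vector, which
the coordinate bounds in the lemmas below exclude. -/
theorem exists_signs {c : Fin n → ℤ} (hc : IsIntPosRoot c ∨ IsIntPosRoot (-c)) :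
    ∃ (p q : Fin n) (s t : ℤ), (s = 1 ∨ s = -1) ∧ (t = 1 ∨ t = -1) ∧
      ∀ k, c k = (if (k : ℕ) = p then s else 0) + if (k : ℕ) = q then t else 0 := by
  have key : ∀ c : Fin n → ℤ, IsIntPosRoot c →
      ∃ (p q : Fin n) (s t : ℤ), (s = 1 ∨ s = -1) ∧ (t = 1 ∨ t = -1) ∧
      ∀ k, c k = (if (k : ℕ) = p then s else 0) + if (k : ℕ) = q then t else 0 := by
    rintro c (⟨i, j, -, rfl⟩ | ⟨i, j, -, rfl⟩ | ⟨i, rfl⟩)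
    · refine ⟨i, j, 1, -1, by simp, by simp, fun k => ?_⟩
      rw [Pi.sub_apply, intBasis_apply, intBasis_apply]
      split_ifs <;> rfl
    · exact ⟨i, j, 1, 1, by simp, by simp, fun k => by
        rw [Pi.add_apply, intBasis_apply, intBasis_apply]⟩
    · exact ⟨i, i, 1, 1, by simp, by simp, fun k => by
        rw [Pi.add_apply, intBasis_apply]⟩
  rcases hc with hc | hc
  · exact key c hc
  · obtain ⟨p, q, s, t, hs, ht, h⟩ := key _ hc
    refine ⟨p, q, -s, -t, by omega, by omega, fun k => ?_⟩
    have := h k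
    rw [Pi.neg_apply] at this
    split_ifs at * <;> omega

theorem eq_add_of_le {c : Fin n → ℤ} (hc : IsIntPosRoot c ∨ IsIntPosRoot (-c)) {i j : Fin n}
    (hij : i ≠ j) (hi : 1 ≤ c i) (hj : 1 ≤ c j) : c = intBasis i + intBasis j := by
  obtain ⟨p, q, s, t, hs, ht, h⟩ := exists_signs hc
  have hij : (i : ℕ) ≠ j := fun e => hij (Fin.ext e)
  rw [h] at hi hj
  funext k
  rw [h, Pi.add_apply, intBasis_apply, intBasis_apply]
  grind

theorem eq_sub_of_le {c : Fin n → ℤ} (hc : IsIntPosRoot c ∨ IsIntPosRoot (-c)) {i j : Fin n}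
    (hi : 1 ≤ c i) (hj : c j ≤ -1) : c = intBasis i - intBasis j := by
  obtain ⟨p, q, s, t, hs, ht, h⟩ := exists_signs hc
  rw [h] at hi hj
  funext k
  rw [h, Pi.sub_apply, intBasis_apply, intBasis_apply]
  grind

theorem eq_two_of_le {c : Fin n → ℤ} (hc : IsIntPosRoot c ∨ IsIntPosRoot (-c)) {i : Fin n}
    (hi : 2 ≤ c i) : c = intBasis i + intBasis i := by
  obtain ⟨p, q, s, t, hs, ht, h⟩ := exists_signs hc
  rw [h] at hi
  funext k
  rw [h, Pi.add_apply, intBasis_apply]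
  grind

end RootModel

/-! ### Determination of `C_I` and the characteristic polynomial -/

section ShiRoots

variable {n : ℕ} {I : Finset (EuclideanSpace ℝ (Fin n))}

theorem intVec_mem_subRoots_of_notMem_omitted {i : Fin n} (hi : i ∉ omitted I) :
    intVec (intSimple i) ∈ subRoots I := by
  rw [mem_omitted, not_not] at hi
  exact ⟨intVec_mem_allRoots.2 (Or.inl (isIntPosRoot_intSimple i)), Submodule.subset_span hi⟩

theorem prefixSum_eq_zero_of_mem_subRoots (hI : I ⊆ simpleRoots n) {a : Fin n → ℤ}
    (ha : intVec a ∈ subRoots I) {m : Fin n} (hm : m ∈ omitted I) : prefixSum m a = 0 :=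
  prefixSum_eq_zero_of_mem_span hI ha.2 hm

/-- From left to right it suffices to subtract simple roots of `I`: if an index that should be
omitted is not, the difference is a positive root or `b` itself lies in `Δ_I`. From right to left,
`prefixSum` shows that subtracting a positive root of `Δ_I` does not weaken the extreme coordinates
of `b`. -/
theorem intVec_mem_shiRoots (hI : I ⊆ simpleRoots n) {b : Fin n → ℤ} :
    intVec b ∈ shiRoots I ↔ IsIntShiRoot (omitted I) b := by
  simp only [shiRoots, Finset.mem_filter, intVec_mem_posRoots]
  constructor
  · rintro ⟨hb, hbI, hmin⟩
    have hsub : ∀ i, i ∉ omitted I → ¬ IsIntPosRoot (b - intSimple i) := by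
      intro i hi hroot
      refine hmin _ (intVec_mem_posRoots.2 (isIntPosRoot_intSimple i))
        (intVec_mem_subRoots_of_notMem_omitted hi) ?_
      rw [← intVec_sub, intVec_mem_allRoots]
      exact Or.inl hroot
    rcases hb with ⟨i, j, hij, rfl⟩ | ⟨i, j, hij, rfl⟩ | ⟨i, rfl⟩
    · have hij' := Fin.lt_def.1 hij
      left
      obtain ⟨i', hi'⟩ : ∃ i' : Fin n, (i : ℕ) + 1 = i' := ⟨⟨i + 1, by omega⟩, rfl⟩
      obtain ⟨j', hj'⟩ : ∃ j' : Fin n, (j' : ℕ) + 1 = j := ⟨⟨j - 1, by omega⟩, by simp; omega⟩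
      have hiM : i ∈ omitted I := by
        by_contra hi
        by_cases hi'j : i' = j
        · subst hi'j
          exact hbI (intSimple_of_succ hi' ▸ intVec_mem_subRoots_of_notMem_omitted hi)
        · have : (i' : ℕ) ≠ j := fun e => hi'j (Fin.ext e)
          refine hsub i hi (Or.inl ⟨i', j, Fin.lt_def.2 (by omega), ?_⟩)
          rw [intSimple_of_succ hi']
          abel
      have hjM : j' ∈ omitted I := by
        by_contra hj
        by_cases hij : i = j'
        · exact hj (hij ▸ hiM)
        · have : (i : ℕ) ≠ j' := fun e => hij (Fin.ext e)
          refine hsub j' hj (Or.inl ⟨i, j', Fin.lt_def.2 (by omega), ?_⟩)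
          rw [intSimple_of_succ hj']
          abel
      exact ⟨i, hiM, j, ⟨j', hjM, Fin.le_def.2 (by omega), hj'⟩, rfl⟩
    · have hij' := Fin.lt_def.1 hij
      right; left
      obtain ⟨i', hi'⟩ : ∃ i' : Fin n, (i : ℕ) + 1 = i' := ⟨⟨i + 1, by omega⟩, rfl⟩
      have hiM : i ∈ omitted I := by
        by_contra hi
        refine hsub i hi ?_
        have e : intBasis i + intBasis j - intSimple i = intBasis i' + intBasis j := by
          rw [intSimple_of_succ hi']; abel
        rw [e]
        by_cases hi'j : i' = j
        · exact Or.inr (Or.inr ⟨j, by rw [hi'j]⟩)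
        · have : (i' : ℕ) ≠ j := fun e => hi'j (Fin.ext e)
          exact Or.inr (Or.inl ⟨i', j, Fin.lt_def.2 (by omega), rfl⟩)
      have hjM : j ∈ omitted I := by
        by_contra hj
        refine hsub j hj ?_
        rcases succ_or_last j with ⟨j', hj'⟩ | hj'
        · refine Or.inr (Or.inl ⟨i, j', Fin.lt_def.2 (by omega), ?_⟩)
          rw [intSimple_of_succ hj']; abel
        · refine Or.inl ⟨i, j, hij, ?_⟩
          rw [intSimple_of_last hj']; abel
      exact ⟨i, hiM, j, hjM, hij, rfl⟩
    · right; right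
      refine ⟨i, ?_, rfl⟩
      by_contra hi
      rcases succ_or_last i with ⟨j, hj⟩ | hi'
      · refine hsub i hi (Or.inr (Or.inl ⟨i, j, Fin.lt_def.2 (by omega), ?_⟩))
        rw [intSimple_of_succ hj]; abel
      · exact hbI (intSimple_of_last hi' ▸ intVec_mem_subRoots_of_notMem_omitted hi)
  · intro hb
    refine ⟨hb.isIntPosRoot, fun hbI => ?_, fun α hα hαI hroot => ?_⟩
    · have h0 : ∀ m ∈ omitted I, prefixSum m b = 0 := fun m hm =>
        prefixSum_eq_zero_of_mem_subRoots hI hbI hm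
      rcases hb with ⟨m, hm, l, ⟨m', -, h1, h2⟩, rfl⟩ | ⟨m, hm, m', -, h, rfl⟩ | ⟨m, hm, rfl⟩ <;>
        have h3 := h0 m hm
      · have h1 := Fin.le_def.1 h1
        rw [prefixSum_sub, prefixSum_intBasis, prefixSum_intBasis] at h3
        split_ifs at h3 <;> omega
      · rw [prefixSum_add, prefixSum_intBasis, prefixSum_intBasis] at h3
        split_ifs at h3 <;> omega
      · rw [prefixSum_add, prefixSum_intBasis] at h3
        split_ifs at h3 <;> omega
    · obtain ⟨a, ha, rfl⟩ := mem_posRoots.1 hα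
      rw [← intVec_sub, intVec_mem_allRoots] at hroot
      have h0 : ∀ m ∈ omitted I, prefixSum m a = 0 := fun m hm =>
        prefixSum_eq_zero_of_mem_subRoots hI hαI hm
      -- A root is determined by these extreme coordinates, so `b - a` would have to be `b` again.
      suffices e : b - a = b from ha.ne_zero (by rwa [sub_eq_self] at e)
      rcases hb with ⟨m, hm, l, ⟨m', hm', h1, h2⟩, rfl⟩ | ⟨m, hm, m', hm', h, rfl⟩ | ⟨m, hm, rfl⟩
      · have h1 := Fin.le_def.1 h1
        have e1 := ha.apply_nonpos (h0 m hm)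
        have e2 := ha.apply_nonneg h2 (h0 m' hm')
        refine eq_sub_of_le hroot ?_ ?_ <;>
          rw [Pi.sub_apply, Pi.sub_apply, intBasis_apply, intBasis_apply] <;>
          split_ifs <;> omega
      · have h := Fin.lt_def.1 h
        have e1 := ha.apply_nonpos (h0 m hm)
        have e2 := ha.apply_nonpos (h0 m' hm')
        refine eq_add_of_le hroot (fun e => by rw [e] at h; omega) ?_ ?_ <;>
          rw [Pi.sub_apply, Pi.add_apply, intBasis_apply, intBasis_apply] <;>
          split_ifs <;> omega
      · have e1 := ha.apply_nonpos (h0 m hm)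
        refine eq_two_of_le hroot ?_
        rw [Pi.sub_apply, Pi.add_apply, intBasis_apply]
        split_ifs <;> omega

open Classical in
theorem shi_eq_image (hI : I ⊆ simpleRoots n) :
    shi I = (shiEquations (omitted I)).image
      fun t => hyperplane (intVec t.1) ((t.2 : ℤ) : ℝ) := by
  ext H
  simp only [shi, Finset.mem_union, Finset.mem_image, mem_shiEquations]
  constructor
  · rintro (⟨α, hα, rfl⟩ | ⟨α, hα, rfl⟩)
    · obtain ⟨a, ha, rfl⟩ := mem_posRoots.1 hα
      exact ⟨(a, 0), Or.inl ⟨ha, rfl⟩, by simp⟩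
    · obtain ⟨a, ha, rfl⟩ := mem_posRoots.1 (Finset.mem_filter.1 hα).1
      exact ⟨(a, 1), Or.inr ⟨(intVec_mem_shiRoots hI).1 hα, rfl⟩, by simp⟩
  · rintro ⟨⟨a, b⟩, ⟨ha, hb⟩ | ⟨ha, hb⟩, rfl⟩
    · simp only at ha hb
      subst hb
      exact Or.inl ⟨_, intVec_mem_posRoots.2 ha, by simp⟩
    · simp only at ha hb
      subst hb
      exact Or.inr ⟨_, (intVec_mem_shiRoots hI).2 ha, by simp⟩

theorem hyperplane_ne_top_of_mem_shiEquations {M : Finset (Fin n)} {t : (Fin n → ℤ) × ℤ}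
    (ht : t ∈ shiEquations M) :
    hyperplane (intVec t.1) ((t.2 : ℤ) : ℝ) ≠ ⊤ := by
  have ha : IsIntPosRoot t.1 := by
    rcases mem_shiEquations.1 ht with h | h
    · exact h.1
    · exact h.1.isIntPosRoot
  intro htop
  have h1 : ∀ v : EuclideanSpace ℝ (Fin n), inner ℝ v (intVec t.1) = ((t.2 : ℤ) : ℝ) := fun v =>
    mem_hyperplane.1 (htop ▸ AffineSubspace.mem_top ℝ _ v)
  have h2 : intVec t.1 = 0 := by
    rw [← inner_self_eq_zero (𝕜 := ℝ), h1, ← h1 0, inner_zero_left]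
  refine ha.ne_zero (intVec_injective ?_)
  rw [h2]
  ext i
  simp [intVec]

/-- The roots `2e_i` at level 0 already span, so the arrangement is essential and relatively bounded
means bounded. -/
theorem lineality_shiEquations (M : Finset (Fin n)) :
    lineality (fun t : (Fin n → ℤ) × ℤ => intVec t.1) (shiEquations M) = ⊥ := by
  rw [eq_bot_iff]
  intro v hv
  rw [Submodule.mem_bot]
  ext i
  have h := hv (intBasis i + intBasis i, 0)
    (mem_shiEquations.2 (Or.inl ⟨Or.inr (Or.inr ⟨i, rfl⟩), rfl⟩))
  simp only [intVec_two, real_inner_smul_right] at h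
  simpa [e, EuclideanSpace.inner_single_right] using h

/-- The characteristic polynomial of the deleted Shi arrangement. -/
theorem charPoly_shi (hI : I ⊆ simpleRoots n) (ζ : ℤ)
    (hζ : (omitted I).Nonempty →
      ((successors (omitted I)).card : ℤ) + 1 = (omitted I).card + ζ) :
    charPoly (shi I) =
      (Polynomial.X - Polynomial.C (2 * ((omitted I).card : ℤ) + ζ)) ^ (omitted I).card *
        ∏ i ∈ Finset.range (n - (omitted I).card),
          (Polynomial.X - Polynomial.C (2 * ((omitted I).card : ℤ) + 1 + 2 * (i : ℤ))) := by
  rw [shi_eq_image hI, charPoly_image_eq_whitneySum _ _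
    fun t ht => hyperplane_ne_top_of_mem_shiEquations ht]
  exact whitneySum_shiEquations _ ζ hζ

theorem finite_regions_shi (hI : I ⊆ simpleRoots n) : (regions (shi I)).Finite := by
  rw [shi_eq_image hI]
  exact finite_regions_image

theorem ncard_regions_shi (hI : I ⊆ simpleRoots n) :
    ((regions (shi I)).ncard : ℤ) = (-1) ^ n * (charPoly (shi I)).eval (-1) := by
  have h := ncard_regions_eq_eval_charPoly (α := fun t : (Fin n → ℤ) × ℤ => intVec t.1)
    (k := fun t => ((t.2 : ℤ) : ℝ)) (s := shiEquations (omitted I))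
    fun t ht => hyperplane_ne_top_of_mem_shiEquations ht
  rwa [← shi_eq_image hI, finrank_euclideanSpace_fin] at h

theorem ncard_boundedRegions_shi (hI : I ⊆ simpleRoots n) :
    ((boundedRegions (shi I)).ncard : ℤ) = (-1) ^ n * (charPoly (shi I)).eval 1 := by
  have h := ncard_boundedRegions_eq_eval_charPoly (α := fun t : (Fin n → ℤ) × ℤ => intVec t.1)
    (k := fun t => ((t.2 : ℤ) : ℝ)) (s := shiEquations (omitted I))
    (fun t ht => hyperplane_ne_top_of_mem_shiEquations ht) (lineality_shiEquations _)
  rwa [← shi_eq_image hI, finrank_euclideanSpace_fin] at h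

/-- The shift `i ↦ i + 1` maps `M` without the last index bijectively onto the successors. This is
where membership of `2e_n` in `I` enters. -/
theorem card_successors (M : Finset (Fin n)) (hn : 0 < n) :
    (successors M).card + (if (⟨n - 1, by omega⟩ : Fin n) ∈ M then 1 else 0) = M.card := by
  classical
  have h1 : (successors M).card = (M.erase ⟨n - 1, by omega⟩).card := by
    symm
    refine Finset.card_bij (fun i hi => ⟨i + 1, ?_⟩) ?_ ?_ ?_
    · have := (Finset.mem_erase.1 hi).1
      rw [ne_eq, Fin.ext_iff] at this
      simp only at this
      omega
    · intro i hi
      exact mem_successors.2 ⟨i, (Finset.mem_erase.1 hi).2, rfl⟩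
    · intro i hi j hj h
      rw [Fin.mk.injEq] at h
      exact Fin.ext (by omega)
    · intro l hl
      obtain ⟨i, hi, hil⟩ := mem_successors.1 hl
      refine ⟨i, Finset.mem_erase.2 ⟨?_, hi⟩, Fin.ext hil⟩
      rintro rfl
      simp only at hil
      omega
  rw [h1]
  split_ifs with h
  · exact Finset.card_erase_add_one h
  · rw [Finset.erase_eq_of_notMem h, add_zero]

theorem last_mem_omitted_iff (hn : 0 < n) :
    (⟨n - 1, by omega⟩ : Fin n) ∈ omitted I ↔ (2 : ℝ) • e (⟨n - 1, by omega⟩ : Fin n) ∉ I := by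
  rw [mem_omitted, intSimple_of_last (by simp only; omega), intVec_two]

end ShiRoots

/-! ### Exponents, double factorials and the final count -/

section Exponents

theorem aroots_pow_mul_prod (c : ℤ) (a b : ℕ) (f : ℕ → ℤ) :
    ((Polynomial.X - Polynomial.C c) ^ a *
        ∏ i ∈ Finset.range b, (Polynomial.X - Polynomial.C (f i)) : ℤ[X]).aroots ℂ =
      Multiset.replicate a (c : ℂ) + (Multiset.range b).map fun i => (f i : ℂ) := by
  rw [Polynomial.aroots, ← Polynomial.roots_multiset_prod_X_sub_C
    (Multiset.replicate a (c : ℂ) + (Multiset.range b).map fun i => (f i : ℂ))]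
  congr 1
  rw [Polynomial.map_mul, Polynomial.map_pow, Polynomial.map_prod, Multiset.map_add,
    Multiset.prod_add, Multiset.map_replicate, Multiset.prod_replicate, Multiset.map_map]
  simp only [Polynomial.map_sub, Polynomial.map_X, Polynomial.map_C]
  rfl

theorem doubleFactorial_two_mul_add (k r : ℕ) :
    (Nat.doubleFactorial (2 * (k + r)) : ℚ) =
      (∏ i ∈ Finset.range r, (2 * (k : ℚ) + 2 + 2 * (i : ℚ))) * Nat.doubleFactorial (2 * k) := by
  induction r with
  | zero => simp
  | succ r ih =>
    have : 2 * (k + (r + 1)) = 2 * (k + r) + 2 := by ring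
    rw [this, Nat.doubleFactorial_add_two, Finset.prod_range_succ, Nat.cast_mul, ih]
    push_cast
    ring

variable {k r : ℕ} {I : Finset (EuclideanSpace ℝ (Fin (k + r)))}

open Classical in
theorem charPoly_shi_of_card (hI : I ⊆ simpleRoots (k + r)) (hr : I.card = r) (hk : 0 < k) (ζ : ℤ)
    (hζ : ζ = if (2 : ℝ) • e (⟨k + r - 1, by omega⟩ : Fin (k + r)) ∈ I then 1 else 0) :
    charPoly (shi I) = (Polynomial.X - Polynomial.C (2 * (k : ℤ) + ζ)) ^ k *
      ∏ i ∈ Finset.range r, (Polynomial.X - Polynomial.C (2 * (k : ℤ) + 1 + 2 * (i : ℤ))) := by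
  have hc : (omitted I).card = k := by
    have := card_omitted hI
    omega
  have h := charPoly_shi hI ζ fun _ => ?_
  · rwa [hc, Nat.add_sub_cancel_left] at h
  · have h1 := card_successors (omitted I) (by omega)
    rw [hζ]
    by_cases h2 : (2 : ℝ) • e (⟨k + r - 1, by omega⟩ : Fin (k + r)) ∈ I
    · rw [if_neg fun hh => (last_mem_omitted_iff (by omega)).1 hh h2] at h1
      rw [if_pos h2]
      omega
    · rw [if_pos ((last_mem_omitted_iff (by omega)).2 h2)] at h1
      rw [if_neg h2]
      omega

theorem ncard_regions_shi_of_charPoly (hI : I ⊆ simpleRoots (k + r)) {ζ : ℤ}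
    (h : charPoly (shi I) = (Polynomial.X - Polynomial.C (2 * (k : ℤ) + ζ)) ^ k *
      ∏ i ∈ Finset.range r, (Polynomial.X - Polynomial.C (2 * (k : ℤ) + 1 + 2 * (i : ℤ)))) :
    ((regions (shi I)).ncard : ℚ) = (2 * (k : ℚ) + ζ + 1) ^ k *
      Nat.doubleFactorial (2 * (k + r)) / Nat.doubleFactorial (2 * k) := by
  have h1 := ncard_regions_shi hI
  rw [h, Polynomial.eval_mul, Polynomial.eval_pow, Polynomial.eval_prod] at h1
  simp only [Polynomial.eval_sub, Polynomial.eval_X, Polynomial.eval_C] at h1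
  have h2 : ((regions (shi I)).ncard : ℤ) = (2 * (k : ℤ) + ζ + 1) ^ k *
      ∏ i ∈ Finset.range r, (2 * (k : ℤ) + 2 + 2 * (i : ℤ)) := by
    -- The sign `(-1) ^ (k + r)` is distributed over the `k + r` linear factors.
    rw [h1, pow_add, mul_mul_mul_comm, ← mul_pow, ← Finset.card_range r, ← Finset.prod_const,
      Finset.card_range, ← Finset.prod_mul_distrib]
    congr 1
    · ring
    · exact Finset.prod_congr rfl fun i _ => by ring
  have h3 : ((regions (shi I)).ncard : ℚ) = (2 * (k : ℚ) + ζ + 1) ^ k *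
      ∏ i ∈ Finset.range r, (2 * (k : ℚ) + 2 + 2 * (i : ℚ)) := by
    exact_mod_cast h2
  have h4 : (Nat.doubleFactorial (2 * k) : ℚ) ≠ 0 :=
    Nat.cast_ne_zero.2 (Nat.doubleFactorial_pos _).ne'
  rw [h3, doubleFactorial_two_mul_add, eq_div_iff h4]
  ring

theorem ncard_boundedRegions_shi_of_charPoly (hI : I ⊆ simpleRoots (k + r)) (hk : 0 < k) {ζ : ℤ}
    (h : charPoly (shi I) = (Polynomial.X - Polynomial.C (2 * (k : ℤ) + ζ)) ^ k *
      ∏ i ∈ Finset.range r, (Polynomial.X - Polynomial.C (2 * (k : ℤ) + 1 + 2 * (i : ℤ)))) :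
    ((boundedRegions (shi I)).ncard : ℚ) = (2 * (k : ℚ) + ζ - 1) ^ k *
      Nat.doubleFactorial (2 * (k + r) - 2) / Nat.doubleFactorial (2 * k - 2) := by
  have h1 := ncard_boundedRegions_shi hI
  rw [h, Polynomial.eval_mul, Polynomial.eval_pow, Polynomial.eval_prod] at h1
  simp only [Polynomial.eval_sub, Polynomial.eval_X, Polynomial.eval_C] at h1
  have h2 : ((boundedRegions (shi I)).ncard : ℤ) = (2 * (k : ℤ) + ζ - 1) ^ k *
      ∏ i ∈ Finset.range r, (2 * (k : ℤ) + 2 * (i : ℤ)) := by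
    rw [h1, pow_add, mul_mul_mul_comm, ← mul_pow, ← Finset.card_range r, ← Finset.prod_const,
      Finset.card_range, ← Finset.prod_mul_distrib]
    congr 1
    · ring
    · exact Finset.prod_congr rfl fun i _ => by ring
  have h3 : ((boundedRegions (shi I)).ncard : ℚ) = (2 * (k : ℚ) + ζ - 1) ^ k *
      ∏ i ∈ Finset.range r, (2 * (k : ℚ) + 2 * (i : ℚ)) := by
    exact_mod_cast h2
  -- Positivity of `k` makes `2 * k - 2` a genuine subtraction; the product, starting at `2k = 2l +
  -- 2`, is then a ratio of double factorials over `(2l)!!`.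
  obtain ⟨l, rfl⟩ : ∃ l, k = l + 1 := ⟨k - 1, by omega⟩
  have h4 : (Nat.doubleFactorial (2 * l) : ℚ) ≠ 0 :=
    Nat.cast_ne_zero.2 (Nat.doubleFactorial_pos _).ne'
  have e1 : 2 * (l + 1 + r) - 2 = 2 * (l + r) := by omega
  have e2 : 2 * (l + 1) - 2 = 2 * l := by omega
  have e3 : ∏ i ∈ Finset.range r, (2 * ((l + 1 : ℕ) : ℚ) + 2 * (i : ℚ)) =
      ∏ i ∈ Finset.range r, (2 * (l : ℚ) + 2 + 2 * (i : ℚ)) :=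
    Finset.prod_congr rfl fun i _ => by push_cast; ring
  rw [h3, e1, e2, e3, doubleFactorial_two_mul_add, eq_div_iff h4]
  ring

end Exponents

end ShiDeletion

theorem mainTheorem5 (n r : ℕ) (hn : 2 ≤ n) (hr : 1 ≤ r) (hrn : r ≤ n - 1) :
    -- the case `2 e_n ∈ I`
    ((∀ I J : Finset (EuclideanSpace ℝ (Fin n)),
        I ⊆ ShiDeletion.simpleRoots n → J ⊆ ShiDeletion.simpleRoots n →
        I.card = r → J.card = r →
        (2 : ℝ) • ShiDeletion.e (⟨n - 1, by omega⟩ : Fin n) ∈ I →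
        (2 : ℝ) • ShiDeletion.e (⟨n - 1, by omega⟩ : Fin n) ∈ J →
        ShiDeletion.charPoly (ShiDeletion.shi I) = ShiDeletion.charPoly (ShiDeletion.shi J)) ∧
      (∀ I : Finset (EuclideanSpace ℝ (Fin n)),
        I ⊆ ShiDeletion.simpleRoots n → I.card = r →
        (2 : ℝ) • ShiDeletion.e (⟨n - 1, by omega⟩ : Fin n) ∈ I →
        -- exponents `(2n-2r+1)^{n-r+1}, 2n-2r+3, 2n-2r+5, …, 2n-1`
        ShiDeletion.exponents (ShiDeletion.shi I) =
          Multiset.replicate (n - r + 1) (2 * (n : ℂ) - 2 * (r : ℂ) + 1) +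
            (Multiset.range (r - 1)).map
              (fun i : ℕ => 2 * (n : ℂ) - 2 * (r : ℂ) + 3 + 2 * (i : ℂ)) ∧
        (ShiDeletion.regions (ShiDeletion.shi I)).Finite ∧
        ((ShiDeletion.regions (ShiDeletion.shi I)).ncard : ℚ) =
          (2 * (n : ℚ) - 2 * (r : ℚ) + 2) ^ (n - r) *
            (Nat.doubleFactorial (2 * n) : ℚ) / (Nat.doubleFactorial (2 * n - 2 * r) : ℚ) ∧
        ((ShiDeletion.boundedRegions (ShiDeletion.shi I)).ncard : ℚ) =
          (2 * (n : ℚ) - 2 * (r : ℚ)) ^ (n - r) *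
            (Nat.doubleFactorial (2 * n - 2) : ℚ) /
              (Nat.doubleFactorial (2 * n - 2 * r - 2) : ℚ))) ∧
    -- the case `2 e_n ∉ I`
    ((∀ I J : Finset (EuclideanSpace ℝ (Fin n)),
        I ⊆ ShiDeletion.simpleRoots n → J ⊆ ShiDeletion.simpleRoots n →
        I.card = r → J.card = r →
        (2 : ℝ) • ShiDeletion.e (⟨n - 1, by omega⟩ : Fin n) ∉ I →
        (2 : ℝ) • ShiDeletion.e (⟨n - 1, by omega⟩ : Fin n) ∉ J →
        ShiDeletion.charPoly (ShiDeletion.shi I) = ShiDeletion.charPoly (ShiDeletion.shi J)) ∧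
      (∀ I : Finset (EuclideanSpace ℝ (Fin n)),
        I ⊆ ShiDeletion.simpleRoots n → I.card = r →
        (2 : ℝ) • ShiDeletion.e (⟨n - 1, by omega⟩ : Fin n) ∉ I →
        -- exponents `(2n-2r)^{n-r}, 2n-2r+1, 2n-2r+3, …, 2n-1`
        ShiDeletion.exponents (ShiDeletion.shi I) =
          Multiset.replicate (n - r) (2 * (n : ℂ) - 2 * (r : ℂ)) +
            (Multiset.range r).map
              (fun i : ℕ => 2 * (n : ℂ) - 2 * (r : ℂ) + 1 + 2 * (i : ℂ)) ∧
        (ShiDeletion.regions (ShiDeletion.shi I)).Finite ∧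
        ((ShiDeletion.regions (ShiDeletion.shi I)).ncard : ℚ) =
          (2 * (n : ℚ) - 2 * (r : ℚ) + 1) ^ (n - r) *
            (Nat.doubleFactorial (2 * n) : ℚ) / (Nat.doubleFactorial (2 * n - 2 * r) : ℚ) ∧
        ((ShiDeletion.boundedRegions (ShiDeletion.shi I)).ncard : ℚ) =
          (2 * (n : ℚ) - 2 * (r : ℚ) - 1) ^ (n - r) *
            (Nat.doubleFactorial (2 * n - 2) : ℚ) /
              (Nat.doubleFactorial (2 * n - 2 * r - 2) : ℚ))) := by
  obtain ⟨k, rfl⟩ : ∃ k, n = k + r := ⟨n - r, by omega⟩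
  have hk : 0 < k := by omega
  have e1 : k + r - r = k := by omega
  have e2 : 2 * (k + r) - 2 * r = 2 * k := by omega
  have e3 : 2 * (((k + r : ℕ) : ℚ)) - 2 * (r : ℚ) = 2 * k := by push_cast; ring
  have e4 : 2 * (((k + r : ℕ) : ℂ)) - 2 * (r : ℂ) = 2 * k := by push_cast; ring
  refine ⟨⟨fun I J hI hJ hIr hJr hI2 hJ2 => ?_, fun I hI hIr hI2 => ?_⟩,
    ⟨fun I J hI hJ hIr hJr hI2 hJ2 => ?_, fun I hI hIr hI2 => ?_⟩⟩
  · rw [ShiDeletion.charPoly_shi_of_card hI hIr hk 1 (if_pos hI2).symm,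
      ShiDeletion.charPoly_shi_of_card hJ hJr hk 1 (if_pos hJ2).symm]
  · have h := ShiDeletion.charPoly_shi_of_card hI hIr hk 1 (if_pos hI2).symm
    rw [e1, e2, e3, e4]
    refine ⟨?_, ShiDeletion.finite_regions_shi hI, ?_, ?_⟩
    -- For `ζ = 1` the factor with `i = 0` has the root `2k + 1` of the repeated factor, which
    -- raises the multiplicity to `k + 1`.
    · obtain ⟨q, rfl⟩ : ∃ q, r = q + 1 := ⟨r - 1, by omega⟩
      have h' : ShiDeletion.charPoly (ShiDeletion.shi I) =
          (Polynomial.X - Polynomial.C (2 * (k : ℤ) + 1)) ^ (k + 1) *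
            ∏ i ∈ Finset.range q, (Polynomial.X - Polynomial.C (2 * (k : ℤ) + 3 + 2 * (i : ℤ))) := by
        rw [h, Finset.prod_range_succ', pow_succ, mul_assoc, mul_comm (∏ _ ∈ _, _)]
        refine congrArg₂ (· * ·) rfl (congrArg₂ (· * ·) (by simp) ?_)
        refine Finset.prod_congr rfl fun i _ => ?_
        congr 2
        push_cast
        ring
      rw [ShiDeletion.exponents, h', ShiDeletion.aroots_pow_mul_prod, Nat.add_sub_cancel]
      push_cast
      rfl
    · rw [ShiDeletion.ncard_regions_shi_of_charPoly hI h]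
      push_cast
      ring
    · rw [ShiDeletion.ncard_boundedRegions_shi_of_charPoly hI hk h]
      push_cast
      ring
  · rw [ShiDeletion.charPoly_shi_of_card hI hIr hk 0 (if_neg hI2).symm,
      ShiDeletion.charPoly_shi_of_card hJ hJr hk 0 (if_neg hJ2).symm]
  · have h := ShiDeletion.charPoly_shi_of_card hI hIr hk 0 (if_neg hI2).symm
    rw [e1, e2, e3, e4]
    refine ⟨?_, ShiDeletion.finite_regions_shi hI, ?_, ?_⟩
    · rw [ShiDeletion.exponents, h, ShiDeletion.aroots_pow_mul_prod]
      push_cast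
      rw [add_zero]
    · rw [ShiDeletion.ncard_regions_shi_of_charPoly hI h]
      push_cast
      ring
    · rw [ShiDeletion.ncard_boundedRegions_shi_of_charPoly hI hk h]
      push_cast
      ring
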